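/- Let $\mathbb{C}H^n=\mathbb{C}H^n(c)$ be the complex hyperbolic space of complex dimension $n\ge 2$ and constant holomorphic sectional curvature $c<0$, with complex structure $J$, and let $k\in\{1,\dots,n-1\}$. Fix a totally geodesic $\mathbb{C}H^{n-k}$ in $\mathbb{C}H^n$ (a complex submanifold), a point $o\in\mathbb{C}H^{n-k}$ and a point at infinity $x\in\mathbb{C}H^{n-k}(\infty)$. Let $KAN$ be the Iwasawa decomposition of $SU(1,n)$ with respect to $o$ and $x$, with $\mathfrak{su}(1,n)=\mathfrak k\oplus\mathfrak a\oplus\mathfrak g_\alpha\oplus\mathfrak g_{2\alpha}$, where $\mathfrak k\oplus\mathfrak p$ is the Cartan decomposition at $o$, $\mathfrak a\subset\mathfrak p$ is maximal abelian, and the unit vector $B\in\mathfrak a$ with $\alpha(B)>0$ generates the geodesic $\operatorname{Exp}(tB)\cdot o$ from $o$ to $x$. Identify $T_o\mathbb{C}H^n$ with $\mathfrak a\oplus\mathfrak g_\alpha\oplus\mathfrak g_{2\alpha}$ by sending $X$ to the velocity of $\operatorname{Exp}(tX)\cdot o$ at $t=0$, and denote by $U\ominus V$ the set of the elements of $U$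 orthogonal to $V$. For a real subspace $\mathfrak w\subset\mathfrak g_\alpha$ let $W_{\mathfrak w}=S_{\mathfrak w}\cdot o$, where $S_{\mathfrak w}$ is the connected subgroup of $AN$ with Lie algebra $\mathfrak a\oplus\mathfrak w\oplus\mathfrak g_{2\alpha}$. Then there is a unique subgroup $\hat H$ of $AN$ that acts simply transitively on $\mathbb{C}H^{n-k}$; let $\hat{\mathfrak h}$ be its Lie algebra. Let $\mathfrak v$ be a proper real subspace of the normal space $\nu_o\mathbb{C}H^{n-k}$ such that $\mathfrak v\cap J\mathfrak v=0$. Then left translation of $\mathfrak v$ by $\hat H$ to all points of $\mathbb{C}H^{n-k}$, that is, $\mathfrak V_{h(o)}=h_*\mathfrak v$ for $h\in\hat H$, determines a smooth subbundle $\mathfrak V$, of rank $\dim\mathfrak v$, of the normal bundle $\nu\mathbb{C}H^{n-k}$. Moreover, the sum $\mathfrak w=(\hat{\mathfrak h}\ominus(\mathfrak a\oplus\mathfrak g_{2\alpha}))\oplus\mathfrak v$ is direct and is contained in $\mathfrak g_\alpha$. Let $M\subset\mathbb{C}H^n$ be the set obtained from $\mathbb{C}H^{n-k}$ by attaching, at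 each point $p\in\mathbb{C}H^{n-k}$, the horocycles determined by $x$ and the lines in $\mathfrak V_p$. Here the horocycle determined by $p$, a unit vector $U\in\mathfrak V_p$ and $x$ is the unit speed curve $\sigma$ with $\sigma(0)=p$, $\sigma'(0)=U$, $\nabla_{\sigma'}\nabla_{\sigma'}\sigma'+\langle\nabla_{\sigma'}\sigma',\nabla_{\sigma'}\sigma'\rangle\sigma'=0$ and $2(\nabla_{\sigma'}\sigma')(0)=\sqrt{-c}\,B_p$, where $B_p$ is the initial velocity of the unit speed geodesic from $p$ to $x$. Then $M$ is congruent to $W_{\mathfrak w}$, that is, an isometry of $\mathbb{C}H^n$ maps $M$ onto $W_{\mathfrak w}$. -/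

import Mathlib

open scoped Matrix ContDiff

noncomputable section

namespace ComplexHyperbolic

/-! ### The complex hyperbolic space as a Kähler manifold -/

/-- `ℂⁿ` with its Hermitian norm; also every tangent space of `ℂHⁿ` in the global chart used here.
The complex structure `J` is multiplication by `i`. -/
abbrev CE (n : ℕ) := EuclideanSpace ℂ (Fin n)

/-- The points of `ℂHⁿ`, in the affine chart `[z₀ : ⋯ : zₙ] ↦ (zᵢ / z₀)ᵢ`: the open unit ball. -/
def CH (n : ℕ) : Set (CE n) := Metric.ball 0 1

/-- The Riemannian metric of constant holomorphic sectional curvature `c < 0`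
(the Bergman metric of the ball). -/
def metric {n : ℕ} (c : ℝ) (z u v : CE n) : ℝ :=
  (4 / (-c)) * (((1 - ‖z‖ ^ 2 : ℝ) : ℂ) * inner ℂ u v + inner ℂ u z * inner ℂ z v).re
    / (1 - ‖z‖ ^ 2) ^ 2

/-- The Christoffel symbol of the Levi-Civita connection of `metric c`, as a bilinear map. -/
def christoffel {n : ℕ} (z u v : CE n) : CE n :=
  ((1 - ‖z‖ ^ 2 : ℝ) : ℂ)⁻¹ • (inner ℂ z u • v + inner ℂ z v • u)

theorem christoffel_symm {n : ℕ} (z u v : CE n) : christoffel z u v = christoffel z v u := by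
  simp only [christoffel, add_comm]

/-- Covariant derivative `∇_{γ'} X` of a vector field `X` along a curve `γ`. -/
def covDeriv {n : ℕ} (γ X : ℝ → CE n) (t : ℝ) : CE n :=
  deriv X t + christoffel (γ t) (deriv γ t) (X t)

/-- The connection is compatible with the metric; being torsion-free, it is the Levi-Civita
connection. -/
theorem hasDerivAt_metric {n : ℕ} (c : ℝ) {γ X Y : ℝ → CE n} {t : ℝ} (h : γ t ∈ CH n)
    (hγ : DifferentiableAt ℝ γ t) (hX : DifferentiableAt ℝ X t) (hY : DifferentiableAt ℝ Y t) :
    HasDerivAt (fun s => metric c (γ s) (X s) (Y s))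
      (metric c (γ t) (covDeriv γ X t) (Y t) + metric c (γ t) (X t) (covDeriv γ Y t)) t := by
  have hN : (1 - ‖γ t‖ ^ 2 : ℝ) ≠ 0 := by
    have h1 : ‖γ t‖ < 1 := by simpa [CH] using h
    nlinarith [norm_nonneg (γ t)]
  have key : ∀ z : CE n, ‖z‖ ^ 2 = (inner ℂ z z).re := fun z => by
    rw [← inner_self_eq_norm_sq (𝕜 := ℂ) z]; rfl
  have dN : HasDerivAt (fun s => (1 - ‖γ s‖ ^ 2 : ℝ)) (-(2 * (inner ℂ (γ t) (deriv γ t)).re)) t := by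
    have := hγ.hasDerivAt.inner ℂ hγ.hasDerivAt
    have h2 := (Complex.reCLM.hasFDerivAt.comp_hasDerivAt t this)
    have h3 := h2.const_sub 1
    refine (h3.congr_deriv ?_).congr_of_eventuallyEq (Filter.Eventually.of_forall fun s => ?_)
    · have := inner_conj_symm (𝕜 := ℂ) (deriv γ t) (γ t)
      simp only [Complex.reCLM_apply, Complex.add_re, ← this, Complex.conj_re]
      ring
    · simp [key]
  have dXY := hX.hasDerivAt.inner ℂ hY.hasDerivAt
  have dXz := hX.hasDerivAt.inner ℂ hγ.hasDerivAt
  have dzY := hγ.hasDerivAt.inner ℂ hY.hasDerivAt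
  have d1 := (Complex.reCLM.hasFDerivAt.comp_hasDerivAt t ((dN.ofReal_comp.mul dXY).add (dXz.mul dzY)))
  have d2 := ((d1.const_mul (4 / (-c))).div (dN.pow 2) (pow_ne_zero 2 hN))
  refine d2.congr_deriv ?_
  simp only [metric, covDeriv, christoffel, inner_add_left, inner_add_right, inner_smul_left,
    inner_smul_right, ← Complex.ofReal_inv, Complex.conj_ofReal, Function.comp, Pi.add_apply,
    Pi.mul_apply, Pi.pow_apply, Complex.reCLM_apply]
  rw [← inner_conj_symm (deriv X t) (γ t), ← inner_conj_symm (X t) (γ t),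
    ← inner_conj_symm (X t) (deriv γ t), ← inner_conj_symm (deriv γ t) (γ t)]
  generalize 1 - ‖γ t‖ ^ 2 = N at hN
  simp only [Complex.add_re, Complex.mul_re, Complex.add_im, Complex.mul_im, Complex.ofReal_re,
    Complex.ofReal_im, Complex.conj_re, Complex.conj_im]
  generalize 4 / -c = κ
  field_simp
  ring

/-- A geodesic of `ℂHⁿ`, defined on the whole real line. -/
def IsGeodesic {n : ℕ} (γ : ℝ → CE n) : Prop :=
  ContDiff ℝ ∞ γ ∧ (∀ t, γ t ∈ CH n) ∧ ∀ t, covDeriv γ (deriv γ) t = 0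

/-- A geodesic parametrized by arc length. -/
def IsUnitGeodesic {n : ℕ} (c : ℝ) (γ : ℝ → CE n) : Prop :=
  IsGeodesic γ ∧ ∀ t, metric c (γ t) (deriv γ t) (deriv γ t) = 1

/-- The Riemannian distance: the infimum of the lengths of curves joining two points. -/
def rdist {n : ℕ} (c : ℝ) (p q : CE n) : ℝ :=
  sInf {L : ℝ | ∃ γ : ℝ → CE n, ContDiff ℝ 1 γ ∧ (∀ t ∈ Set.Icc (0 : ℝ) 1, γ t ∈ CH n) ∧
    γ 0 = p ∧ γ 1 = q ∧
    L = ∫ t in (0 : ℝ)..1, Real.sqrt (metric c (γ t) (deriv γ t) (deriv γ t))}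

/-- Two curves are asymptotic if they stay at bounded distance for positive times. -/
def Asymptotic {n : ℕ} (c : ℝ) (γ₁ γ₂ : ℝ → CE n) : Prop :=
  ∃ C : ℝ, ∀ t : ℝ, 0 ≤ t → rdist c (γ₁ t) (γ₂ t) ≤ C

/-- A point at infinity of `ℂHⁿ`: an equivalence class of asymptotic unit speed geodesics. -/
def IsPointAtInfinity {n : ℕ} (c : ℝ) (x : Set (ℝ → CE n)) : Prop :=
  ∃ γ₀, IsUnitGeodesic c γ₀ ∧ x = {γ | IsUnitGeodesic c γ ∧ Asymptotic c γ₀ γ}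

/-- The point at infinity `x` belongs to the ideal boundary of the totally geodesic `S`. -/
def InIdealBoundary {n : ℕ} (S : Set (CE n)) (x : Set (ℝ → CE n)) : Prop :=
  ∃ γ ∈ x, ∀ t, γ t ∈ S

/-- The isometries of `ℂHⁿ`. -/
def IsIsometry {n : ℕ} (c : ℝ) (φ : CE n → CE n) : Prop :=
  Set.BijOn φ (CH n) (CH n) ∧ ContDiffOn ℝ ∞ φ (CH n) ∧
    ∀ z ∈ CH n, ∀ u v, metric c (φ z) (fderiv ℝ φ z u) (fderiv ℝ φ z v) = metric c z u v

/-- Congruence of subsets of `ℂHⁿ`. -/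
def IsCongruent {n : ℕ} (c : ℝ) (M W : Set (CE n)) : Prop :=
  ∃ φ : CE n → CE n, IsIsometry c φ ∧ φ '' M = W

/-- `S` is a totally geodesic `ℂHᵐ` in `ℂHⁿ`: the image of a smooth map `ℂHᵐ → ℂHⁿ` that is
holomorphic, preserves the metric, and maps geodesics to geodesics. -/
def IsTotallyGeodesicCH {n : ℕ} (c : ℝ) (m : ℕ) (S : Set (CE n)) : Prop :=
  ∃ f : CE m → CE n, S = f '' CH m ∧ Set.MapsTo f (CH m) (CH n) ∧ ContDiffOn ℝ ∞ f (CH m) ∧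
    (∀ z ∈ CH m, ∀ u, fderiv ℝ f z (Complex.I • u) = Complex.I • fderiv ℝ f z u) ∧
    (∀ z ∈ CH m, ∀ u v, metric c (f z) (fderiv ℝ f z u) (fderiv ℝ f z v) = metric c z u v) ∧
    ∀ γ : ℝ → CE m, IsGeodesic γ → IsGeodesic (f ∘ γ)

/-- The vectors tangent to `S` at `p`: velocities of smooth curves in `S`. -/
def tangentVectors {n : ℕ} (S : Set (CE n)) (p : CE n) : Set (CE n) :=
  {u | ∃ γ : ℝ → CE n, ContDiff ℝ ∞ γ ∧ (∀ t, γ t ∈ S) ∧ γ 0 = p ∧ deriv γ 0 = u}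

/-- The multiplication by `i`, as a real linear map. -/
def J (n : ℕ) : CE n →ₗ[ℝ] CE n :=
  (Complex.I • (LinearMap.id : CE n →ₗ[ℂ] CE n)).restrictScalars ℝ

/-- The metric as a real bilinear form. -/
def metricForm {n : ℕ} (c : ℝ) (z : CE n) : CE n →ₗ[ℝ] CE n →ₗ[ℝ] ℝ :=
  LinearMap.mk₂ ℝ (metric c z)
    (fun a b v => by
      simp only [metric, inner_add_left, add_mul, mul_add, Complex.add_re]; ring)
    (fun r a v => by
      simp only [metric, inner_smul_left_eq_star_smul, starRingEnd_apply, star_trivial,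
        smul_eq_mul, Complex.add_re, Complex.real_smul, mul_assoc, Complex.re_ofReal_mul]
      ring)
    (fun a b v => by
      simp only [metric, inner_add_right, mul_add, Complex.add_re]; ring)
    (fun r a v => by
      simp only [metric, inner_smul_right_eq_smul, smul_eq_mul,
        Complex.add_re, Complex.real_smul, mul_left_comm _ (r : ℂ),
        Complex.re_ofReal_mul]
      ring)

/-- The normal space `ν_p S`. -/
def normalSpace {n : ℕ} (c : ℝ) (S : Set (CE n)) (p : CE n) : Submodule ℝ (CE n) where
  carrier := {ξ | ∀ u ∈ tangentVectors S p, metricForm c p u ξ = 0}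
  zero_mem' := fun u _ => map_zero _
  add_mem' := fun {a b} ha hb u hu => by rw [map_add, ha u hu, hb u hu, add_zero]
  smul_mem' := fun r a ha u hu => by rw [map_smul, ha u hu, smul_zero]

/-- `V` is a smooth subbundle of rank `d` of the normal bundle of `S`. -/
def IsNormalSubbundle {n : ℕ} (c : ℝ) (S : Set (CE n)) (d : ℕ) (V : CE n → Set (CE n)) : Prop :=
  ∀ p ∈ S, V p ⊆ normalSpace c S p ∧
    ∃ U : Set (CE n), IsOpen U ∧ p ∈ U ∧ ∃ X : Fin d → CE n → CE n,
      (∀ i, ContDiffOn ℝ ∞ (X i) U) ∧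
      ∀ q ∈ S ∩ U, LinearIndependent ℝ (fun i => X i q) ∧
        (Submodule.span ℝ (Set.range fun i => X i q) : Set (CE n)) = V q

/-- `σ` is the horocycle determined by the point `p`, the unit vector `U` and the point at infinity
`x`: the unit speed curve with initial velocity `U` satisfying the equation of a circle
`∇_{σ'} ∇_{σ'} σ' + ⟨∇_{σ'} σ', ∇_{σ'} σ'⟩ σ' = 0` with initial acceleration `(√-c / 2) B_p`,
where `B_p` is the initial velocity of the unit speed geodesic from `p` towards `x`. -/
def IsHorocycle {n : ℕ} (c : ℝ) (x : Set (ℝ → CE n)) (p U : CE n) (σ : ℝ → CE n) : Prop :=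
  ContDiff ℝ ∞ σ ∧ (∀ t, σ t ∈ CH n) ∧ σ 0 = p ∧ deriv σ 0 = U ∧
    (∀ t, metric c (σ t) (deriv σ t) (deriv σ t) = 1) ∧
    (∀ t, covDeriv σ (covDeriv σ (deriv σ)) t
      + metric c (σ t) (covDeriv σ (deriv σ) t) (covDeriv σ (deriv σ) t) • deriv σ t = 0) ∧
    ∃ γ ∈ x, γ 0 = p ∧ covDeriv σ (deriv σ) 0 = (Real.sqrt (-c) / 2) • deriv γ 0

/-- The set obtained from `S` by attaching, at each `p ∈ S`, the horocycles determined by `x` and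
the lines in `V p`. -/
def attachHorocycles {n : ℕ} (c : ℝ) (x : Set (ℝ → CE n)) (S : Set (CE n))
    (V : CE n → Set (CE n)) : Set (CE n) :=
  S ∪ {q | ∃ p ∈ S, ∃ U ∈ V p, ∃ σ, IsHorocycle c x p U σ ∧ ∃ t, σ t = q}

/-! ### The group `SU(1, n)` and its action -/

/-- Complex `(n + 1) × (n + 1)` matrices. -/
abbrev Mat (n : ℕ) := Matrix (Fin (n + 1)) (Fin (n + 1)) ℂ

/-- The matrix of the Hermitian form `-z₀ w̄₀ + z₁ w̄₁ + ⋯ + zₙ w̄ₙ`. -/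
def formMatrix (n : ℕ) : Mat n := Matrix.diagonal (Matrix.vecCons (-1) fun _ => 1)

/-- The group `SU(1, n)`. -/
def SU1 (n : ℕ) : Subgroup (Matrix.SpecialLinearGroup (Fin (n + 1)) ℂ) where
  carrier := {A | (A : Mat n)ᴴ * formMatrix n * (A : Mat n) = formMatrix n}
  one_mem' := by simp
  mul_mem' := fun {A B} hA hB => by
    simp only [Set.mem_ofPred_eq, Matrix.SpecialLinearGroup.coe_mul,
      Matrix.conjTranspose_mul] at *
    calc (B : Mat n)ᴴ * (A : Mat n)ᴴ * formMatrix n * ((A : Mat n) * (B : Mat n))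
        = (B : Mat n)ᴴ * ((A : Mat n)ᴴ * formMatrix n * (A : Mat n)) * (B : Mat n) := by
          simp only [mul_assoc]
      _ = formMatrix n := by rw [hA, hB]
  inv_mem' := fun {A} hA => by
    simp only [Set.mem_ofPred_eq] at *
    have h : (A : Mat n) * ((A⁻¹ : Matrix.SpecialLinearGroup (Fin (n + 1)) ℂ) : Mat n) = 1 := by
      rw [← Matrix.SpecialLinearGroup.coe_mul, mul_inv_cancel,
        Matrix.SpecialLinearGroup.coe_one]
    have h' : ((A⁻¹ : Matrix.SpecialLinearGroup (Fin (n + 1)) ℂ) : Mat n)ᴴ * (A : Mat n)ᴴ = 1 := by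
      rw [← Matrix.conjTranspose_mul, h, Matrix.conjTranspose_one]
    conv_lhs => rw [← hA]
    simp only [mul_assoc, h, mul_one]
    rw [← mul_assoc, h', one_mul]

/-- The underlying matrix of an element of `SU(1, n)`. -/
def mat {n : ℕ} (g : SU1 n) : Mat n := (g : Matrix.SpecialLinearGroup (Fin (n + 1)) ℂ)

/-- Homogeneous coordinates `(1, z)` of a point of `ℂHⁿ`. -/
def homog {n : ℕ} (z : CE n) : Fin (n + 1) → ℂ := Matrix.vecCons 1 fun i => z i

/-- The action of a matrix by fractional linear transformations. -/
def act {n : ℕ} (A : Mat n) (z : CE n) : CE n :=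
  WithLp.toLp 2 fun i => (A *ᵥ homog z) i.succ / (A *ᵥ homog z) 0

/-- The subgroup `H` acts simply transitively on `S`. -/
def ActsSimplyTransitively {n : ℕ} (H : Subgroup (SU1 n)) (S : Set (CE n)) : Prop :=
  (∀ h ∈ H, ∀ p ∈ S, act (mat h) p ∈ S) ∧ ∀ p ∈ S, ∀ q ∈ S, ∃! h, h ∈ H ∧ act (mat h) p = q

/-- The fiber at `p` of the left translation by `H` of the subspace `v` of the tangent space
at `o`. -/
def leftTranslate {n : ℕ} (H : Subgroup (SU1 n)) (v : Submodule ℝ (CE n)) (o p : CE n) :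
    Set (CE n) :=
  {ξ | ∃ h ∈ H, act (mat h) o = p ∧ ∃ η ∈ v, ξ = fderiv ℝ (act (mat h)) o η}

/-! ### Lie algebras and the Iwasawa decomposition -/

/-- The Lie algebra `su(1, n)`. -/
def su1 (n : ℕ) : Submodule ℝ (Mat n) where
  carrier := {X | Xᴴ * formMatrix n + formMatrix n * X = 0 ∧ X.trace = 0}
  zero_mem' := by simp
  add_mem' := fun {X Y} hX hY => by
    refine ⟨?_, by rw [Matrix.trace_add, hX.2, hY.2, add_zero]⟩
    have := congrArg₂ (· + ·) hX.1 hY.1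
    simp only [add_zero] at this
    rw [← this, Matrix.conjTranspose_add, add_mul, mul_add]
    abel
  smul_mem' := fun r X hX => by
    refine ⟨?_, by rw [Matrix.trace_smul, hX.2, smul_zero]⟩
    rw [Matrix.conjTranspose_smul, star_trivial, smul_mul_assoc, mul_smul_comm, ← smul_add, hX.1,
      smul_zero]

/-- The velocity at `t = 0` of the curve `exp(tX) · o`; it identifies `𝔞 ⊕ 𝔫` with the
tangent space at `o`. -/
def orbitVelocity {n : ℕ} (o : CE n) : Mat n →ₗ[ℝ] CE n where
  toFun X := WithLp.toLp 2 fun i => (X *ᵥ homog o) i.succ - o i * (X *ᵥ homog o) 0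
  map_add' X Y := by
    ext i
    simp only [Matrix.add_mulVec, Pi.add_apply, PiLp.add_apply]
    ring
  map_smul' r X := by
    ext i
    simp only [Matrix.smul_mulVec, Pi.smul_apply, PiLp.smul_apply, RingHom.id_apply,
      Complex.real_smul]
    ring

theorem hasDerivAt_act_exp {n : ℕ} (o : CE n) (X : Mat n) :
    HasDerivAt (fun t : ℝ => act (NormedSpace.exp (t • X)) o) (orbitVelocity o X) 0 := by
  have hm : ∀ i, HasDerivAt (fun t : ℝ => (NormedSpace.exp (t • X) *ᵥ homog o) i)
      ((X *ᵥ homog o) i) 0 := fun i => by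
    let _ : NormedRing (Mat n) := Matrix.linftyOpNormedRing
    let _ : NormedAlgebra ℝ (Mat n) := Matrix.linftyOpNormedAlgebra
    have h := hasDerivAt_exp_smul_const (𝕂 := ℝ) X (0 : ℝ)
    rw [zero_smul, NormedSpace.exp_zero, one_mul] at h
    let L : Mat n →ₗ[ℝ] ℂ :=
      { toFun := fun A => (A *ᵥ homog o) i
        map_add' := fun A B => by rw [Matrix.add_mulVec]; rfl
        map_smul' := fun r A => by rw [Matrix.smul_mulVec]; rfl }
    exact (LinearMap.toContinuousLinearMap L).hasFDerivAt.comp_hasDerivAt (0 : ℝ) h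
  have h0 : (NormedSpace.exp ((0 : ℝ) • X) *ᵥ homog o) = homog o := by simp
  rw [hasDerivAt_iff_hasFDerivAt, ← hasFDerivWithinAt_univ, hasFDerivWithinAt_piLp]
  intro i
  have := (hm i.succ).div (hm 0) (by rw [h0]; simp [homog])
  refine (this.congr_deriv (g' := orbitVelocity o X i) ?_).hasFDerivAt.congr_fderiv ?_ |>.hasFDerivWithinAt
  · rw [h0]
    simp [homog, orbitVelocity]
  · ext
    simp

/-- The isotropy algebra `𝔨` of `o`. -/
def isotropyAlg {n : ℕ} (o : CE n) : Set (Mat n) :=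
  {X | X ∈ su1 n ∧ ∀ t : ℝ, act (NormedSpace.exp (t • X)) o = o}

/-- The complement `𝔭` of `𝔨` in the Cartan decomposition at `o`: the orthogonal
complement of `𝔨` for `(X, Y) ↦ tr(XY)`, a positive multiple of the Killing form. -/
def cartanP {n : ℕ} (o : CE n) : Submodule ℝ (Mat n) where
  carrier := {X | X ∈ su1 n ∧ ∀ Y ∈ isotropyAlg o, (X * Y).trace = 0}
  zero_mem' := ⟨zero_mem _, by simp⟩
  add_mem' := fun {X X'} hX hX' => ⟨add_mem hX.1 hX'.1, fun Y hY => by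
    rw [add_mul, Matrix.trace_add, hX.2 Y hY, hX'.2 Y hY, add_zero]⟩
  smul_mem' := fun r X hX => ⟨Submodule.smul_mem _ r hX.1, fun Y hY => by
    rw [smul_mul_assoc, Matrix.trace_smul, hX.2 Y hY, smul_zero]⟩

/-- `𝔞` is a maximal abelian subspace of `𝔭`. -/
def IsMaximalAbelian {n : ℕ} (o : CE n) (a : Submodule ℝ (Mat n)) : Prop :=
  Maximal (fun b : Submodule ℝ (Mat n) =>
    b ≤ cartanP o ∧ ∀ X ∈ b, ∀ Y ∈ b, X * Y = Y * X) a

/-- The root space `𝔤_α` of `su(1, n)` with respect to `𝔞`. -/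
def rootSpace {n : ℕ} (a : Submodule ℝ (Mat n)) (α : a →ₗ[ℝ] ℝ) : Submodule ℝ (Mat n) where
  carrier := {X | X ∈ su1 n ∧ ∀ H : a, (H : Mat n) * X - X * (H : Mat n) = α H • X}
  zero_mem' := ⟨zero_mem _, by simp⟩
  add_mem' := fun {X Y} hX hY => ⟨add_mem hX.1 hY.1, fun H => by
    rw [smul_add, ← hX.2 H, ← hY.2 H, mul_add, add_mul]; abel⟩
  smul_mem' := fun r X hX => ⟨Submodule.smul_mem _ r hX.1, fun H => by
    rw [smul_comm, ← hX.2 H, mul_smul_comm, smul_mul_assoc, smul_sub]⟩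

/-- `𝔞` and `α` are the maximal abelian subspace and the simple root of the Iwasawa decomposition
`su(1, n) = 𝔨 ⊕ 𝔞 ⊕ 𝔤_α ⊕ 𝔤_{2α}` with respect to the point `o` and the point at infinity `x`:
`α` and `2α` are roots, and the unit vector `B` of `𝔞` with `α(B) > 0` generates the geodesic
`exp(tB) · o` from `o` towards `x`. -/
def IsIwasawa {n : ℕ} (o : CE n) (x : Set (ℝ → CE n)) (a : Submodule ℝ (Mat n))
    (α : a →ₗ[ℝ] ℝ) : Prop :=
  IsMaximalAbelian o a ∧ rootSpace a α ≠ ⊥ ∧ rootSpace a ((2 : ℝ) • α) ≠ ⊥ ∧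
    ∃ B : a, 0 < α B ∧ (fun t : ℝ => act (NormedSpace.exp (t • (B : Mat n))) o) ∈ x

/-- The connected subgroup of `SU(1, n)` with Lie algebra `s`. -/
def expSubgroup {n : ℕ} (s : Submodule ℝ (Mat n)) : Subgroup (SU1 n) :=
  Subgroup.closure {g | ∃ X ∈ s, mat g = NormedSpace.exp X}

/-- The Lie algebra of a closed subgroup of `SU(1, n)`
(for which the spanning set below is already a subspace). -/
def lieAlg {n : ℕ} (H : Subgroup (SU1 n)) : Submodule ℝ (Mat n) :=
  Submodule.span ℝ {X | X ∈ su1 n ∧ ∀ t : ℝ, ∃ h ∈ H, mat h = NormedSpace.exp (t • X)}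

/-- The solvable algebra `𝔞 ⊕ 𝔫 = 𝔞 ⊕ 𝔤_α ⊕ 𝔤_{2α}`. -/
def solvAlg {n : ℕ} (a : Submodule ℝ (Mat n)) (α : a →ₗ[ℝ] ℝ) : Submodule ℝ (Mat n) :=
  a ⊔ rootSpace a α ⊔ rootSpace a ((2 : ℝ) • α)

/-- `𝔲 ⊖ 𝔟`: the elements of `𝔲` orthogonal to `𝔟`, with respect to the metric of
`T_o ℂHⁿ ≅ 𝔞 ⊕ 𝔫`. -/
def ominus {n : ℕ} (c : ℝ) (o : CE n) (u b : Submodule ℝ (Mat n)) : Submodule ℝ (Mat n) where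
  carrier := {X | X ∈ u ∧ ∀ Y ∈ b, metricForm c o (orbitVelocity o Y) (orbitVelocity o X) = 0}
  zero_mem' := ⟨zero_mem _, by simp⟩
  add_mem' := fun {X X'} hX hX' => ⟨add_mem hX.1 hX'.1, fun Y hY => by
    rw [map_add, map_add, hX.2 Y hY, hX'.2 Y hY, add_zero]⟩
  smul_mem' := fun r X hX => ⟨Submodule.smul_mem _ r hX.1, fun Y hY => by
    rw [map_smul, map_smul, hX.2 Y hY, smul_zero]⟩

/-- `ĥ ⊖ (𝔞 ⊕ 𝔤_{2α})`, where `ĥ` is the Lie algebra of `H`. -/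
def hPart {n : ℕ} (c : ℝ) (o : CE n) (a : Submodule ℝ (Mat n)) (α : a →ₗ[ℝ] ℝ)
    (H : Subgroup (SU1 n)) : Submodule ℝ (Mat n) :=
  ominus c o (lieAlg H) (a ⊔ rootSpace a ((2 : ℝ) • α))

/-- The subspace `v` of `T_o ℂHⁿ`, regarded as a subspace of `𝔞 ⊕ 𝔫`. -/
def vPart {n : ℕ} (o : CE n) (a : Submodule ℝ (Mat n)) (α : a →ₗ[ℝ] ℝ)
    (v : Submodule ℝ (CE n)) : Submodule ℝ (Mat n) :=
  solvAlg a α ⊓ v.comap (orbitVelocity o)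

/-- The submanifold `W_𝔴`: the orbit through `o` of the connected subgroup with Lie algebra
`𝔰_𝔴 = 𝔞 ⊕ 𝔴 ⊕ 𝔤_{2α}`. -/
def Wsub {n : ℕ} (o : CE n) (a : Submodule ℝ (Mat n)) (α : a →ₗ[ℝ] ℝ)
    (w : Submodule ℝ (Mat n)) : Set (CE n) :=
  {q | ∃ s ∈ expSubgroup (a ⊔ w ⊔ rootSpace a ((2 : ℝ) • α)), act (mat s) o = q}

end ComplexHyperbolic

end

open ComplexHyperbolic

noncomputable section

namespace ComplexHyperbolic

/-! ### The Hermitian form and homogeneous coordinates -/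

/-- The vectors of `ℂ^{1,n}`. -/
abbrev HV (n : ℕ) := Fin (n + 1) → ℂ

/-- The last `n` coordinates of a vector of `ℂ^{1,n}`. -/
def tl {n : ℕ} : HV n →ₗ[ℂ] CE n where
  toFun w := WithLp.toLp 2 fun i => w i.succ
  map_add' _ _ := rfl
  map_smul' _ _ := rfl

/-- The Hermitian form `-z̄₀ w₀ + z̄₁ w₁ + ⋯ + z̄ₙ wₙ`. -/
def q {n : ℕ} (a b : HV n) : ℂ := inner ℂ (tl a) (tl b) - (starRingEnd ℂ) (a 0) * b 0

section form

variable {n : ℕ} (a b d : HV n) (r : ℂ) (s : ℝ)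

theorem q_add_left : q (a + b) d = q a d + q b d := by
  simp [q]; ring
theorem q_add_right : q d (a + b) = q d a + q d b := by
  simp [q]; ring
theorem q_sub_left : q (a - b) d = q a d - q b d := by
  simp [q]; ring
theorem q_sub_right : q d (a - b) = q d a - q d b := by
  simp [q]; ring
theorem q_smul_left : q (r • a) b = (starRingEnd ℂ) r * q a b := by
  simp [q]; ring
theorem q_smul_right : q a (r • b) = r * q a b := by
  simp [q]; ring
theorem q_zero_left : q 0 b = 0 := by simp [q]
theorem q_zero_right : q a 0 = 0 := by simp [q]
theorem real_smul_eq_coe_smul : s • a = (s : ℂ) • a := by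
  ext i; simp
theorem q_rsmul_left : q (s • a) b = s * q a b := by
  rw [real_smul_eq_coe_smul, q_smul_left, Complex.conj_ofReal]
theorem q_rsmul_right : q a (s • b) = s * q a b := by
  rw [real_smul_eq_coe_smul, q_smul_right]
theorem q_conj : (starRingEnd ℂ) (q a b) = q b a := by
  simp [q, mul_comm]
theorem q_self_im : (q a a).im = 0 := by
  have h := congrArg Complex.im (q_conj a a)
  simp only [Complex.conj_im] at h
  linarith
theorem q_self_ofReal : ((q a a).re : ℂ) = q a a := by
  apply Complex.ext <;> simp [q_self_im]
theorem q_self_re : (q a a).re = ‖tl a‖ ^ 2 - ‖a 0‖ ^ 2 := by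
  rw [q, inner_self_eq_norm_sq_to_K, ← Complex.normSq_eq_conj_mul_self, Complex.sub_re,
    Complex.ofReal_re, Complex.normSq_eq_norm_sq]
  norm_cast

end form

theorem q_comm_zero {n : ℕ} {a b : HV n} (h : q a b = 0) : q b a = 0 := by
  rw [← q_conj, h, map_zero]

/-- Linearity of the Hermitian form in its second argument. -/
def qLin {n : ℕ} (a : HV n) : HV n →ₗ[ℂ] ℂ where
  toFun := q a
  map_add' b d := q_add_right b d a
  map_smul' r b := q_smul_right a b r

theorem qLin_apply {n : ℕ} (a b : HV n) : qLin a b = q a b := rfl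

theorem q_eq_dotProduct {n : ℕ} (a b : HV n) : q a b = star a ⬝ᵥ (formMatrix n *ᵥ b) := by
  simp only [q, tl, PiLp.inner_apply, dotProduct, formMatrix,
    Matrix.mulVec_diagonal, Fin.sum_univ_succ, Matrix.cons_val_zero, Matrix.cons_val_succ, one_mul,
    Pi.star_apply, RCLike.inner_apply, starRingEnd_apply]
  rw [sub_eq_neg_add]
  congr 1
  · ring
  · exact Finset.sum_congr rfl fun i _ => mul_comm _ _

@[simp] theorem homog_zero_apply {n : ℕ} (z : CE n) : homog z 0 = 1 := rfl
@[simp] theorem tl_homog {n : ℕ} (z : CE n) : tl (homog z) = z := rfl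

theorem mem_CH_iff {n : ℕ} {z : CE n} : z ∈ CH n ↔ (q (homog z) (homog z)).re < 0 := by
  rw [q_self_re, CH, mem_ball_zero_iff, tl_homog, homog_zero_apply]
  simp [sq_lt_one_iff₀ (norm_nonneg z)]

theorem zero_ne_of_neg {n : ℕ} {w : HV n} (h : (q w w).re < 0) : w 0 ≠ 0 := by
  intro h0
  rw [q_self_re, h0] at h
  simp at h
  nlinarith [sq_nonneg ‖tl w‖]

theorem q_self_ne_of_neg {n : ℕ} {w : HV n} (h : (q w w).re < 0) : q w w ≠ 0 := by
  intro h0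
  simp [h0] at h

/-- Affine coordinates of the point with homogeneous coordinates `w`. -/
def pr {n : ℕ} (w : HV n) : CE n := (w 0)⁻¹ • tl w

/-- The differential of `pr`. -/
def dpr {n : ℕ} (W : HV n) : HV n →ₗ[ℂ] CE n where
  toFun A := (W 0)⁻¹ • (tl A - A 0 • pr W)
  map_add' A B := by simp only [map_add, Pi.add_apply, ← smul_add]; congr 1; module
  map_smul' r A := by
    simp only [map_smul, Pi.smul_apply, RingHom.id_apply, smul_eq_mul]; module

theorem dpr_apply {n : ℕ} (W A : HV n) : dpr W A = (W 0)⁻¹ • (tl A - A 0 • pr W) := rfl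

@[simp] theorem pr_homog {n : ℕ} (z : CE n) : pr (homog z) = z := by simp [pr]

theorem eq_of_tl_eq {n : ℕ} {a b : HV n} (h : tl a = tl b) (h0 : a 0 = b 0) : a = b := by
  funext i
  refine Fin.cases h0 (fun j => ?_) i
  exact congrArg (fun z : CE n => z j) h

theorem smul_homog_pr {n : ℕ} {w : HV n} (h : w 0 ≠ 0) : w 0 • homog (pr w) = w := by
  apply eq_of_tl_eq
  · simp [pr, smul_smul, h]
  · simp

theorem homog_pr {n : ℕ} {w : HV n} (h : w 0 ≠ 0) : homog (pr w) = (w 0)⁻¹ • w := by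
  rw [eq_inv_smul_iff₀ h, smul_homog_pr h]

theorem pr_smul {n : ℕ} {r : ℂ} (hr : r ≠ 0) (w : HV n) : pr (r • w) = pr w := by
  simp only [pr, map_smul, Pi.smul_apply, smul_eq_mul, smul_smul]
  congr 1
  field_simp

theorem pr_rsmul {n : ℕ} {r : ℝ} (hr : r ≠ 0) (w : HV n) : pr (r • w) = pr w := by
  rw [real_smul_eq_coe_smul, pr_smul (by exact_mod_cast hr)]

theorem pr_mem_CH {n : ℕ} {w : HV n} (h : (q w w).re < 0) : pr w ∈ CH n := by
  have h0 := zero_ne_of_neg h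
  rw [mem_CH_iff, homog_pr h0, q_smul_left, q_smul_right, ← mul_assoc,
    ← Complex.normSq_eq_conj_mul_self, Complex.re_ofReal_mul]
  exact mul_neg_of_pos_of_neg (Complex.normSq_pos.2 (inv_ne_zero h0)) h

theorem dpr_smul {n : ℕ} {r : ℂ} (hr : r ≠ 0) (W A : HV n) : dpr (r • W) A = r⁻¹ • dpr W A := by
  rw [dpr_apply, dpr_apply, pr_smul hr, smul_smul, Pi.smul_apply, smul_eq_mul, mul_inv]

theorem dpr_self {n : ℕ} {W : HV n} (h : W 0 ≠ 0) : dpr W W = 0 := by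
  rw [dpr_apply, pr, smul_smul, mul_inv_cancel₀ h, one_smul, sub_self, smul_zero]

theorem dpr_eq_zero {n : ℕ} {W A : HV n} (h : W 0 ≠ 0) (hA : dpr W A = 0) :
    A = (A 0 / W 0) • W := by
  rw [dpr_apply, smul_eq_zero, or_iff_right (inv_ne_zero h), sub_eq_zero] at hA
  apply eq_of_tl_eq
  · rw [hA, pr, map_smul, smul_smul]; rfl
  · simp [h]

/-- The tangent vector `u` of the affine chart as a vector of `ℂ^{1,n}`. -/
def tvec {n : ℕ} : CE n →ₗ[ℂ] HV n where
  toFun u := Matrix.vecCons 0 fun i => u i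
  map_add' a b := by
    refine eq_of_tl_eq ?_ ?_
    · rfl
    · simp
  map_smul' a b := by
    refine eq_of_tl_eq ?_ ?_
    · rfl
    · simp

@[simp] theorem tvec_zero_apply {n : ℕ} (z : CE n) : tvec z 0 = 0 := rfl
@[simp] theorem tl_tvec {n : ℕ} (z : CE n) : tl (tvec z) = z := rfl

theorem dpr_tvec {n : ℕ} (W : HV n) (u : CE n) : dpr W (tvec u) = (W 0)⁻¹ • u := by
  simp [dpr_apply]

theorem dpr_homog_tvec {n : ℕ} (z u : CE n) : dpr (homog z) (tvec u) = u := by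
  simp [dpr_apply]

theorem homog_add {n : ℕ} (z u : CE n) : homog (z + u) = homog z + tvec u :=
  eq_of_tl_eq rfl (by simp)

/-- Decomposition of a vector into a multiple of `W` and a tangent vector of the chart. -/
theorem eq_tvec_add {n : ℕ} {W : HV n} (h : W 0 ≠ 0) (A : HV n) :
    A = W 0 • tvec (dpr W A) + (A 0 / W 0) • W := by
  apply eq_of_tl_eq
  · simp only [dpr_apply, map_add, map_smul, tl_tvec, pr, smul_smul, smul_sub]
    rw [mul_inv_cancel₀ h, one_smul, mul_inv_cancel_left₀ h, div_eq_mul_inv, sub_add_cancel]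
  · simp [h]

/-! ### Positivity -/

theorem q_self_nonneg_of_orthogonal {n : ℕ} {W A : HV n} (hW : (q W W).re < 0) (h : q W A = 0) :
    0 ≤ (q A A).re ∧ ((q A A).re = 0 → A = 0) := by
  have h1 : ‖W 0‖ * ‖A 0‖ ≤ ‖tl W‖ * ‖tl A‖ := by
    rw [q, sub_eq_zero] at h
    have := norm_inner_le_norm (𝕜 := ℂ) (tl W) (tl A)
    rwa [h, norm_mul, RCLike.norm_conj] at this
  have hW' : ‖tl W‖ < ‖W 0‖ := by
    rw [q_self_re] at hW
    exact lt_of_pow_lt_pow_left₀ 2 (norm_nonneg _) (by linarith)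
  have h3 : ‖A 0‖ ≤ ‖tl A‖ := by
    by_contra! hlt
    have := norm_nonneg (tl A)
    have := norm_nonneg (tl W)
    nlinarith
  rw [q_self_re]
  refine ⟨by nlinarith [norm_nonneg (A 0), norm_nonneg (tl A)], fun h0 => ?_⟩
  have h4 : ‖A 0‖ = ‖tl A‖ := by nlinarith [norm_nonneg (A 0), norm_nonneg (tl A)]
  have h5 : ‖tl A‖ = 0 := by
    have := norm_nonneg (tl A)
    rw [h4] at h1
    nlinarith
  exact eq_of_tl_eq (by rw [norm_eq_zero.1 h5, map_zero])
    (by rw [norm_eq_zero.1 (h4.trans h5)]; rfl)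

theorem q_cauchy_schwarz {n : ℕ} {W A B : HV n} (hW : (q W W).re < 0) (hA : q W A = 0)
    (hB : q W B = 0) : ‖q A B‖ ^ 2 ≤ (q A A).re * (q B B).re := by
  obtain ⟨h1, h2⟩ := q_self_nonneg_of_orthogonal hW hA
  rcases h1.eq_or_lt with h | h
  · rw [h2 h.symm]; simp [q_zero_left]
  have h3 := (q_self_nonneg_of_orthogonal hW (A := q A A • B - q A B • A)
    (by rw [q_sub_right, q_smul_right, q_smul_right, hA, hB]; simp)).1
  have h4 : q (q A A • B - q A B • A) (q A A • B - q A B • A)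
      = ((q A A).re * ((q A A).re * (q B B).re - ‖q A B‖ ^ 2) : ℝ) := by
    simp only [q_sub_left, q_sub_right, q_smul_left, q_smul_right, q_conj]
    have e : (‖q A B‖ ^ 2 : ℂ) = q B A * q A B := by
      rw [← q_conj A B, ← Complex.normSq_eq_conj_mul_self, Complex.normSq_eq_norm_sq]
      norm_cast
    push_cast
    rw [e, q_self_ofReal, q_self_ofReal]
    ring
  rw [h4, Complex.ofReal_re] at h3
  have := nonneg_of_mul_nonneg_right h3 h
  linarith

/-- A null vector orthogonal to a null vector `X ≠ 0` is a multiple of it. -/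
theorem null_eq_smul {n : ℕ} {W X Y : HV n} (hW : (q W W).re < 0) (hX : q X X = 0)
    (hY : q Y Y = 0) (hXY : q X Y = 0) (hXW : q W X ≠ 0) : Y = (q W Y / q W X) • X := by
  have h := (q_self_nonneg_of_orthogonal hW (A := Y - (q W Y / q W X) • X)
    (by rw [q_sub_right, q_smul_right, div_mul_cancel₀ _ hXW, sub_self])).2
    (by simp only [q_sub_left, q_sub_right, q_smul_left, q_smul_right, hX, hY, hXY,
          q_comm_zero hXY]; simp)
  exact sub_eq_zero.1 h

/-! ### The metric and the connection in homogeneous coordinates -/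

theorem metric_dpr {n : ℕ} (c : ℝ) {W : HV n} (hW : (q W W).re < 0) (A B : HV n) :
    metric c (pr W) (dpr W A) (dpr W B)
      = 4 / (-c) * ((q A W * q W B - q A B * q W W).re / (q W W).re ^ 2) := by
  have h0 := zero_ne_of_neg hW
  set z := pr W
  set u := dpr W A with hu
  set u' := dpr W B with hu'
  have eW : W = W 0 • homog z := (smul_homog_pr h0).symm
  have eA := eq_tvec_add h0 A
  have eB := eq_tvec_add h0 B
  rw [← hu] at eA
  rw [← hu'] at eB
  set w := W 0 with hw
  have e1 : q (tvec u) (homog z) = inner ℂ u z := by simp [q]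
  have e2 : q (homog z) (tvec u') = inner ℂ z u' := by simp [q]
  have e3 : q (tvec u) (tvec u') = inner ℂ u u' := by simp [q]
  have e4 : q (homog z) (homog z) = ((‖z‖ ^ 2 - 1 : ℝ) : ℂ) := by
    rw [← q_self_ofReal, q_self_re]; simp
  have eN : q W W = ((Complex.normSq w * (‖z‖ ^ 2 - 1) : ℝ) : ℂ) := by
    rw [eW, q_smul_left, q_smul_right, e4, Complex.ofReal_mul, Complex.normSq_eq_conj_mul_self]
    ring
  have key : q A W * q W B - q A B * q W W = ((Complex.normSq w ^ 2 : ℝ) : ℂ) *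
      (((1 - ‖z‖ ^ 2 : ℝ) : ℂ) * inner ℂ u u' + inner ℂ u z * inner ℂ z u') := by
    have f1 : q A W = starRingEnd ℂ w * w * inner ℂ u z + starRingEnd ℂ (A 0 / w) * q W W := by
      conv_lhs => rw [eA, q_add_left, q_smul_left, q_smul_left]
      congr 1
      rw [eW, q_smul_right, e1]; ring
    have f2 : q W B = starRingEnd ℂ w * w * inner ℂ z u' + (B 0 / w) * q W W := by
      conv_lhs => rw [eB, q_add_right, q_smul_right, q_smul_right]
      congr 1
      rw [eW, q_smul_left, e2]; ring
    have f3 : q A B = starRingEnd ℂ w * w * inner ℂ u u'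
        + starRingEnd ℂ w * (B 0 / w) * (w * inner ℂ u z)
        + starRingEnd ℂ (A 0 / w) * q W B := by
      conv_lhs => rw [eA, q_add_left, q_smul_left, q_smul_left]
      congr 1
      conv_lhs => rw [eB, q_add_right, q_smul_right, q_smul_right, e3]
      rw [eW, q_smul_right, e1]; ring
    rw [f3, f1, f2, eN]
    push_cast
    rw [Complex.normSq_eq_conj_mul_self]
    ring
  rw [key, Complex.re_ofReal_mul, eN, Complex.ofReal_re, metric]
  have hn : Complex.normSq w ≠ 0 := (Complex.normSq_pos.2 h0).ne'
  have hz : (‖z‖ ^ 2 - 1 : ℝ) ≠ 0 := by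
    intro h
    rw [eN, h] at hW
    simp at hW
  have hz' : (1 - ‖z‖ ^ 2 : ℝ) ≠ 0 := fun h => hz (by linarith)
  generalize (((1 - ‖z‖ ^ 2 : ℝ) : ℂ) * inner ℂ u u' + inner ℂ u z * inner ℂ z u').re = m
  generalize 4 / -c = k
  field_simp
  ring

theorem christoffel_dpr {n : ℕ} {W : HV n} (hW : (q W W).re < 0) (A B : HV n) :
    christoffel (pr W) (dpr W A) (dpr W B)
      = (A 0 / W 0 - q W A / q W W) • dpr W B + (B 0 / W 0 - q W B / q W W) • dpr W A := by
  have h0 := zero_ne_of_neg hW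
  have e4 : q (homog (pr W)) (homog (pr W)) = ((‖pr W‖ ^ 2 - 1 : ℝ) : ℂ) := by
    rw [← q_self_ofReal, q_self_re]; simp
  have hz : ((‖pr W‖ ^ 2 - 1 : ℝ) : ℂ) ≠ 0 := by
    rw [← e4]
    exact q_self_ne_of_neg (mem_CH_iff.1 (pr_mem_CH hW))
  have key : ∀ A : HV n, ((1 - ‖pr W‖ ^ 2 : ℝ) : ℂ)⁻¹ * inner ℂ (pr W) (dpr W A)
      = A 0 / W 0 - q W A / q W W := by
    intro A
    have eA : q W A = starRingEnd ℂ (W 0) * W 0 * inner ℂ (pr W) (dpr W A) + A 0 / W 0 * q W W := by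
      conv_lhs => rw [eq_tvec_add h0 A, q_add_right, q_smul_right, q_smul_right]
      congr 1
      have e : q W (tvec (dpr W A)) = starRingEnd ℂ (W 0) * inner ℂ (pr W) (dpr W A) := by
        conv_lhs => rw [← smul_homog_pr h0, q_smul_left]
        rw [smul_homog_pr h0]
        simp [q]
      rw [e]
      ring
    have eN : q W W = starRingEnd ℂ (W 0) * W 0 * ((‖pr W‖ ^ 2 - 1 : ℝ) : ℂ) := by
      conv_lhs => rw [← smul_homog_pr h0, q_smul_left, q_smul_right, e4]
      ring
    have h0' : starRingEnd ℂ (W 0) ≠ 0 := by simpa using h0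
    have hz' : ((1 - ‖pr W‖ ^ 2 : ℝ) : ℂ) = -((‖pr W‖ ^ 2 - 1 : ℝ) : ℂ) := by push_cast; ring
    rw [eA, eN, hz']
    field_simp
    ring
  rw [christoffel, smul_add, smul_smul, smul_smul, key, key]

end ComplexHyperbolic
end

noncomputable section

namespace ComplexHyperbolic

/-! ### Curves given by lifts -/

theorem hasDerivAt_tl {n : ℕ} {W : ℝ → HV n} {W' : HV n} {t : ℝ} (h : HasDerivAt W W' t) :
    HasDerivAt (fun s => tl (W s)) (tl W') t :=
  (LinearMap.toContinuousLinearMap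
    ((tl : HV n →ₗ[ℂ] CE n).restrictScalars ℝ)).hasFDerivAt.comp_hasDerivAt t h

theorem hasDerivAt_coord {n : ℕ} {W : ℝ → HV n} {W' : HV n} {t : ℝ} (h : HasDerivAt W W' t)
    (i : Fin (n + 1)) : HasDerivAt (fun s => W s i) (W' i) t :=
  hasDerivAt_pi.1 h i

theorem hasDerivAt_pr {n : ℕ} {W : ℝ → HV n} {W' : HV n} {t : ℝ} (h : HasDerivAt W W' t)
    (h0 : W t 0 ≠ 0) : HasDerivAt (fun s => pr (W s)) (dpr (W t) W') t := by
  refine (((hasDerivAt_coord h 0).inv h0).smul (hasDerivAt_tl h)).congr_deriv ?_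
  simp only [dpr_apply, pr, Pi.inv_apply]
  match_scalars
  · ring
  · field_simp

theorem hasDerivAt_dpr {n : ℕ} {W A : ℝ → HV n} {W' A' : HV n} {t : ℝ} (h : HasDerivAt W W' t)
    (hA : HasDerivAt A A' t) (h0 : W t 0 ≠ 0) :
    HasDerivAt (fun s => dpr (W s) (A s)) (dpr (W t) A' - (A t 0 / W t 0) • dpr (W t) W'
      - (W' 0 / W t 0) • dpr (W t) (A t)) t := by
  refine (((hasDerivAt_coord h 0).inv h0).smul ((hasDerivAt_tl hA).sub
    ((hasDerivAt_coord hA 0).smul (hasDerivAt_pr h h0)))).congr_deriv ?_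
  simp only [dpr_apply, Pi.inv_apply, Pi.smul_apply', Pi.sub_apply]
  match_scalars <;> field_simp
  ring

theorem covDeriv_dpr {n : ℕ} {W A : ℝ → HV n} {W' A' : HV n} {t : ℝ} (h : HasDerivAt W W' t)
    (hA : HasDerivAt A A' t) (hW : (q (W t) (W t)).re < 0) :
    covDeriv (fun s => pr (W s)) (fun s => dpr (W s) (A s)) t
      = dpr (W t) (A' - (q (W t) W' / q (W t) (W t)) • A t
          - (q (W t) (A t) / q (W t) (W t)) • W') := by
  have h0 := zero_ne_of_neg hW
  rw [covDeriv, (hasDerivAt_dpr h hA h0).deriv, (hasDerivAt_pr h h0).deriv,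
    christoffel_dpr hW]
  simp only [map_sub, map_smul]
  module

theorem contDiff_pr {n : ℕ} {W : ℝ → HV n} {m : WithTop ℕ∞} (h : ContDiff ℝ m W)
    (h0 : ∀ t, W t 0 ≠ 0) : ContDiff ℝ m (fun s => pr (W s)) := by
  refine ContDiff.smul (ContDiff.inv (contDiff_pi.1 h 0) h0) ?_
  exact (LinearMap.toContinuousLinearMap
    ((tl : HV n →ₗ[ℂ] CE n).restrictScalars ℝ)).contDiff.comp h

/-! ### Uniqueness for autonomous differential equations -/

theorem autonomous_ode_unique {E : Type*} [NormedAddCommGroup E] [NormedSpace ℝ E] {F : E → E}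
    {Ω : Set E} (hΩ : IsOpen Ω) (hF : ContDiffOn ℝ 1 F Ω) {f g : ℝ → E}
    (hf : ∀ t, HasDerivAt f (F (f t)) t) (hg : ∀ t, HasDerivAt g (F (g t)) t)
    (hfΩ : ∀ t, f t ∈ Ω) (h0 : f 0 = g 0) : f = g := by
  have hfc : Continuous f := continuous_iff_continuousAt.2 fun t => (hf t).continuousAt
  have hgc : Continuous g := continuous_iff_continuousAt.2 fun t => (hg t).continuousAt
  have hcl : IsClopen {t | f t = g t} := by
    refine ⟨isClosed_eq hfc hgc, isOpen_iff_mem_nhds.2 fun t (ht : f t = g t) => ?_⟩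
    obtain ⟨K, s, hs, hK⟩ := (hF.contDiffAt (hΩ.mem_nhds (hfΩ t))).exists_lipschitzOnWith
    refine ODE_solution_unique_of_eventually (v := fun _ => F) (s := fun _ => s) (K := K)
      (Filter.Eventually.of_forall fun _ => hK) ?_ ?_ ht
    · filter_upwards [hfc.continuousAt.preimage_mem_nhds hs] with r hr using ⟨hf r, hr⟩
    · rw [ht] at hs
      filter_upwards [hgc.continuousAt.preimage_mem_nhds hs] with r hr using ⟨hg r, hr⟩
  funext t
  have := hcl.eq_univ ⟨0, h0⟩
  exact (this ▸ Set.mem_univ t : t ∈ {t | f t = g t})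

theorem contDiffOn_christoffel {n : ℕ} {m : WithTop ℕ∞} {E : Type*} [NormedAddCommGroup E]
    [NormedSpace ℝ E] {Ω : Set E} {z u v : E → CE n} (hz : ContDiffOn ℝ m z Ω)
    (hu : ContDiffOn ℝ m u Ω) (hv : ContDiffOn ℝ m v Ω) (hΩ : ∀ e ∈ Ω, z e ∈ CH n) :
    ContDiffOn ℝ m (fun e => christoffel (z e) (u e) (v e)) Ω := by
  have hN : ContDiffOn ℝ m (fun e => ((1 - ‖z e‖ ^ 2 : ℝ) : ℂ)) Ω :=
    Complex.ofRealCLM.contDiff.comp_contDiffOn (contDiffOn_const.sub (hz.norm_sq ℂ))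
  refine ContDiffOn.smul (hN.inv ?_) ?_
  · intro e he h
    have h1 := hΩ e he
    rw [CH, mem_ball_zero_iff] at h1
    have h2 : (1 - ‖z e‖ ^ 2 : ℝ) = 0 := by exact_mod_cast h
    nlinarith [norm_nonneg (z e)]
  · exact ((hz.inner ℂ hu).smul hv).add ((hz.inner ℂ hv).smul hu)

theorem contDiffOn_metric {n : ℕ} {m : WithTop ℕ∞} {E : Type*} [NormedAddCommGroup E]
    [NormedSpace ℝ E] {Ω : Set E} {z u v : E → CE n} (c : ℝ) (hz : ContDiffOn ℝ m z Ω)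
    (hu : ContDiffOn ℝ m u Ω) (hv : ContDiffOn ℝ m v Ω) (hΩ : ∀ e ∈ Ω, z e ∈ CH n) :
    ContDiffOn ℝ m (fun e => metric c (z e) (u e) (v e)) Ω := by
  have hN : ContDiffOn ℝ m (fun e => (1 - ‖z e‖ ^ 2 : ℝ)) Ω :=
    contDiffOn_const.sub (hz.norm_sq ℂ)
  have hM : ContDiffOn ℝ m (fun e => (((1 - ‖z e‖ ^ 2 : ℝ) : ℂ) * inner ℂ (u e) (v e)
      + inner ℂ (u e) (z e) * inner ℂ (z e) (v e)).re) Ω :=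
    Complex.reCLM.contDiff.comp_contDiffOn
      (((Complex.ofRealCLM.contDiff.comp_contDiffOn hN).mul (hu.inner ℂ hv)).add
        ((hu.inner ℂ hz).mul (hz.inner ℂ hv)))
  refine ContDiffOn.div (contDiffOn_const.mul hM) (hN.pow 2) ?_
  · intro e he h
    have h1 := hΩ e he
    rw [CH, mem_ball_zero_iff] at h1
    have h2 := pow_eq_zero_iff (two_ne_zero) |>.1 h
    nlinarith [norm_nonneg (z e)]

theorem isOpen_fst_mem_CH {n : ℕ} {F : Type*} [TopologicalSpace F] :
    IsOpen {e : CE n × F | e.1 ∈ CH n} :=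
  Metric.isOpen_ball.preimage continuous_fst

theorem geodesic_unique {n : ℕ} {γ₁ γ₂ : ℝ → CE n} (h₁ : IsGeodesic γ₁) (h₂ : IsGeodesic γ₂)
    (h0 : γ₁ 0 = γ₂ 0) (h0' : deriv γ₁ 0 = deriv γ₂ 0) : γ₁ = γ₂ := by
  let F : CE n × CE n → CE n × CE n := fun e => (e.2, -christoffel e.1 e.2 e.2)
  have hF : ContDiffOn ℝ 1 F {e | e.1 ∈ CH n} :=
    contDiff_snd.contDiffOn.prodMk
      (contDiffOn_christoffel contDiff_fst.contDiffOn contDiff_snd.contDiffOn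
        contDiff_snd.contDiffOn fun e he => he).neg
  have key : ∀ γ : ℝ → CE n, IsGeodesic γ →
      ∀ t, HasDerivAt (fun s => (γ s, deriv γ s)) (F (γ t, deriv γ t)) t := by
    intro γ hγ t
    have d1 := (hγ.1.differentiable (by simp)).differentiableAt (x := t) |>.hasDerivAt
    have d2 := ((contDiff_infty_iff_deriv.1 hγ.1).2.differentiable (by simp)).differentiableAt
      (x := t) |>.hasDerivAt
    have := hγ.2.2 t
    rw [covDeriv, add_eq_zero_iff_eq_neg] at this
    rw [this] at d2
    exact d1.prodMk d2
  have := autonomous_ode_unique isOpen_fst_mem_CH hF (key γ₁ h₁) (key γ₂ h₂)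
    (fun t => h₁.2.1 t) (by simp only [h0, h0'])
  funext t
  exact congrArg Prod.fst (congrFun this t)

/-- The first order system equivalent to the equation of a circle. -/
def circleField {n : ℕ} (c : ℝ) (e : CE n × CE n × CE n) : CE n × CE n × CE n :=
  (e.2.1, e.2.2 - christoffel e.1 e.2.1 e.2.1,
    -(metric c e.1 e.2.2 e.2.2 • e.2.1) - christoffel e.1 e.2.1 e.2.2)

theorem contDiffOn_circleField {n : ℕ} (c : ℝ) :
    ContDiffOn ℝ 1 (circleField c) {e : CE n × CE n × CE n | e.1 ∈ CH n} := by
  have c1 : ContDiff ℝ 1 fun e : CE n × CE n × CE n => e.2.1 := contDiff_fst.comp contDiff_snd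
  have c2 : ContDiff ℝ 1 fun e : CE n × CE n × CE n => e.2.2 := contDiff_snd.comp contDiff_snd
  have d1 := contDiffOn_christoffel (n := n) (Ω := {e : CE n × CE n × CE n | e.1 ∈ CH n})
    contDiff_fst.contDiffOn c1.contDiffOn c1.contDiffOn fun e he => he
  have d2 := contDiffOn_metric (n := n) (Ω := {e : CE n × CE n × CE n | e.1 ∈ CH n}) c
    contDiff_fst.contDiffOn c2.contDiffOn c2.contDiffOn fun e he => he
  have d3 := contDiffOn_christoffel (n := n) (Ω := {e : CE n × CE n × CE n | e.1 ∈ CH n})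
    contDiff_fst.contDiffOn c1.contDiffOn c2.contDiffOn fun e he => he
  exact c1.contDiffOn.prodMk ((c2.contDiffOn.sub d1).prodMk ((d2.smul c1.contDiffOn).neg.sub d3))

/-- Uniqueness of the solutions of the equation of a circle. -/
theorem circle_unique {n : ℕ} {c : ℝ} {σ₁ σ₂ : ℝ → CE n}
    (h₁ : ContDiff ℝ ∞ σ₁) (h₂ : ContDiff ℝ ∞ σ₂) (m₁ : ∀ t, σ₁ t ∈ CH n) (m₂ : ∀ t, σ₂ t ∈ CH n)
    (e₁ : ∀ t, covDeriv σ₁ (covDeriv σ₁ (deriv σ₁)) t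
      + metric c (σ₁ t) (covDeriv σ₁ (deriv σ₁) t) (covDeriv σ₁ (deriv σ₁) t) • deriv σ₁ t = 0)
    (e₂ : ∀ t, covDeriv σ₂ (covDeriv σ₂ (deriv σ₂)) t
      + metric c (σ₂ t) (covDeriv σ₂ (deriv σ₂) t) (covDeriv σ₂ (deriv σ₂) t) • deriv σ₂ t = 0)
    (h0 : σ₁ 0 = σ₂ 0) (h0' : deriv σ₁ 0 = deriv σ₂ 0)
    (h0'' : covDeriv σ₁ (deriv σ₁) 0 = covDeriv σ₂ (deriv σ₂) 0) : σ₁ = σ₂ := by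
  have key : ∀ σ : ℝ → CE n, ContDiff ℝ ∞ σ → (∀ t, σ t ∈ CH n) →
      (∀ t, covDeriv σ (covDeriv σ (deriv σ)) t
        + metric c (σ t) (covDeriv σ (deriv σ) t) (covDeriv σ (deriv σ) t) • deriv σ t = 0) →
      ∀ t, HasDerivAt (fun s => (σ s, deriv σ s, covDeriv σ (deriv σ) s))
        (circleField c (σ t, deriv σ t, covDeriv σ (deriv σ) t)) t := by
    intro σ hσ hm he t
    have s1 := (contDiff_infty_iff_deriv.1 hσ).2
    have s2 := (contDiff_infty_iff_deriv.1 s1).2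
    have s3 : ContDiff ℝ ∞ (covDeriv σ (deriv σ)) := by
      refine s2.add (contDiffOn_univ.1 ?_)
      exact contDiffOn_christoffel hσ.contDiffOn s1.contDiffOn s1.contDiffOn fun t _ => hm t
    have d1 := (hσ.differentiable (by simp)).differentiableAt (x := t) |>.hasDerivAt
    have d2 := (s1.differentiable (by simp)).differentiableAt (x := t) |>.hasDerivAt
    have d3 := (s3.differentiable (by simp)).differentiableAt (x := t) |>.hasDerivAt
    refine d1.prodMk ((d2.congr_deriv ?_).prodMk (d3.congr_deriv ?_))
    · exact eq_sub_of_add_eq rfl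
    · have := he t
      rw [covDeriv] at this
      simp only
      rw [eq_sub_iff_add_eq, ← add_eq_zero_iff_eq_neg]
      exact this
  have := autonomous_ode_unique isOpen_fst_mem_CH (contDiffOn_circleField c) (key σ₁ h₁ m₁ e₁) (key σ₂ h₂ m₂ e₂)
    (fun t => m₁ t) (by simp only [h0, h0', h0''])
  funext t
  exact congrArg Prod.fst (congrFun this t)

end ComplexHyperbolic
end

noncomputable section

namespace ComplexHyperbolic

/-! ### Geodesics and horocycles -/

/-- The constant `√-c / 2`. -/
def rate (c : ℝ) : ℝ := Real.sqrt (-c) / 2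

theorem rate_pos {c : ℝ} (hc : c < 0) : 0 < rate c :=
  half_pos (Real.sqrt_pos.2 (by linarith))

theorem four_div_eq {c : ℝ} (hc : c < 0) : 4 / (-c) = (rate c ^ 2)⁻¹ := by
  rw [rate, div_pow, Real.sq_sqrt (by linarith)]
  norm_num

/-- The horizontal lift of a tangent vector at `pr W`. -/
def hlift {n : ℕ} (W : HV n) : CE n →ₗ[ℂ] HV n where
  toFun u := W 0 • tvec u - (q W (W 0 • tvec u) / q W W) • W
  map_add' u v := by simp only [map_add, smul_add, q_add_right]; module
  map_smul' r u := by
    simp only [map_smul, q_smul_right, RingHom.id_apply]; module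

theorem hlift_apply {n : ℕ} (W : HV n) (u : CE n) :
    hlift W u = W 0 • tvec u - (q W (W 0 • tvec u) / q W W) • W := rfl

theorem q_hlift {n : ℕ} {W : HV n} (h : (q W W).re < 0) (u : CE n) : q W (hlift W u) = 0 := by
  rw [hlift_apply, q_sub_right, q_smul_right _ W, div_mul_cancel₀ _ (q_self_ne_of_neg h), sub_self]

theorem dpr_hlift {n : ℕ} {W : HV n} (h : (q W W).re < 0) (u : CE n) : dpr W (hlift W u) = u := by
  have h0 := zero_ne_of_neg h
  rw [hlift_apply, map_sub, map_smul, map_smul, dpr_self h0, dpr_tvec, smul_zero, sub_zero,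
    smul_smul, mul_inv_cancel₀ h0, one_smul]

theorem hlift_dpr {n : ℕ} {W A : HV n} (h : (q W W).re < 0) (hA : q W A = 0) :
    hlift W (dpr W A) = A := by
  have h1 : dpr W (hlift W (dpr W A) - A) = 0 := by rw [map_sub, dpr_hlift h, sub_self]
  have h2 := dpr_eq_zero (zero_ne_of_neg h) h1
  have h3 : q W (hlift W (dpr W A) - A) = 0 := by rw [q_sub_right, q_hlift h, hA, sub_self]
  rw [h2, q_smul_right, mul_eq_zero, or_iff_left (q_self_ne_of_neg h)] at h3
  rw [h3, zero_smul] at h2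
  exact sub_eq_zero.1 h2

theorem metric_dpr_unit {n : ℕ} {c : ℝ} (hc : c < 0) {W : HV n} (hW : q W W = -1) (A B : HV n) :
    metric c (pr W) (dpr W A) (dpr W B) = (rate c ^ 2)⁻¹ * (q A W * q W B + q A B).re := by
  rw [metric_dpr c (by simp [hW]), four_div_eq hc, hW]
  simp

/-- A unit vector of `ℂ^{1,n}` over a point of the ball. -/
theorem exists_unit_lift {n : ℕ} {z : CE n} (hz : z ∈ CH n) :
    ∃ r : ℝ, 0 < r ∧ q (r • homog z) (r • homog z) = -1 ∧ pr (r • homog z) = z := by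
  rw [mem_CH_iff] at hz
  set s := -(q (homog z) (homog z)).re with hs
  have hs0 : 0 < s := by linarith
  have hr : 0 < (Real.sqrt s)⁻¹ := inv_pos.2 (Real.sqrt_pos.2 hs0)
  refine ⟨(Real.sqrt s)⁻¹, hr, ?_, ?_⟩
  · rw [q_rsmul_left, q_rsmul_right, ← q_self_ofReal, show (q (homog z) (homog z)).re = -s by
      rw [hs, neg_neg], ← Complex.ofReal_mul, ← Complex.ofReal_mul, ← Complex.ofReal_one,
      ← Complex.ofReal_neg, Complex.ofReal_inj]
    have := Real.mul_self_sqrt hs0.le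
    have := Real.sqrt_pos.2 hs0
    field_simp
    nlinarith
  · rw [pr_rsmul hr.ne', pr_homog]

/-- The lift of the geodesic with initial data `P`, `U`. -/
def geoLift {n : ℕ} (l : ℝ) (P U : HV n) (t : ℝ) : HV n :=
  Real.cosh (l * t) • P + Real.sinh (l * t) • U

theorem hasDerivAt_geoLift {n : ℕ} (l : ℝ) (P U : HV n) (t : ℝ) :
    HasDerivAt (geoLift l P U) (l • geoLift l U P t) t := by
  have h := (hasDerivAt_id t).const_mul l
  refine ((h.cosh.smul_const P).add (h.sinh.smul_const U)).congr_deriv ?_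
  simp only [geoLift, id]
  module

theorem contDiff_geoLift {n : ℕ} (l : ℝ) (P U : HV n) {m : WithTop ℕ∞} :
    ContDiff ℝ m (geoLift l P U) := by
  unfold geoLift
  exact ((Real.contDiff_cosh.comp (contDiff_const.mul contDiff_id)).smul contDiff_const).add
    ((Real.contDiff_sinh.comp (contDiff_const.mul contDiff_id)).smul contDiff_const)

theorem q_geoLift_self {n : ℕ} {l : ℝ} {P U : HV n} (hP : q P P = -1) (hU : q U U = 1)
    (hPU : q P U = 0) (t : ℝ) : q (geoLift l P U t) (geoLift l P U t) = -1 := by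
  simp only [geoLift, q_add_left, q_add_right, q_rsmul_left, q_rsmul_right, hP, hU, hPU,
    q_comm_zero hPU]
  have : (Real.cosh (l * t) : ℂ) ^ 2 = Real.sinh (l * t) ^ 2 + 1 := by
    exact_mod_cast Real.cosh_sq (l * t)
  linear_combination -this

theorem q_geoLift_deriv {n : ℕ} {l : ℝ} {P U : HV n} (hP : q P P = -1) (hU : q U U = 1)
    (hPU : q P U = 0) (t : ℝ) : q (geoLift l P U t) (geoLift l U P t) = 0 ∧
      q (geoLift l U P t) (geoLift l U P t) = 1 := by
  simp only [geoLift, q_add_left, q_add_right, q_rsmul_left, q_rsmul_right, hP, hU, hPU,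
    q_comm_zero hPU]
  have : (Real.cosh (l * t) : ℂ) ^ 2 = Real.sinh (l * t) ^ 2 + 1 := by
    exact_mod_cast Real.cosh_sq (l * t)
  exact ⟨by ring, by linear_combination this⟩

theorem geoLift_zero {n : ℕ} (l : ℝ) (P U : HV n) : geoLift l P U 0 = P := by
  simp [geoLift]

theorem deriv_pr_geoLift {n : ℕ} {l : ℝ} {P U : HV n} (hP : q P P = -1) (hU : q U U = 1)
    (hPU : q P U = 0) : deriv (fun t => pr (geoLift l P U t))
      = fun t => dpr (geoLift l P U t) (l • geoLift l U P t) :=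
  funext fun t => (hasDerivAt_pr (hasDerivAt_geoLift l P U t)
    (zero_ne_of_neg (by simp [q_geoLift_self hP hU hPU]))).deriv

theorem isGeodesic_pr_geoLift {n : ℕ} (l : ℝ) {P U : HV n} (hP : q P P = -1) (hU : q U U = 1)
    (hPU : q P U = 0) : IsGeodesic (fun t => pr (geoLift l P U t)) := by
  have hW := q_geoLift_self (l := l) hP hU hPU
  have hW' := q_geoLift_deriv (l := l) hP hU hPU
  have hneg : ∀ t, (q (geoLift l P U t) (geoLift l P U t)).re < 0 := fun t => by simp [hW]
  refine ⟨contDiff_pr (contDiff_geoLift l P U) fun t => zero_ne_of_neg (hneg t),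
    fun t => pr_mem_CH (hneg t), fun t => ?_⟩
  have hd : HasDerivAt (fun s => l • geoLift l U P s) (l • l • geoLift l P U t) t :=
    (hasDerivAt_geoLift l U P t).const_smul l
  rw [deriv_pr_geoLift hP hU hPU, covDeriv_dpr (hasDerivAt_geoLift l P U t) hd (hneg t), q_rsmul_right, (hW' t).1, mul_zero,
    zero_div, zero_smul, sub_zero, sub_zero, real_smul_eq_coe_smul,
    real_smul_eq_coe_smul, map_smul, map_smul, dpr_self (zero_ne_of_neg (hneg t)), smul_zero,
    smul_zero]

theorem isUnitGeodesic_pr_geoLift {n : ℕ} {c : ℝ} (hc : c < 0) {P U : HV n} (hP : q P P = -1)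
    (hU : q U U = 1) (hPU : q P U = 0) :
    IsUnitGeodesic c (fun t => pr (geoLift (rate c) P U t)) := by
  refine ⟨isGeodesic_pr_geoLift _ hP hU hPU, fun t => ?_⟩
  rw [deriv_pr_geoLift hP hU hPU, metric_dpr_unit hc (q_geoLift_self hP hU hPU t), q_rsmul_left,
    q_rsmul_right, q_rsmul_left, q_rsmul_right, (q_geoLift_deriv hP hU hPU t).1,
    (q_geoLift_deriv hP hU hPU t).2]
  have := (rate_pos hc).ne'
  simp
  field_simp

theorem deriv_pr_geoLift_zero {n : ℕ} {l : ℝ} {P U : HV n} (hP : q P P = -1) (hU : q U U = 1)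
    (hPU : q P U = 0) : deriv (fun t => pr (geoLift l P U t)) 0 = l • dpr P U := by
  rw [deriv_pr_geoLift hP hU hPU]
  simp only [geoLift_zero]
  rw [real_smul_eq_coe_smul, map_smul]
  rfl

/-- Every unit speed geodesic is the projection of some `geoLift`, over any unit lift of its
starting point. -/
theorem IsUnitGeodesic.exists_geoLift {n : ℕ} {c : ℝ} (hc : c < 0) {γ : ℝ → CE n}
    (hγ : IsUnitGeodesic c γ) {P : HV n} (hP : q P P = -1) (hP0 : pr P = γ 0) :
    ∃ U, q U U = 1 ∧ q P U = 0 ∧ γ = (fun t => pr (geoLift (rate c) P U t)) ∧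
      deriv γ 0 = rate c • dpr P U := by
  have hneg : (q P P).re < 0 := by simp [hP]
  have hl := (rate_pos hc).ne'
  have h1 : q P (hlift P ((rate c)⁻¹ • deriv γ 0)) = 0 := q_hlift hneg _
  have h2 : deriv γ 0 = rate c • dpr P (hlift P ((rate c)⁻¹ • deriv γ 0)) := by
    rw [dpr_hlift hneg, smul_smul, mul_inv_cancel₀ hl, one_smul]
  set U := hlift P ((rate c)⁻¹ • deriv γ 0)
  have hUU : q U U = 1 := by
    have := hγ.2 0
    have e : rate c • dpr P U = dpr P (rate c • U) := by
      rw [real_smul_eq_coe_smul, map_smul]; rfl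
    rw [← hP0, h2, e, metric_dpr_unit hc hP] at this
    simp only [q_rsmul_left, q_rsmul_right, h1, mul_zero, zero_add, Complex.re_ofReal_mul] at this
    rw [← q_self_ofReal, Complex.ofReal_eq_one]
    field_simp at this
    exact this
  refine ⟨U, hUU, h1, ?_, h2⟩
  refine geodesic_unique hγ.1 (isGeodesic_pr_geoLift _ hP hUU h1) ?_ ?_
  · rw [geoLift_zero, hP0]
  · rw [deriv_pr_geoLift_zero hP hUU h1, ← h2]

/-- The lift of a horocycle through `pr v`. -/
def horoLift {n : ℕ} (l : ℝ) (v w X : HV n) (t : ℝ) : HV n :=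
  v + t • w + (t ^ 2 * l ^ 2 / 2) • X

theorem horoLift_zero {n : ℕ} (l : ℝ) (v w X : HV n) : horoLift l v w X 0 = v := by
  simp [horoLift]

theorem hasDerivAt_horoLift {n : ℕ} (l : ℝ) (v w X : HV n) (t : ℝ) :
    HasDerivAt (horoLift l v w X) (w + (t * l ^ 2) • X) t := by
  have h := hasDerivAt_id t
  have h2 := (((hasDerivAt_pow 2 t).mul_const (l ^ 2)).div_const 2).smul_const X
  refine (((hasDerivAt_const t v).add (h.smul_const w)).add h2).congr_deriv ?_
  simp only [Nat.cast_ofNat]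
  match_scalars <;> ring

structure IsHoroData {n : ℕ} (l : ℝ) (v w X : HV n) : Prop where
  vv : q v v = -1
  vw : q v w = 0
  ww : q w w = ((l ^ 2 : ℝ) : ℂ)
  XX : q X X = 0
  Xv : q X v = -1
  Xw : q X w = 0

theorem IsHoroData.vX {n : ℕ} {l : ℝ} {v w X : HV n} (h : IsHoroData l v w X) : q v X = -1 := by
  rw [← q_conj, h.Xv]; simp

theorem IsHoroData.self {n : ℕ} {l : ℝ} {v w X : HV n} (h : IsHoroData l v w X) (t : ℝ) :
    q (horoLift l v w X t) (horoLift l v w X t) = -1 := by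
  simp only [horoLift, q_add_left, q_add_right, q_rsmul_left, q_rsmul_right, h.vv, h.vw, h.ww,
    h.XX, h.Xv, h.Xw, h.vX, q_comm_zero h.vw, q_comm_zero h.Xw]
  push_cast
  ring

theorem IsHoroData.self_deriv {n : ℕ} {l : ℝ} {v w X : HV n} (h : IsHoroData l v w X) (t : ℝ) :
    q (horoLift l v w X t) (w + (t * l ^ 2) • X) = 0 := by
  simp only [horoLift, q_add_left, q_add_right, q_rsmul_left, q_rsmul_right, h.vw, h.ww,
    h.XX, h.Xw, h.vX, q_comm_zero h.Xw]
  push_cast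
  ring

theorem IsHoroData.self_X {n : ℕ} {l : ℝ} {v w X : HV n} (h : IsHoroData l v w X) (t : ℝ) :
    q (horoLift l v w X t) X = -1 := by
  simp only [horoLift, q_add_left, q_rsmul_left, h.XX, h.vX, q_comm_zero h.Xw]
  ring

/-- The properties of the projections of the curves `horoLift`. -/
theorem IsHoroData.curve {n : ℕ} {c : ℝ} (hc : c < 0) {v w X : HV n}
    (h : IsHoroData (rate c) v w X) {σ : ℝ → CE n}
    (hσ : σ = fun t => pr (horoLift (rate c) v w X t)) :
    ContDiff ℝ ∞ σ ∧ (∀ t, σ t ∈ CH n) ∧ σ 0 = pr v ∧ deriv σ 0 = dpr v w ∧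
    (∀ t, metric c (σ t) (deriv σ t) (deriv σ t) = 1) ∧
    (∀ t, covDeriv σ (covDeriv σ (deriv σ)) t
      + metric c (σ t) (covDeriv σ (deriv σ) t) (covDeriv σ (deriv σ) t) • deriv σ t = 0) ∧
    covDeriv σ (deriv σ) 0 = (rate c ^ 2) • dpr v X := by
  set l := rate c
  have hl : l ≠ 0 := (rate_pos hc).ne'
  have hneg : ∀ t, (q (horoLift l v w X t) (horoLift l v w X t)).re < 0 := fun t => by
    simp [h.self]
  have d1 : deriv σ = fun t => dpr (horoLift l v w X t) (w + (t * l ^ 2) • X) := by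
    rw [hσ]
    exact funext fun t => (hasDerivAt_pr (hasDerivAt_horoLift l v w X t)
      (zero_ne_of_neg (hneg t))).deriv
  have d2 : covDeriv σ (deriv σ) = fun t => dpr (horoLift l v w X t) (l ^ 2 • X) := by
    funext t
    have hA : HasDerivAt (fun s : ℝ => w + (s * l ^ 2) • X) (l ^ 2 • X) t := by
      simpa using (((hasDerivAt_id t).mul_const (l ^ 2)).smul_const X).const_add w
    rw [d1, hσ, covDeriv_dpr (hasDerivAt_horoLift l v w X t) hA (hneg t), h.self_deriv, zero_div,
      zero_smul, sub_zero, sub_zero]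
  have d3 : ∀ t, covDeriv σ (covDeriv σ (deriv σ)) t = -(l ^ 2 • deriv σ t) := by
    intro t
    rw [d2, d1, hσ, covDeriv_dpr (hasDerivAt_horoLift l v w X t) (hasDerivAt_const t _) (hneg t),
      h.self_deriv, zero_div, zero_smul, sub_zero, q_rsmul_right, h.self_X, h.self, zero_sub,
      map_neg, map_smul]
    norm_num
    norm_cast
  refine ⟨?_, fun t => hσ ▸ pr_mem_CH (hneg t), ?_, ?_, fun t => ?_, fun t => ?_, ?_⟩
  · rw [hσ]
    refine contDiff_pr ?_ fun t => zero_ne_of_neg (hneg t)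
    unfold horoLift
    fun_prop
  · rw [hσ]
    simp only [horoLift_zero]
  · rw [d1]
    simp [horoLift_zero]
  · have e : q (w + (t * l ^ 2) • X) (w + (t * l ^ 2) • X) = ((l ^ 2 : ℝ) : ℂ) := by
      simp only [q_add_left, q_add_right, q_rsmul_left, q_rsmul_right, h.ww, h.XX, h.Xw,
        q_comm_zero h.Xw]
      ring
    rw [d1, hσ, metric_dpr_unit hc (h.self t), h.self_deriv, mul_zero, zero_add, e,
      Complex.ofReal_re]
    exact inv_mul_cancel₀ (pow_ne_zero 2 hl)
  · have e : metric c (σ t) (covDeriv σ (deriv σ) t) (covDeriv σ (deriv σ) t) = l ^ 2 := by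
      rw [d2, hσ, metric_dpr_unit hc (h.self t)]
      rw [← q_conj (horoLift l v w X t)]
      simp only [q_rsmul_left, q_rsmul_right, h.self_X, h.XX]
      change (l ^ 2)⁻¹ * _ = l ^ 2
      simp [-Complex.ofReal_pow]
      field_simp
    rw [e, d3, neg_add_cancel]
  · rw [d2]
    simp only [horoLift_zero]
    rw [real_smul_eq_coe_smul, map_smul]
    norm_cast

/-- A curve with the characteristic properties of a horocycle is the projection of a
`horoLift`. -/
theorem IsHoroData.unique {n : ℕ} {c : ℝ} (hc : c < 0) {v w X : HV n}
    (h : IsHoroData (rate c) v w X) {σ : ℝ → CE n} (h1 : ContDiff ℝ ∞ σ) (h2 : ∀ t, σ t ∈ CH n)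
    (h3 : σ 0 = pr v) (h4 : deriv σ 0 = dpr v w)
    (h5 : ∀ t, covDeriv σ (covDeriv σ (deriv σ)) t
      + metric c (σ t) (covDeriv σ (deriv σ) t) (covDeriv σ (deriv σ) t) • deriv σ t = 0)
    (h6 : covDeriv σ (deriv σ) 0 = (rate c ^ 2) • dpr v X) :
    σ = fun t => pr (horoLift (rate c) v w X t) := by
  obtain ⟨g1, g2, g3, g4, _, g5, g6⟩ := h.curve hc rfl
  exact circle_unique h1 g1 h2 g2 h5 g5 (h3.trans g3.symm) (h4.trans g4.symm) (h6.trans g6.symm)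

end ComplexHyperbolic
end

noncomputable section

namespace ComplexHyperbolic

/-! ### Points at infinity -/

theorem metric_self_le {n : ℕ} {c : ℝ} (hc : c < 0) {z : CE n} {ρ : ℝ} (hρ : 0 < ρ)
    (hz : ρ ≤ 1 - ‖z‖ ^ 2) (u : CE n) :
    metric c z u u ≤ 4 / (-c) * (2 * (‖u‖ / ρ) ^ 2) := by
  have e : (((1 - ‖z‖ ^ 2 : ℝ) : ℂ) * inner ℂ u u + inner ℂ u z * inner ℂ z u).re
      = (1 - ‖z‖ ^ 2) * ‖u‖ ^ 2 + ‖(inner ℂ z u : ℂ)‖ ^ 2 := by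
    rw [Complex.add_re, Complex.re_ofReal_mul, ← inner_conj_symm u z,
      ← Complex.normSq_eq_conj_mul_self, Complex.normSq_eq_norm_sq, Complex.ofReal_re,
      ← inner_self_eq_norm_sq (𝕜 := ℂ) u]
    rfl
  have hc' : 0 < 4 / (-c) := div_pos (by norm_num) (by linarith)
  rw [metric, e, mul_div_assoc]
  refine mul_le_mul_of_nonneg_left ?_ hc'.le
  have h1 : ‖z‖ ≤ 1 := by nlinarith [norm_nonneg z]
  have h2 : ‖(inner ℂ z u : ℂ)‖ ≤ ‖u‖ :=
    (norm_inner_le_norm z u).trans (mul_le_of_le_one_left (norm_nonneg u) h1)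
  have h3 : ‖(inner ℂ z u : ℂ)‖ ^ 2 ≤ ‖u‖ ^ 2 := by gcongr
  have h4 : (1 - ‖z‖ ^ 2) * ‖u‖ ^ 2 ≤ ‖u‖ ^ 2 :=
    mul_le_of_le_one_left (by positivity) (by nlinarith [norm_nonneg z])
  rw [div_pow, ← mul_div_assoc]
  exact div_le_div₀ (by positivity) (by linarith) (by positivity) (by gcongr)

theorem exists_segment {n : ℕ} (p r : CE n) :
    ContDiff ℝ 1 (fun t : ℝ => p + t • (r - p)) ∧
      ∀ t, deriv (fun t : ℝ => p + t • (r - p)) t = r - p := by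
  refine ⟨by fun_prop, fun t => ?_⟩
  have : HasDerivAt (fun t : ℝ => p + t • (r - p)) ((1 : ℝ) • (r - p)) t :=
    ((hasDerivAt_id t).smul_const (r - p)).const_add p
  rw [this.deriv, one_smul]

theorem segment_norm_sq {n : ℕ} {p r : CE n} {ρ : ℝ} (hp : ρ ≤ 1 - ‖p‖ ^ 2)
    (hr : ρ ≤ 1 - ‖r‖ ^ 2) {t : ℝ} (ht : t ∈ Set.Icc (0 : ℝ) 1) :
    ρ ≤ 1 - ‖p + t • (r - p)‖ ^ 2 := by
  have e : p + t • (r - p) = (1 - t) • p + t • r := by module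
  have h1 : ‖p + t • (r - p)‖ ≤ (1 - t) * ‖p‖ + t * ‖r‖ := by
    rw [e]
    refine (norm_add_le _ _).trans_eq ?_
    rw [norm_smul, norm_smul, Real.norm_of_nonneg ht.1,
      Real.norm_of_nonneg (sub_nonneg.2 ht.2)]
  have h2 : ‖p + t • (r - p)‖ ^ 2 ≤ ((1 - t) * ‖p‖ + t * ‖r‖) ^ 2 := by gcongr
  have h3 : ((1 - t) * ‖p‖ + t * ‖r‖) ^ 2 ≤ (1 - t) * ‖p‖ ^ 2 + t * ‖r‖ ^ 2 := by
    nlinarith [mul_nonneg (mul_nonneg ht.1 (sub_nonneg.2 ht.2)) (sq_nonneg (‖p‖ - ‖r‖))]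
  nlinarith [ht.1, ht.2]

theorem rdist_le_segment {n : ℕ} {c : ℝ} (hc : c < 0) {p r : CE n} {ρ : ℝ} (hρ : 0 < ρ)
    (hp : ρ ≤ 1 - ‖p‖ ^ 2) (hr : ρ ≤ 1 - ‖r‖ ^ 2) :
    rdist c p r ≤ Real.sqrt (4 / (-c) * (2 * (‖r - p‖ / ρ) ^ 2)) := by
  obtain ⟨h1, h2⟩ := exists_segment p r
  have hm : ∀ t ∈ Set.Icc (0 : ℝ) 1, p + t • (r - p) ∈ CH n := by
    intro t ht
    have := segment_norm_sq hp hr ht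
    rw [CH, mem_ball_zero_iff]
    nlinarith [norm_nonneg (p + t • (r - p))]
  have h3 : rdist c p r ≤ ∫ t in (0 : ℝ)..1, Real.sqrt (metric c (p + t • (r - p))
      (deriv (fun t : ℝ => p + t • (r - p)) t) (deriv (fun t : ℝ => p + t • (r - p)) t)) := by
    refine csInf_le ⟨0, ?_⟩ ⟨_, h1, hm, by simp, by simp, rfl⟩
    rintro L ⟨γ, -, -, -, -, rfl⟩
    exact intervalIntegral.integral_nonneg zero_le_one fun t _ => Real.sqrt_nonneg _
  refine h3.trans ((le_abs_self _).trans ?_)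
  rw [← Real.norm_eq_abs]
  refine (intervalIntegral.norm_integral_le_of_norm_le_const fun t ht => ?_).trans
    (by rw [sub_zero, abs_one, mul_one])
  rw [Set.uIoc_of_le zero_le_one] at ht
  rw [Real.norm_of_nonneg (Real.sqrt_nonneg _), h2]
  exact Real.sqrt_le_sqrt
    (metric_self_le hc hρ (segment_norm_sq hp hr (Set.Ioc_subset_Icc_self ht)) _)

theorem q_ne_zero_of_null {n : ℕ} {X W : HV n} (hX : X ≠ 0) (hXX : q X X = 0)
    (hW : (q W W).re < 0) : q X W ≠ 0 := by
  intro h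
  exact hX ((q_self_nonneg_of_orthogonal hW (q_comm_zero h)).2 (by rw [hXX]; rfl))

/-- A Busemann function of the point at infinity represented by the null vector `X`. -/
def busemann {n : ℕ} (X : HV n) (z : CE n) : ℝ :=
  Real.log (‖q X (homog z)‖ ^ 2) - Real.log (-(q (homog z) (homog z)).re)

theorem busemann_pr {n : ℕ} {X W : HV n} (hX : X ≠ 0) (hXX : q X X = 0) (hW : q W W = -1) :
    busemann X (pr W) = Real.log (‖q X W‖ ^ 2) := by
  have hneg : (q W W).re < 0 := by simp [hW]
  have h0 := zero_ne_of_neg hneg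
  have h1 := norm_pos_iff.2 (q_ne_zero_of_null hX hXX hneg)
  have h2 := norm_pos_iff.2 h0
  rw [busemann, homog_pr h0, q_smul_right, q_smul_right, q_smul_left, hW]
  have e : ((W 0)⁻¹ * ((starRingEnd ℂ) (W 0)⁻¹ * -1)).re = -((‖W 0‖ ^ 2)⁻¹) := by
    rw [← mul_assoc, mul_comm (W 0)⁻¹, ← Complex.normSq_eq_conj_mul_self,
      Complex.normSq_eq_norm_sq, norm_inv, inv_pow]
    simp only [mul_neg, mul_one, Complex.neg_re, Complex.ofReal_re]
  rw [e, neg_neg, norm_mul, norm_inv, mul_pow, Real.log_mul (by positivity) (by positivity),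
    inv_pow]
  ring

theorem norm_q_sq_le {n : ℕ} {X W A : HV n} (hXX : q X X = 0) (hW : (q W W).re < 0)
    (hA : q W A = 0) : ‖q X A‖ ^ 2 * -(q W W).re ≤ ‖q X W‖ ^ 2 * (q A A).re := by
  have hne := q_self_ne_of_neg hW
  have h1 : q W (X - (q W X / q W W) • W) = 0 := by
    rw [q_sub_right, q_smul_right, div_mul_cancel₀ _ hne, sub_self]
  have h := q_cauchy_schwarz hW h1 hA
  have e1 : q (X - (q W X / q W W) • W) A = q X A := by
    rw [q_sub_left, q_smul_left, hA, mul_zero, sub_zero]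
  have e2 : q (X - (q W X / q W W) • W) (X - (q W X / q W W) • W)
      = ((‖q X W‖ ^ 2 / -(q W W).re : ℝ) : ℂ) := by
    rw [q_sub_left, q_smul_left, h1, mul_zero, sub_zero, q_sub_right, q_smul_right, hXX, zero_sub]
    push_cast
    rw [q_self_ofReal, ← q_conj X W, mul_comm_div, div_neg, neg_inj, ← mul_div_assoc,
      ← Complex.normSq_eq_conj_mul_self, Complex.normSq_eq_norm_sq]
    norm_cast
  rw [e1, e2, Complex.ofReal_re] at h
  have hN : 0 < -(q W W).re := by linarith
  calc ‖q X A‖ ^ 2 * -(q W W).re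
      ≤ ‖q X W‖ ^ 2 / -(q W W).re * (q A A).re * -(q W W).re := by gcongr
    _ = ‖q X W‖ ^ 2 * (q A A).re := by rw [div_mul_eq_mul_div, div_mul_cancel₀ _ hN.ne']

theorem hasDerivAt_busemann {n : ℕ} {c : ℝ} (hc : c < 0) {X : HV n} (hX : X ≠ 0)
    (hXX : q X X = 0) {β : ℝ → CE n} {u : CE n} {t : ℝ} (hβ : HasDerivAt β u t)
    (hm : β t ∈ CH n) : ∃ b, HasDerivAt (fun s => busemann X (β s)) b t ∧
      b ≤ 2 * rate c * Real.sqrt (metric c (β t) u u) := by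
  have hneg := mem_CH_iff.1 hm
  set W := homog (β t) with hW
  have hne := q_self_ne_of_neg hneg
  have hXW := q_ne_zero_of_null hX hXX hneg
  set A := hlift W u
  have hA : q W A = 0 := q_hlift hneg u
  have hu : dpr W A = u := dpr_hlift hneg u
  set κ := q W (tvec u) / q W W with hκ
  have eA : tvec u = A + κ • W := by
    simp only [A, hlift_apply, κ]
    simp [hW]
  have d1 : HasDerivAt (fun s => q X (homog (β s))) (q X (tvec u)) t := by
    have h : HasDerivAt (fun s => inner ℂ (tl X) (β s) - (starRingEnd ℂ) (X 0))
        (inner ℂ (tl X) u) t := by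
      simpa using ((hasDerivAt_const t (tl X)).inner ℂ hβ).sub_const ((starRingEnd ℂ) (X 0))
    simpa [q] using h
  have d2 : HasDerivAt (fun s => -(q (homog (β s)) (homog (β s))).re)
      (-(2 * (q W (tvec u)).re)) t := by
    have h := hβ.norm_sq.sub_const 1
    have e : (q W (tvec u)).re = inner ℝ (β t) u := by
      simp [q, W, PiLp.inner_apply]
    rw [e]
    refine h.neg.congr_of_eventuallyEq (Filter.Eventually.of_forall fun s => ?_)
    simp [q_self_re]
  have d3 := d1.norm_sq
  have hn1 : ‖q X W‖ ^ 2 ≠ 0 := pow_ne_zero 2 (norm_ne_zero_iff.2 hXW)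
  have hN : 0 < -(q W W).re := by linarith
  refine ⟨_, (d3.log hn1).sub (d2.log hN.ne'), ?_⟩
  have e1 : 2 * inner ℝ (q X W) (q X (tvec u)) / ‖q X W‖ ^ 2 - -(2 * (q W (tvec u)).re) /
      -(q W W).re = 2 * (q X A / q X W).re := by
    have e2 : inner ℝ (q X W) (q X (tvec u)) / ‖q X W‖ ^ 2 = (q X (tvec u) / q X W).re := by
      rw [Complex.inner, div_eq_mul_inv (q X (tvec u)), Complex.inv_def, ← mul_assoc,
        Complex.re_mul_ofReal, Complex.normSq_eq_norm_sq, div_eq_mul_inv]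
    have e3 : (q W (tvec u)).re / (q W W).re = κ.re := by
      rw [hκ, ← q_self_ofReal W, Complex.div_ofReal_re, Complex.ofReal_re]
    rw [mul_div_assoc, e2, neg_div_neg_eq, mul_div_assoc, e3, eA, q_add_right, q_smul_right,
      add_div, mul_div_cancel_right₀ _ hXW, Complex.add_re]
    ring
  refine (le_of_eq e1).trans ?_
  rw [mul_assoc]
  refine mul_le_mul_of_nonneg_left ?_ zero_le_two
  refine (Complex.re_le_norm _).trans ?_
  have hl := rate_pos hc
  have e4 : metric c (β t) u u = (rate c ^ 2)⁻¹ * ((q A A).re / -(q W W).re) := by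
    have h := metric_dpr c hneg A A
    rw [hu, hW, pr_homog, ← hW] at h
    rw [h, four_div_eq hc, hA, mul_zero, zero_sub, ← q_self_ofReal W]
    simp only [Complex.neg_re, Complex.re_mul_ofReal, Complex.ofReal_re]
    have := hN.ne'
    field_simp
  have h5 : ‖q X A / q X W‖ ^ 2 ≤ (q A A).re / -(q W W).re := by
    rw [norm_div, div_pow, div_le_div_iff₀ (by positivity) hN]
    have := norm_q_sq_le hXX hneg hA
    linarith
  rw [e4, Real.sqrt_mul (by positivity), Real.sqrt_inv, Real.sqrt_sq hl.le,
    mul_inv_cancel_left₀ hl.ne']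
  exact Real.le_sqrt_of_sq_le h5

theorem busemann_sub_le {n : ℕ} {c : ℝ} (hc : c < 0) {X : HV n} (hX : X ≠ 0)
    (hXX : q X X = 0) {p r : CE n} (hp : p ∈ CH n) (hr : r ∈ CH n) :
    busemann X r - busemann X p ≤ 2 * rate c * rdist c p r := by
  have hl : 0 < 2 * rate c := by linarith [rate_pos hc]
  rw [mul_comm, ← div_le_iff₀ hl]
  refine le_csInf ?_ ?_
  · obtain ⟨h1, -⟩ := exists_segment p r
    rw [CH, mem_ball_zero_iff] at hp hr
    refine ⟨_, _, h1, fun t ht => ?_, by simp, by simp, rfl⟩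
    have h2 : min (1 - ‖p‖ ^ 2) (1 - ‖r‖ ^ 2) ≤ 1 - ‖p + t • (r - p)‖ ^ 2 :=
      segment_norm_sq (min_le_left _ _) (min_le_right _ _) ht
    have h3 : 0 < min (1 - ‖p‖ ^ 2) (1 - ‖r‖ ^ 2) :=
      lt_min (by nlinarith [norm_nonneg p]) (by nlinarith [norm_nonneg r])
    rw [CH, mem_ball_zero_iff]
    nlinarith [norm_nonneg (p + t • (r - p))]
  · rintro L ⟨γ, h1, h2, rfl, rfl, rfl⟩
    rw [div_le_iff₀ hl, mul_comm]
    have hd : ∀ t, HasDerivAt γ (deriv γ t) t := fun t =>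
      (h1.differentiable (by simp)).differentiableAt.hasDerivAt
    choose! b hb hb' using fun t (ht : t ∈ Set.Icc (0 : ℝ) 1) =>
      hasDerivAt_busemann hc hX hXX (hd t) (h2 t ht)
    rw [← intervalIntegral.integral_const_mul]
    refine intervalIntegral.sub_le_integral_of_hasDeriv_right_of_le zero_le_one
      (g' := b) (fun t ht => (hb t ht).continuousAt.continuousWithinAt)
      (fun t ht => (hb t (Set.Ioo_subset_Icc_self ht)).hasDerivWithinAt) ?_
      (fun t ht => hb' t (Set.Ioo_subset_Icc_self ht))
    refine ContinuousOn.integrableOn_Icc ?_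
    have h3 : ContDiffOn ℝ 0 (fun t => metric c (γ t) (deriv γ t) (deriv γ t)) (Set.Icc 0 1) := by
      have h4 : ContDiffOn ℝ 0 (deriv γ) (Set.Icc 0 1) :=
        contDiffOn_zero.2 (h1.continuous_deriv le_rfl).continuousOn
      exact contDiffOn_metric c (h1.of_le zero_le_one).contDiffOn h4 h4 h2
    exact continuousOn_const.mul (contDiffOn_zero.1 h3).sqrt

theorem geoLift_eq_exp {n : ℕ} (l : ℝ) (P U : HV n) (t : ℝ) :
    geoLift l P U t = (Real.exp (l * t) / 2) • (P + U) + (Real.exp (-(l * t)) / 2) • (P - U) := by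
  simp only [geoLift, Real.cosh_eq, Real.sinh_eq]
  module

theorem null_endpoint {n : ℕ} {P U : HV n} (hP : q P P = -1) (hU : q U U = 1)
    (hPU : q P U = 0) : q (P + U) (P + U) = 0 ∧ q P (P + U) = -1 ∧ P + U ≠ 0 ∧
      q (P + U) (P - U) = -2 ∧ q (P - U) (P - U) = 0 := by
  have h : q P (P + U) = -1 := by rw [q_add_right, hP, hPU, add_zero]
  refine ⟨?_, h, fun h0 => ?_, ?_, ?_⟩
  · simp [q_add_left, q_add_right, hP, hU, hPU, q_comm_zero hPU]
  · rw [h0, q_zero_right] at h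
    norm_num at h
  · simp [q_add_left, q_sub_right, hP, hU, hPU, q_comm_zero hPU]
    norm_num
  · simp [q_sub_left, q_sub_right, hP, hU, hPU, q_comm_zero hPU]

theorem Asymptotic.endpoint {n : ℕ} {c : ℝ} (hc : c < 0) {P U P' U' : HV n} (hP : q P P = -1)
    (hU : q U U = 1) (hPU : q P U = 0) (hP' : q P' P' = -1) (hU' : q U' U' = 1)
    (hPU' : q P' U' = 0) (h : Asymptotic c (fun t => pr (geoLift (rate c) P U t))
      (fun t => pr (geoLift (rate c) P' U' t))) : q (P + U) (P' + U') = 0 := by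
  obtain ⟨C, hC⟩ := h
  obtain ⟨hXX, hPX, hX, hXY, -⟩ := null_endpoint hP hU hPU
  have hl := rate_pos hc
  set l := rate c
  set X := P + U
  by_contra hs
  have key : ∀ t : ℝ, 0 ≤ t → ‖q X (geoLift l P' U' t)‖ ≤ Real.exp (l * C) := by
    intro t ht
    have n1 := q_geoLift_self (l := l) hP hU hPU t
    have n2 := q_geoLift_self (l := l) hP' hU' hPU' t
    have hn2 : (q (geoLift l P' U' t) (geoLift l P' U' t)).re < 0 := by simp [n2]
    have hn1 : (q (geoLift l P U t) (geoLift l P U t)).re < 0 := by simp [n1]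
    have b := busemann_sub_le hc hX hXX (pr_mem_CH hn1) (pr_mem_CH hn2)
    have b' := b.trans (mul_le_mul_of_nonneg_left (hC t ht) (by positivity))
    rw [busemann_pr hX hXX n1, busemann_pr hX hXX n2, Real.log_pow, Real.log_pow] at b'
    have e : q X (geoLift l P U t) = -(Real.exp (-(l * t)) : ℂ) := by
      rw [geoLift_eq_exp, q_add_right, q_rsmul_right, q_rsmul_right, hXX, hXY]
      push_cast
      ring
    rw [e, norm_neg, Complex.norm_real, Real.norm_of_nonneg (Real.exp_pos _).le, Real.log_exp] at b'
    have hpos := norm_pos_iff.2 (q_ne_zero_of_null hX hXX hn2)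
    rw [← Real.log_le_iff_le_exp hpos]
    have : 0 ≤ l * t := by positivity
    push_cast at b'
    change _ ≤ 2 * l * C at b'
    linarith
  have hpos := norm_pos_iff.2 hs
  set D := ‖q X (P' - U')‖
  have key2 : ∀ t : ℝ, 0 ≤ t → Real.exp (l * t) * ‖q X (P' + U')‖ ≤ 2 * Real.exp (l * C) + D := by
    intro t ht
    have h1 := key t ht
    rw [geoLift_eq_exp, q_add_right, q_rsmul_right, q_rsmul_right] at h1
    have h2 := norm_sub_le_norm_add (((Real.exp (l * t) / 2 : ℝ) : ℂ) * q X (P' + U'))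
      (((Real.exp (-(l * t)) / 2 : ℝ) : ℂ) * q X (P' - U'))
    rw [norm_mul, norm_mul, Complex.norm_real, Complex.norm_real,
      Real.norm_of_nonneg (by positivity), Real.norm_of_nonneg (by positivity)] at h2
    have h3 : Real.exp (-(l * t)) ≤ 1 := Real.exp_le_one_iff.2 (by have := mul_nonneg hl.le ht; linarith)
    have h4 : Real.exp (-(l * t)) * D ≤ D := mul_le_of_le_one_left (norm_nonneg _) h3
    linarith
  have h5 := key2 ((2 * Real.exp (l * C) + D) / ‖q X (P' + U')‖ / l) (by positivity)
  rw [mul_div_cancel₀ _ hl.ne'] at h5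
  have h6 := Real.add_one_le_exp ((2 * Real.exp (l * C) + D) / ‖q X (P' + U')‖)
  have h7 := mul_le_mul_of_nonneg_right h6 hpos.le
  rw [add_mul, div_mul_cancel₀ _ hpos.ne'] at h7
  linarith

theorem null_coord_ne_zero {n : ℕ} {X : HV n} (hX : X ≠ 0) (hXX : q X X = 0) : X 0 ≠ 0 := by
  intro h0
  have h := q_self_re X
  rw [hXX, h0] at h
  simp at h
  exact hX (eq_of_tl_eq (by simpa using h.symm) h0)

/-- Estimates along a geodesic converging to the point at infinity `X`. -/
theorem exists_bounds_near_endpoint {n : ℕ} {X Y : HV n} (hX : X ≠ 0) (hXX : q X X = 0)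
    (hYY : q Y Y = 0) (hXY : (q X Y).re < 0) : ∃ C δ : ℝ, 0 < δ ∧ ∀ s ∈ Set.Ioc (0 : ℝ) 1,
      ‖pr (X + s • Y) - pr X‖ ≤ C * s ∧ δ * s ≤ 1 - ‖pr (X + s • Y)‖ ^ 2 := by
  have hX0 := null_coord_ne_zero hX hXX
  have hq : ∀ s : ℝ, (q (X + s • Y) (X + s • Y)).re = 2 * s * (q X Y).re := by
    intro s
    simp only [q_add_left, q_add_right, q_rsmul_left, q_rsmul_right, hXX, hYY, ← q_conj X Y]
    simp
    ring
  have hd : ∀ s ∈ Set.Icc (0 : ℝ) 1, X 0 + s * Y 0 ≠ 0 := by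
    intro s hs
    rcases hs.1.eq_or_lt with rfl | h
    · simpa using hX0
    · have := zero_ne_of_neg (w := X + s • Y) (by rw [hq]; nlinarith)
      simpa using this
  have hcont : ContinuousOn (fun s : ℝ => ‖X 0 + s * Y 0‖) (Set.Icc 0 1) := by fun_prop
  obtain ⟨s₀, hs₀, hmin⟩ := isCompact_Icc.exists_isMinOn (Set.nonempty_Icc.2 zero_le_one) hcont
  obtain ⟨s₁, hs₁, hmax⟩ := isCompact_Icc.exists_isMaxOn (Set.nonempty_Icc.2 zero_le_one) hcont
  set m := ‖X 0 + s₀ * Y 0‖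
  set M := ‖X 0 + s₁ * Y 0‖
  have hm : 0 < m := norm_pos_iff.2 (hd s₀ hs₀)
  have hM : 0 < M := norm_pos_iff.2 (hd s₁ hs₁)
  refine ⟨m⁻¹ * ‖tl Y - Y 0 • pr X‖, -(2 * (q X Y).re) / M ^ 2, by
    apply div_pos <;> [linarith; positivity], fun s hs => ?_⟩
  have hs' := Set.Ioc_subset_Icc_self hs
  have hds := hd s hs'
  have hW0 : (X + s • Y) 0 = X 0 + s * Y 0 := by simp
  constructor
  · have e : pr (X + s • Y) - pr X = (X 0 + s * Y 0)⁻¹ • ((s : ℂ) • (tl Y - Y 0 • pr X)) := by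
      rw [eq_inv_smul_iff₀ hds]
      have e1 : (X 0 + s * Y 0) • pr (X + s • Y) = tl X + (s : ℂ) • tl Y := by
        rw [pr, hW0, smul_smul, mul_inv_cancel₀ hds, one_smul, map_add, real_smul_eq_coe_smul,
          map_smul]
      have e2 : X 0 • pr X = tl X := by rw [pr, smul_smul, mul_inv_cancel₀ hX0, one_smul]
      rw [smul_sub, e1, add_smul, e2]
      module
    rw [e, norm_smul, norm_smul, norm_inv, Complex.norm_real, Real.norm_of_nonneg hs.1.le]
    have : ‖X 0 + s * Y 0‖⁻¹ ≤ m⁻¹ := inv_anti₀ hm (hmin hs')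
    have h2 : 0 ≤ s * ‖tl Y - Y 0 • pr X‖ := mul_nonneg hs.1.le (norm_nonneg _)
    calc _ ≤ m⁻¹ * (s * ‖tl Y - Y 0 • pr X‖) := by gcongr
      _ = _ := by ring
  · have e : 1 - ‖pr (X + s • Y)‖ ^ 2 = -(2 * s * (q X Y).re) / ‖X 0 + s * Y 0‖ ^ 2 := by
      rw [← hq, q_self_re, pr, norm_smul, norm_inv, hW0]
      have := norm_ne_zero_iff.2 hds
      field_simp
      ring
    have h1 : ‖X 0 + s * Y 0‖ ≤ M := hmax hs'
    have h0 : 0 < ‖X 0 + s * Y 0‖ := norm_pos_iff.2 hds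
    have h2 : 0 ≤ -(2 * s * (q X Y).re) := by nlinarith [hs.1]
    rw [e]
    calc _ = -(2 * s * (q X Y).re) / M ^ 2 := by ring
      _ ≤ _ := by gcongr

theorem asymptotic_of_endpoint {n : ℕ} {c : ℝ} (hc : c < 0) {P U P' U' : HV n} (hP : q P P = -1)
    (hU : q U U = 1) (hPU : q P U = 0) (hP' : q P' P' = -1) (hU' : q U' U' = 1)
    (hPU' : q P' U' = 0) {κ : ℂ} (h : P' + U' = κ • (P + U)) :
    Asymptotic c (fun t => pr (geoLift (rate c) P U t))
      (fun t => pr (geoLift (rate c) P' U' t)) := by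
  obtain ⟨hXX, -, hX, hXY, hYY⟩ := null_endpoint hP hU hPU
  obtain ⟨-, -, hX', hXY', hYY'⟩ := null_endpoint hP' hU' hPU'
  have hκ : κ ≠ 0 := by
    rintro rfl
    exact hX' (by rw [h, zero_smul])
  set l := rate c
  have hl : 0 < l := rate_pos hc
  set X := P + U
  obtain ⟨C, δ, hδ, hb⟩ := exists_bounds_near_endpoint hX hXX hYY (by rw [hXY]; norm_num)
  have hre : (q X (κ⁻¹ • (P' - U'))).re < 0 := by
    have e : X = κ⁻¹ • (P' + U') := by rw [h, smul_smul, inv_mul_cancel₀ hκ, one_smul]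
    rw [e, q_smul_left, q_smul_right, ← mul_assoc, ← Complex.normSq_eq_conj_mul_self, hXY',
      Complex.re_ofReal_mul]
    have := Complex.normSq_pos.2 (inv_ne_zero hκ)
    norm_num
    simpa using hκ
  obtain ⟨C', δ', hδ', hb'⟩ := exists_bounds_near_endpoint hX hXX
    (Y := κ⁻¹ • (P' - U')) (by rw [q_smul_left, q_smul_right, hYY', mul_zero, mul_zero]) hre
  refine ⟨Real.sqrt (4 / (-c) * (2 * ((C + C') / min δ δ') ^ 2)), fun t ht => ?_⟩
  set s := Real.exp (-(2 * (l * t))) with hs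
  have hs1 : s ∈ Set.Ioc (0 : ℝ) 1 :=
    ⟨Real.exp_pos _, Real.exp_le_one_iff.2 (by have := mul_nonneg hl.le ht; linarith)⟩
  have hexp : Real.exp (l * t) * s = Real.exp (-(l * t)) := by
    rw [hs, ← Real.exp_add]; ring_nf
  have hne : Real.exp (l * t) / 2 ≠ 0 := by positivity
  have e1 : pr (geoLift l P U t) = pr (X + s • (P - U)) := by
    rw [geoLift_eq_exp, ← pr_rsmul hne (X + s • (P - U))]
    congr 1
    change (Real.exp (l * t) / 2) • X + _ = _
    rw [← hexp]
    module
  have e2 : pr (geoLift l P' U' t) = pr (X + s • (κ⁻¹ • (P' - U'))) := by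
    have e : geoLift l P' U' t = κ • ((Real.exp (l * t) / 2) • (X + s • (κ⁻¹ • (P' - U')))) := by
      rw [geoLift_eq_exp, h, ← hexp]
      simp only [real_smul_eq_coe_smul]
      match_scalars
      · ring
      all_goals field_simp
    rw [e, pr_smul hκ, pr_rsmul hne]
  simp only [e1, e2]
  obtain ⟨a1, a2⟩ := hb s hs1
  obtain ⟨b1, b2⟩ := hb' s hs1
  have hmin : 0 < min δ δ' := lt_min hδ hδ'
  refine (rdist_le_segment hc (ρ := min δ δ' * s) (mul_pos hmin hs1.1)
    ((mul_le_mul_of_nonneg_right (min_le_left _ _) hs1.1.le).trans a2)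
    ((mul_le_mul_of_nonneg_right (min_le_right _ _) hs1.1.le).trans b2)).trans ?_
  have hc' : 0 < 4 / (-c) := div_pos (by norm_num) (by linarith)
  refine Real.sqrt_le_sqrt (mul_le_mul_of_nonneg_left (mul_le_mul_of_nonneg_left
    (pow_le_pow_left₀ (by have := mul_pos hmin hs1.1; positivity) ?_ 2) zero_le_two) hc'.le)
  rw [div_le_div_iff₀ (mul_pos hmin hs1.1) hmin]
  have h3 : ‖pr (X + s • (κ⁻¹ • (P' - U'))) - pr (X + s • (P - U))‖ ≤ (C + C') * s := by
    have := norm_sub_le (pr (X + s • (κ⁻¹ • (P' - U'))) - pr X) (pr (X + s • (P - U)) - pr X)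
    rw [sub_sub_sub_cancel_right] at this
    linarith
  calc _ ≤ (C + C') * s * min δ δ' := by gcongr
    _ = _ := by ring

/-- The endpoint of a point at infinity, normalized with respect to the vector `v`. -/
def normEnd {n : ℕ} (X v : HV n) : HV n := (-(q v X)⁻¹) • X

theorem normEnd_spec {n : ℕ} {X v : HV n} (hX : X ≠ 0) (hXX : q X X = 0) (hv : (q v v).re < 0) :
    q (normEnd X v) (normEnd X v) = 0 ∧ q v (normEnd X v) = -1 ∧ q (normEnd X v) v = -1 := by
  have h : q v (normEnd X v) = -1 := by
    rw [normEnd, q_smul_right, neg_mul, inv_mul_cancel₀]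
    intro h
    exact q_ne_zero_of_null hX hXX hv (q_comm_zero h)
  refine ⟨?_, h, ?_⟩
  · rw [normEnd, q_smul_left, q_smul_right, hXX, mul_zero, mul_zero]
  · rw [← q_conj, h]; simp

theorem normEnd_data {n : ℕ} {X v : HV n} (hX : X ≠ 0) (hXX : q X X = 0) (hv : q v v = -1) :
    q (normEnd X v - v) (normEnd X v - v) = 1 ∧ q v (normEnd X v - v) = 0 := by
  obtain ⟨h1, h2, h3⟩ := normEnd_spec hX hXX (v := v) (by simp [hv])
  simp [q_sub_left, q_sub_right, h1, h2, h3, hv]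

/-- A point at infinity is represented by a null vector `X`, and consists of the unit speed
geodesics ending at `X`. -/
theorem IsPointAtInfinity.exists_null {n : ℕ} {c : ℝ} (hc : c < 0) {x : Set (ℝ → CE n)}
    (hx : IsPointAtInfinity c x) : ∃ X : HV n, X ≠ 0 ∧ q X X = 0 ∧ ∀ (γ : ℝ → CE n) (v : HV n),
      q v v = -1 → pr v = γ 0 →
        (γ ∈ x ↔ γ = fun t => pr (geoLift (rate c) v (normEnd X v - v) t)) := by
  obtain ⟨γ₀, hγ₀, rfl⟩ := hx
  obtain ⟨r, -, hP, hP0⟩ := exists_unit_lift (hγ₀.1.2.1 0)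
  obtain ⟨U, hU, hPU, hγ, -⟩ := hγ₀.exists_geoLift hc hP hP0
  set P := r • homog (γ₀ 0)
  obtain ⟨hXX, hPX, hX, -, -⟩ := null_endpoint hP hU hPU
  refine ⟨P + U, hX, hXX, fun γ v hv hv0 => ⟨?_, ?_⟩⟩
  · rintro ⟨h1, h2⟩
    obtain ⟨U', hU', hPU', hγ', -⟩ := h1.exists_geoLift hc hv hv0
    rw [hγ, hγ'] at h2
    have h3 := Asymptotic.endpoint hc hP hU hPU hv hU' hPU' h2
    obtain ⟨hXX', hPX', hX', -, -⟩ := null_endpoint hv hU' hPU'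
    have hvX : q v (P + U) ≠ 0 := fun h =>
      q_ne_zero_of_null hX hXX (W := v) (by simp [hv]) (q_comm_zero h)
    have h4 := null_eq_smul (W := v) (by simp [hv]) hXX hXX' h3 hvX
    have h5 : normEnd (P + U) v - v = U' := by
      rw [sub_eq_iff_eq_add', h4, hPX', normEnd, neg_div, one_div]
    rw [h5, hγ']
  · intro h
    obtain ⟨h1, h2⟩ := normEnd_data hX hXX hv
    refine ⟨h ▸ isUnitGeodesic_pr_geoLift hc hv h1 h2, ?_⟩
    rw [hγ, h]
    exact asymptotic_of_endpoint hc hP hU hPU hv h1 h2 (κ := -(q v (P + U))⁻¹)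
      (by rw [add_sub_cancel, normEnd])

end ComplexHyperbolic
end

noncomputable section

namespace ComplexHyperbolic

/-! ### Totally geodesic complex hyperbolic subspaces -/

theorem q_tvec_tvec {n : ℕ} (u v : CE n) : q (tvec u) (tvec v) = inner ℂ u v := by simp [q]

theorem q_homog_zero_tvec {n : ℕ} (u : CE n) : q (homog (0 : CE n)) (tvec u) = 0 := by simp [q]

theorem q_homog_zero {n : ℕ} : q (homog (0 : CE n)) (homog 0) = -1 := by simp [q]

theorem pr_geoLift_zero_tvec {n : ℕ} (l : ℝ) (u : CE n) (t : ℝ) :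
    pr (geoLift l (homog 0) (tvec u) t) = Real.tanh (l * t) • u := by
  have h : (geoLift l (homog 0) (tvec u) t) 0 = Real.cosh (l * t) := by
    simp [geoLift]
  rw [pr, h, geoLift, map_add, real_smul_eq_coe_smul, real_smul_eq_coe_smul, map_smul, map_smul,
    tl_homog, tl_tvec, smul_zero, zero_add, smul_smul, Real.tanh_eq_sinh_div_cosh, div_eq_inv_mul,
    ← Complex.ofReal_inv, ← Complex.ofReal_mul]
  rfl

theorem IsTotallyGeodesicCH.exists_subspace {n m : ℕ} {c : ℝ} (hc : c < 0) {S : Set (CE n)}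
    (hS : IsTotallyGeodesicCH c m S) :
    ∃ V : Submodule ℂ (HV n), ∀ z, z ∈ S ↔ z ∈ CH n ∧ homog z ∈ V := by
  obtain ⟨f, rfl, hmaps, hsm, hJ, hmet, hgeo⟩ := hS
  have h0 : (0 : CE m) ∈ CH m := by simp [CH]
  obtain ⟨r, -, hP, hP0⟩ := exists_unit_lift (hmaps h0)
  set P := r • homog (f 0)
  have hneg : (q P P).re < 0 := by simp [hP]
  have hl := rate_pos hc
  set l := rate c with hlc
  have hdiff : ∀ z ∈ CH m, DifferentiableAt ℝ f z := fun z hz =>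
    (hsm.contDiffAt (Metric.isOpen_ball.mem_nhds hz)).differentiableAt (by simp)
  let D : CE m →ₗ[ℂ] CE n :=
    { toFun := fderiv ℝ f 0
      map_add' := map_add _
      map_smul' := fun a u => by
        conv_lhs => rw [← Complex.re_add_im a, add_smul, mul_smul, map_add]
        have e1 : ∀ (s : ℝ) (w : CE m), fderiv ℝ f 0 ((s : ℂ) • w) = (s : ℂ) • fderiv ℝ f 0 w :=
          fun s w => (fderiv ℝ f 0).map_smul s w
        rw [e1, e1, hJ 0 h0, ← mul_smul, ← add_smul, Complex.re_add_im]
        rfl }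
  have hD : ∀ u, D u = fderiv ℝ f 0 u := fun u => rfl
  let L : CE m →ₗ[ℂ] HV n := hlift P ∘ₗ D
  have hPL : ∀ u, q P (L u) = 0 := fun u => q_hlift hneg _
  have hLL : ∀ u, q (L u) (L u) = ((‖u‖ ^ 2 : ℝ) : ℂ) := by
    intro u
    have h := hmet 0 h0 u u
    have e1 : metric c (f 0) (D u) (D u) = (l ^ 2)⁻¹ * (q (L u) (L u)).re := by
      have := metric_dpr_unit hc hP (L u) (L u)
      rwa [hPL, mul_zero, zero_add, hP0, show dpr P (L u) = D u from dpr_hlift hneg _] at this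
    have e2 : metric c 0 u u = (l ^ 2)⁻¹ * ‖u‖ ^ 2 := by
      have := metric_dpr_unit hc (q_homog_zero (n := m)) (tvec u) (tvec u)
      rw [pr_homog, dpr_homog_tvec, q_homog_zero_tvec, mul_zero, zero_add, q_tvec_tvec] at this
      rw [this, ← inner_self_eq_norm_sq (𝕜 := ℂ) u]
      rfl
    rw [← hD, e1, e2] at h
    rw [← q_self_ofReal, mul_left_cancel₀ (inv_ne_zero (pow_ne_zero 2 hl.ne')) h]
  have key : ∀ z ∈ CH m, f z = pr (P + L z) := by
    intro z hz
    rcases eq_or_ne z 0 with rfl | hz0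
    · rw [map_zero, add_zero, hP0]
    have hzn : 0 < ‖z‖ := norm_pos_iff.2 hz0
    set u : CE m := (‖z‖⁻¹ : ℝ) • z with hu
    have hu1 : ‖u‖ = 1 := by
      rw [hu, norm_smul, norm_inv, norm_norm, inv_mul_cancel₀ hzn.ne']
    have hzu : ‖z‖ • u = z := by rw [hu, smul_smul, mul_inv_cancel₀ hzn.ne', one_smul]
    have huu : q (tvec u) (tvec u) = 1 := by
      rw [q_tvec_tvec, inner_self_eq_norm_sq_to_K, hu1]; simp
    set β := fun t => pr (geoLift l (homog (0 : CE m)) (tvec u) t) with hβ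
    have hβg : IsUnitGeodesic c β :=
      isUnitGeodesic_pr_geoLift hc q_homog_zero huu (q_homog_zero_tvec u)
    have hβd : ∀ t, HasDerivAt β (deriv β t) t := fun t =>
      (hβg.1.1.differentiable (by simp)).differentiableAt.hasDerivAt
    have hfβd : ∀ t, HasDerivAt (f ∘ β) (fderiv ℝ f (β t) (deriv β t)) t := fun t =>
      (hdiff _ (hβg.1.2.1 t)).hasFDerivAt.comp_hasDerivAt t (hβd t)
    have hfβ : IsUnitGeodesic c (f ∘ β) := by
      refine ⟨hgeo β hβg.1, fun t => ?_⟩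
      rw [(hfβd t).deriv, Function.comp_apply, hmet _ (hβg.1.2.1 t), hβg.2 t]
    have hβ0 : β 0 = 0 := by
      simp only [hβ, geoLift_zero, pr_homog]
    obtain ⟨U, hU, hPU, hγ, hγ'⟩ := hfβ.exists_geoLift hc hP
      (by rw [Function.comp_apply, hβ0, hP0])
    have hUL : U = L u := by
      rw [(hfβd 0).deriv, hβ0, deriv_pr_geoLift_zero q_homog_zero huu (q_homog_zero_tvec u),
        dpr_homog_tvec, map_smul] at hγ'
      rw [← hlift_dpr hneg hPU, ← smul_right_injective _ hl.ne' hγ']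
      rfl
    have hz1 : ‖z‖ < 1 := by rwa [CH, mem_ball_zero_iff] at hz
    have ht : Real.tanh (l * (Real.artanh ‖z‖ / l)) = ‖z‖ := by
      rw [mul_div_cancel₀ _ hl.ne', Real.tanh_artanh ⟨by linarith, hz1⟩]
    have h1 : f z = (f ∘ β) (Real.artanh ‖z‖ / l) := by
      rw [Function.comp_apply, hβ]
      simp only
      rw [pr_geoLift_zero_tvec, ht, hzu]
    have hLz : L z = ‖z‖ • L u := by
      conv_lhs => rw [← hzu]
      exact L.map_smul (‖z‖ : ℂ) u
    set T := Real.artanh ‖z‖ / l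
    have hcosh := (Real.cosh_pos (l * T)).ne'
    have hsinh : Real.sinh (l * T) = Real.cosh (l * T) * ‖z‖ := by
      rw [← ht, Real.tanh_eq_sinh_div_cosh, mul_div_cancel₀ _ hcosh]
    have h2 : geoLift l P U T = Real.cosh (l * T) • (P + L z) := by
      rw [geoLift, hLz, hUL, hsinh]
      module
    calc f z = pr (geoLift l P U T) := by rw [h1, hγ]
      _ = pr (P + L z) := by rw [h2, pr_rsmul hcosh]
  have hnegz : ∀ z ∈ CH m, (q (P + L z) (P + L z)).re < 0 := by
    intro z hz
    rw [CH, mem_ball_zero_iff] at hz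
    rw [q_add_left, q_add_right, q_add_right, hP, hPL, q_comm_zero (hPL z), hLL]
    simp only [Complex.add_re, Complex.ofReal_re, Complex.neg_re, Complex.one_re, Complex.zero_re]
    nlinarith [norm_nonneg z]
  refine ⟨Submodule.span ℂ {P} ⊔ LinearMap.range L, fun z => ⟨?_, ?_⟩⟩
  · rintro ⟨w, hw, rfl⟩
    refine ⟨hmaps hw, ?_⟩
    rw [key w hw, homog_pr (zero_ne_of_neg (hnegz w hw))]
    exact Submodule.smul_mem _ _ (add_mem
      (Submodule.mem_sup_left (Submodule.mem_span_singleton_self P))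
      (Submodule.mem_sup_right ⟨w, rfl⟩))
  · rintro ⟨hz, hzV⟩
    obtain ⟨y, hy, y', ⟨w, rfl⟩, hyw⟩ := Submodule.mem_sup.1 hzV
    obtain ⟨a, rfl⟩ := Submodule.mem_span_singleton.1 hy
    have h1 := mem_CH_iff.1 hz
    have h2 : q (homog z) (homog z) = ((‖w‖ ^ 2 - ‖a‖ ^ 2 : ℝ) : ℂ) := by
      rw [← hyw]
      simp only [q_add_left, q_add_right, q_smul_left, q_smul_right, hP, hPL, q_comm_zero (hPL _),
        hLL]
      push_cast
      have : (‖a‖ ^ 2 : ℂ) = (starRingEnd ℂ) a * a := by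
        rw [← Complex.normSq_eq_conj_mul_self, Complex.normSq_eq_norm_sq]; norm_cast
      rw [this]
      ring
    rw [h2, Complex.ofReal_re] at h1
    have ha : a ≠ 0 := by
      rintro rfl
      simp at h1
      nlinarith [norm_nonneg w]
    have hwa : ‖w‖ < ‖a‖ := by
      apply lt_of_pow_lt_pow_left₀ 2 (norm_nonneg _)
      linarith
    have hm : a⁻¹ • w ∈ CH m := by
      rw [CH, mem_ball_zero_iff, norm_smul, norm_inv, inv_mul_lt_iff₀ (norm_pos_iff.2 ha)]
      linarith
    refine ⟨a⁻¹ • w, hm, ?_⟩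
    rw [key _ hm, ← pr_smul ha, smul_add, map_smul, smul_smul, mul_inv_cancel₀ ha, one_smul, hyw,
      pr_homog]

end ComplexHyperbolic
end

noncomputable section

namespace ComplexHyperbolic

/-! ### The Lie algebra `su(1, n)` -/

theorem q_mulVec_left {n : ℕ} (X : Mat n) (u v : HV n) :
    q (X *ᵥ u) v = star u ⬝ᵥ ((Xᴴ * formMatrix n) *ᵥ v) := by
  rw [q_eq_dotProduct, Matrix.star_mulVec, ← Matrix.dotProduct_mulVec, Matrix.mulVec_mulVec]

theorem q_mulVec_right {n : ℕ} (X : Mat n) (u v : HV n) :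
    q u (X *ᵥ v) = star u ⬝ᵥ ((formMatrix n * X) *ᵥ v) := by
  rw [q_eq_dotProduct, Matrix.mulVec_mulVec]

theorem eq_of_forall_dotProduct {n : ℕ} {A B : Mat n}
    (h : ∀ u v : HV n, star u ⬝ᵥ (A *ᵥ v) = star u ⬝ᵥ (B *ᵥ v)) : A = B := by
  ext i j
  have := h (Pi.single i 1) (Pi.single j 1)
  simpa [Pi.star_single] using this

theorem mem_su1_iff {n : ℕ} {X : Mat n} :
    X ∈ su1 n ↔ (∀ u v : HV n, q (X *ᵥ u) v + q u (X *ᵥ v) = 0) ∧ X.trace = 0 := by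
  refine and_congr_left fun _ => ⟨fun h u v => ?_, fun h => eq_of_forall_dotProduct fun u v => ?_⟩
  · rw [q_mulVec_left, q_mulVec_right, ← dotProduct_add, ← Matrix.add_mulVec, h]
    simp
  · rw [Matrix.add_mulVec, dotProduct_add, ← q_mulVec_left, ← q_mulVec_right, h]
    simp

/-- The rank one operator `v ↦ ⟨b, v⟩ a`. -/
def rk {n : ℕ} (a b : HV n) : Mat n := Matrix.vecMulVec a (star b ᵥ* formMatrix n)

@[simp] theorem rk_mulVec {n : ℕ} (a b v : HV n) : rk a b *ᵥ v = q b v • a := by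
  rw [rk, Matrix.vecMulVec_mulVec, ← Matrix.dotProduct_mulVec, ← q_eq_dotProduct]
  ext i
  simp [mul_comm]

theorem trace_rk {n : ℕ} (a b : HV n) : (rk a b).trace = q b a := by
  rw [rk, Matrix.trace_vecMulVec, dotProduct_comm, ← Matrix.dotProduct_mulVec, q_eq_dotProduct]

theorem mul_rk {n : ℕ} (X : Mat n) (a b : HV n) : X * rk a b = rk (X *ᵥ a) b :=
  Matrix.mul_vecMulVec _ _ _

theorem mat_ext_mulVec {n : ℕ} {A B : Mat n} (h : ∀ v, A *ᵥ v = B *ᵥ v) : A = B := by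
  exact eq_of_forall_dotProduct fun u v => by rw [h]

/-- The skew operator `v ↦ ⟨b, v⟩ a - ⟨a, v⟩ b`. -/
def sk {n : ℕ} (a b : HV n) : Mat n := rk a b - rk b a

@[simp] theorem sk_mulVec {n : ℕ} (a b v : HV n) : sk a b *ᵥ v = q b v • a - q a v • b := by
  rw [sk, Matrix.sub_mulVec, rk_mulVec, rk_mulVec]

theorem sk_mem_su1 {n : ℕ} {a b : HV n} (h : q a b = q b a) : sk a b ∈ su1 n := by
  refine mem_su1_iff.2 ⟨fun u v => ?_, ?_⟩
  · simp only [sk_mulVec, q_sub_left, q_sub_right, q_smul_left, q_smul_right, q_conj]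
    ring
  · rw [sk, Matrix.trace_sub, trace_rk, trace_rk, h, sub_self]

theorem I_rk_mem_su1 {n : ℕ} {X : HV n} (hXX : q X X = 0) (r : ℝ) :
    (Complex.I * r) • rk X X ∈ su1 n := by
  refine mem_su1_iff.2 ⟨fun u v => ?_, ?_⟩
  · simp only [Matrix.smul_mulVec, rk_mulVec, q_smul_left, q_smul_right, q_conj, map_mul,
      Complex.conj_I, Complex.conj_ofReal]
    ring
  · rw [Matrix.trace_smul, trace_rk, hXX, smul_zero]

/-- A unit vector over a point of `ℂHⁿ` and a null vector, suitably normalized. -/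
structure IsFrame {n : ℕ} (P X : HV n) : Prop where
  PP : q P P = -1
  XX : q X X = 0
  XP : q X P = -1

namespace IsFrame

variable {n : ℕ} {P X : HV n}

theorem PX (h : IsFrame P X) : q P X = -1 := by rw [← q_conj, h.XP]; simp

theorem neg (h : IsFrame P X) : (q P P).re < 0 := by simp [h.PP]

theorem X_ne (h : IsFrame P X) : X ≠ 0 := by
  rintro rfl
  have := h.XP
  rw [q_zero_left] at this
  norm_num at this

end IsFrame

/-- The orthogonal complement of `P` and `X`. -/
def perp {n : ℕ} (P X : HV n) : Submodule ℂ (HV n) := LinearMap.ker (qLin P) ⊓ LinearMap.ker (qLin X)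

theorem mem_perp {n : ℕ} {P X e : HV n} : e ∈ perp P X ↔ q P e = 0 ∧ q X e = 0 := Iff.rfl

/-- The projection to `perp P X`. -/
def projE {n : ℕ} (P X : HV n) : HV n →ₗ[ℂ] HV n :=
  LinearMap.id - (qLin X - qLin P).smulRight X + (qLin X).smulRight P

theorem projE_apply {n : ℕ} (P X v : HV n) :
    projE P X v = v - (q X v - q P v) • X + q X v • P := rfl

theorem IsFrame.decomp {n : ℕ} {P X : HV n} (v : HV n) :
    v = (q X v - q P v) • X - q X v • P + projE P X v := by
  rw [projE_apply]; abel

theorem IsFrame.projE_mem {n : ℕ} {P X : HV n} (h : IsFrame P X) (v : HV n) :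
    projE P X v ∈ perp P X := by
  rw [mem_perp, projE_apply]
  simp [q_add_right, q_sub_right, q_smul_right, h.PP, h.XX, h.XP, h.PX]

theorem IsFrame.projE_perp {n : ℕ} {P X e : HV n} (he : e ∈ perp P X) :
    projE P X e = e := by
  rw [projE_apply, (mem_perp.1 he).1, (mem_perp.1 he).2]; simp

theorem IsFrame.projE_P {n : ℕ} {P X : HV n} (h : IsFrame P X) : projE P X P = 0 := by
  rw [projE_apply, h.PP, h.XP]; simp

theorem IsFrame.projE_X {n : ℕ} {P X : HV n} (h : IsFrame P X) : projE P X X = 0 := by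
  rw [projE_apply, h.PX, h.XX]; simp

theorem IsFrame.mat_ext {n : ℕ} {P X : HV n} (h : IsFrame P X) {A B : Mat n}
    (hP : A *ᵥ P = B *ᵥ P) (hX : A *ᵥ X = B *ᵥ X) (hE : ∀ e ∈ perp P X, A *ᵥ e = B *ᵥ e) :
    A = B := by
  refine mat_ext_mulVec fun v => ?_
  rw [IsFrame.decomp (P := P) (X := X) v]
  simp only [Matrix.mulVec_add, Matrix.mulVec_sub, Matrix.mulVec_smul, hP, hX,
    hE _ (h.projE_mem v)]

/-- The elements of `𝔞 ⊕ 𝔤_α ⊕ 𝔤_{2α}`. -/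
def solv {n : ℕ} (P X : HV n) : ℝ × HV n × ℝ →ₗ[ℝ] Mat n where
  toFun p := p.1 • sk P X + sk X p.2.1 + (Complex.I * p.2.2) • rk X X
  map_add' p p' := by
    refine mat_ext_mulVec fun v => ?_
    simp only [Matrix.add_mulVec, Matrix.smul_mulVec, sk_mulVec, rk_mulVec, Prod.fst_add,
      Prod.snd_add, q_add_left, Complex.ofReal_add]
    module
  map_smul' r p := by
    refine mat_ext_mulVec fun v => ?_
    simp only [Matrix.add_mulVec, Matrix.smul_mulVec, sk_mulVec, rk_mulVec, Prod.smul_fst,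
      Prod.smul_snd, smul_eq_mul, RingHom.id_apply, q_smul_left, Complex.conj_ofReal, Complex.ofReal_mul, smul_add,
      smul_sub, real_smul_eq_coe_smul]
    module

theorem solv_mulVec {n : ℕ} (P X : HV n) (s : ℝ) (w : HV n) (r : ℝ) (v : HV n) :
    solv P X (s, w, r) *ᵥ v = s • (q X v • P - q P v • X) + (q w v • X - q X v • w)
      + (Complex.I * r * q X v) • X := by
  change (s • sk P X + sk X w + (Complex.I * r) • rk X X) *ᵥ v = _
  rw [Matrix.add_mulVec, Matrix.add_mulVec, Matrix.smul_mulVec, Matrix.smul_mulVec, sk_mulVec,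
    sk_mulVec, rk_mulVec, smul_smul]

namespace IsFrame

variable {n : ℕ} {P X : HV n}

theorem solv_P (h : IsFrame P X) (s r : ℝ) {w : HV n} (hw : w ∈ perp P X) :
    solv P X (s, w, r) *ᵥ P = s • (X - P) + w - (Complex.I * r) • X := by
  rw [solv_mulVec, h.XP, h.PP, q_comm_zero (mem_perp.1 hw).1]
  module

theorem solv_X (h : IsFrame P X) (s r : ℝ) {w : HV n} (hw : w ∈ perp P X) :
    solv P X (s, w, r) *ᵥ X = s • X := by
  rw [solv_mulVec, h.XX, h.PX, q_comm_zero (mem_perp.1 hw).2]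
  module

theorem solv_perp (s r : ℝ) (w : HV n) {e : HV n} (he : e ∈ perp P X) :
    solv P X (s, w, r) *ᵥ e = q w e • X := by
  rw [solv_mulVec, (mem_perp.1 he).1, (mem_perp.1 he).2]
  module

theorem solv_mem_su1 (h : IsFrame P X) (s r : ℝ) {w : HV n} (hw : w ∈ perp P X) : solv P X (s, w, r) ∈ su1 n :=
  add_mem (add_mem (Submodule.smul_mem _ _ (sk_mem_su1 (by rw [h.PX, h.XP])))
    (sk_mem_su1 (by rw [(mem_perp.1 hw).2, q_comm_zero (mem_perp.1 hw).2]))) (I_rk_mem_su1 h.XX r)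

theorem solv_injective (h : IsFrame P X) {s s' r r' : ℝ} {w w' : HV n} (hw : w ∈ perp P X) (hw' : w' ∈ perp P X)
    (he : solv P X (s, w, r) *ᵥ P = solv P X (s', w', r') *ᵥ P) : s = s' ∧ w = w' ∧ r = r' := by
  rw [h.solv_P s r hw, h.solv_P s' r' hw'] at he
  have h1 := congrArg (q X) he
  have h2 := congrArg (q P) he
  simp only [q_add_right, q_sub_right, q_rsmul_right, q_smul_right, h.XX, h.XP, h.PP, h.PX,
    (mem_perp.1 hw).1, (mem_perp.1 hw).2, (mem_perp.1 hw').1, (mem_perp.1 hw').2] at h1 h2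
  have hs : s = s' := by
    have h3 := congrArg Complex.re h1
    simpa using h3
  have hr : r = r' := by
    have h3 := congrArg Complex.im h2
    simpa using h3
  subst hs hr
  exact ⟨rfl, by simpa using he, rfl⟩

/-- The elements of `su(1, n)` that preserve the flag given by `X`. -/
theorem exists_solv (h : IsFrame P X) {Z : Mat n} (hZ : Z ∈ su1 n) {σ : ℝ} (hX : Z *ᵥ X = σ • X)
    (hE : ∀ e ∈ perp P X, ∃ β : ℂ, Z *ᵥ e = β • X) :
    ∃ f ∈ perp P X, ∃ r : ℝ, Z = solv P X (σ, f, r) := by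
  have hsk := (mem_su1_iff.1 hZ).1
  have hf := h.projE_mem (Z *ᵥ P)
  set f := projE P X (Z *ᵥ P) with hf'
  have h1 : q X (Z *ᵥ P) = σ := by
    have := hsk X P
    rw [hX, q_rsmul_left, h.XP] at this
    linear_combination this
  have h2 : (q P (Z *ᵥ P)).re = 0 := by
    have := congrArg Complex.re (hsk P P)
    rw [← q_conj] at this
    simp at this
    linarith
  refine ⟨f, hf, (q P (Z *ᵥ P)).im, h.mat_ext ?_ ?_ fun e he => ?_⟩
  · rw [h.solv_P _ _ hf]
    conv_lhs => rw [IsFrame.decomp (P := P) (X := X) (Z *ᵥ P), ← hf', h1,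
      ← Complex.re_add_im (q P (Z *ᵥ P)), h2]
    simp only [real_smul_eq_coe_smul]
    push_cast
    module
  · rw [hX, h.solv_X _ _ hf]
  · obtain ⟨β, hβ⟩ := hE e he
    rw [IsFrame.solv_perp _ _ _ he, hβ]
    have := hsk P e
    rw [hβ, q_smul_right, h.PX, IsFrame.decomp (P := P) (X := X) (Z *ᵥ P), ← hf'] at this
    simp only [q_add_left, q_sub_left, q_smul_left, (mem_perp.1 he).1, (mem_perp.1 he).2] at this
    congr 1
    linear_combination -this

end IsFrame

end ComplexHyperbolic
end

noncomputable section

namespace ComplexHyperbolic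

/-! ### Exponentials of matrices acting on vectors -/

theorem hasSum_exp_mulVec {n : ℕ} (A : Mat n) (v : HV n) :
    HasSum (fun k : ℕ => ((k.factorial : ℝ)⁻¹) • (A ^ k *ᵥ v)) (NormedSpace.exp A *ᵥ v) := by
  let _ : NormedRing (Mat n) := Matrix.linftyOpNormedRing
  let _ : NormedAlgebra ℝ (Mat n) := Matrix.linftyOpNormedAlgebra
  let L : Mat n →ₗ[ℝ] HV n :=
    { toFun := fun A => A *ᵥ v
      map_add' := fun A B => Matrix.add_mulVec A B v
      map_smul' := fun r A => Matrix.smul_mulVec r A v }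
  have h := (NormedSpace.exp_series_hasSum_exp' (𝕂 := ℝ) A).mapL (LinearMap.toContinuousLinearMap L)
  have e : ∀ B, LinearMap.toContinuousLinearMap L B = B *ᵥ v := fun _ => rfl
  simp only [e, Matrix.smul_mulVec] at h
  exact h

theorem hasDerivAt_exp_mulVec {n : ℕ} (A : Mat n) (v : HV n) :
    HasDerivAt (fun t : ℝ => NormedSpace.exp (t • A) *ᵥ v) (A *ᵥ v) 0 := by
  let _ : NormedRing (Mat n) := Matrix.linftyOpNormedRing
  let _ : NormedAlgebra ℝ (Mat n) := Matrix.linftyOpNormedAlgebra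
  have h := hasDerivAt_exp_smul_const (𝕂 := ℝ) A (0 : ℝ)
  rw [zero_smul, NormedSpace.exp_zero, one_mul] at h
  let L : Mat n →ₗ[ℝ] HV n :=
    { toFun := fun A => A *ᵥ v
      map_add' := fun A B => Matrix.add_mulVec A B v
      map_smul' := fun r A => Matrix.smul_mulVec r A v }
  exact (LinearMap.toContinuousLinearMap L).hasFDerivAt.comp_hasDerivAt (0 : ℝ) h

theorem pow_mulVec_mem {n : ℕ} {K : Submodule ℝ (HV n)} {A : Mat n} {v : HV n}
    (hv : A *ᵥ v ∈ K) (hK : ∀ k ∈ K, A *ᵥ k ∈ K) (k : ℕ) : A ^ (k + 1) *ᵥ v ∈ K := by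
  induction k with
  | zero => simpa using hv
  | succ k ih =>
    rw [pow_succ', ← Matrix.mulVec_mulVec]
    exact hK _ ih

theorem exp_mulVec_sub_mem {n : ℕ} {K : Submodule ℝ (HV n)} {A : Mat n} {v : HV n}
    (hv : A *ᵥ v ∈ K) (hK : ∀ k ∈ K, A *ᵥ k ∈ K) : NormedSpace.exp A *ᵥ v - v ∈ K := by
  have h := (hasSum_nat_add_iff' 1).2 (hasSum_exp_mulVec A v)
  simp only [Finset.range_one, Finset.sum_singleton, Nat.factorial_zero, Nat.cast_one, inv_one,
    pow_zero, Matrix.one_mulVec, one_smul] at h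
  have hcl : IsClosed (K : Set (HV n)) := K.closed_of_finiteDimensional
  exact hcl.mem_of_tendsto h (Filter.Eventually.of_forall fun s =>
    Submodule.sum_mem _ fun k _ => Submodule.smul_mem _ _ (pow_mulVec_mem hv hK k))

theorem exp_mulVec_mem {n : ℕ} {K : Submodule ℝ (HV n)} {A : Mat n}
    (hK : ∀ k ∈ K, A *ᵥ k ∈ K) {v : HV n} (hv : v ∈ K) : NormedSpace.exp A *ᵥ v ∈ K := by
  have := add_mem (exp_mulVec_sub_mem (hK v hv) hK) hv
  rwa [sub_add_cancel] at this

theorem exp_mulVec_of_eigen {n : ℕ} {A : Mat n} {v : HV n} {σ : ℂ} (h : A *ᵥ v = σ • v) :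
    NormedSpace.exp A *ᵥ v = Complex.exp σ • v := by
  have hp : ∀ k : ℕ, A ^ k *ᵥ v = σ ^ k • v := by
    intro k
    induction k with
    | zero => simp
    | succ k ih => rw [pow_succ', ← Matrix.mulVec_mulVec, ih, Matrix.mulVec_smul, h, smul_smul,
        ← pow_succ]
  have h1 := hasSum_exp_mulVec A v
  have h2 := (NormedSpace.exp_series_hasSum_exp' (𝕂 := ℝ) σ).smul_const v
  rw [← Complex.exp_eq_exp_ℂ] at h2
  refine h1.unique ?_
  convert! h2 using 2 with k
  rw [hp, smul_assoc]

theorem exp_mulVec_of_nilpotent {n : ℕ} {A : Mat n} {v : HV n}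
    (h : A *ᵥ (A *ᵥ (A *ᵥ v)) = 0) :
    NormedSpace.exp A *ᵥ v = v + A *ᵥ v + (2⁻¹ : ℝ) • (A *ᵥ (A *ᵥ v)) := by
  have hp : ∀ k, k ∉ Finset.range 3 → ((k.factorial : ℝ)⁻¹) • (A ^ k *ᵥ v) = 0 := by
    intro k hk
    obtain ⟨j, rfl⟩ := Nat.exists_eq_add_of_le' (not_lt.1 (Finset.mem_range.not.1 hk))
    rw [pow_add, ← Matrix.mulVec_mulVec, pow_succ, pow_two, ← Matrix.mulVec_mulVec,
      ← Matrix.mulVec_mulVec, h, Matrix.mulVec_zero, smul_zero]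
  rw [(hasSum_exp_mulVec A v).unique (hasSum_sum_of_ne_finset_zero hp)]
  simp [Finset.sum_range_succ, pow_two]

theorem mulVec_mem_of_exp {n : ℕ} {K : Submodule ℝ (HV n)} {A : Mat n} {v : HV n}
    (h : ∀ t : ℝ, NormedSpace.exp (t • A) *ᵥ v - v ∈ K) : A *ᵥ v ∈ K := by
  have hcl : IsClosed (K : Set (HV n)) := K.closed_of_finiteDimensional
  have hd := hasDerivAt_iff_tendsto_slope.1 (hasDerivAt_exp_mulVec A v)
  refine hcl.mem_of_tendsto hd (Filter.Eventually.of_forall fun t => ?_)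
  rw [slope_def_module]
  refine K.smul_mem _ ?_
  simpa using h t

theorem act_eq_pr {n : ℕ} (A : Mat n) (z : CE n) : act A z = pr (A *ᵥ homog z) := by
  ext i
  exact div_eq_inv_mul _ _

theorem det_exp_smul_eq_one {n : ℕ} {A : Mat n} (h : A.trace = 0) (t : ℝ) :
    (NormedSpace.exp (t • A)).det = 1 := by
  let _ : NormedRing (Mat n) := Matrix.linftyOpNormedRing
  let _ : NormedAlgebra ℝ (Mat n) := Matrix.linftyOpNormedAlgebra
  have hdet : DifferentiableAt ℝ (fun B : Mat n => B.det) 1 := by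
    have he : ∀ i j, DifferentiableAt ℝ (fun B : Mat n => B i j) 1 := fun i j =>
      (LinearMap.toContinuousLinearMap
        ({ toFun := fun B => B i j, map_add' := fun _ _ => rfl, map_smul' := fun _ _ => rfl } :
          Mat n →ₗ[ℝ] ℂ)).differentiableAt
    simp only [Matrix.det_apply]
    refine DifferentiableAt.fun_sum fun σ _ => DifferentiableAt.const_smul ?_ _
    exact (HasFDerivAt.finsetProd fun i _ => (he (σ i) i).hasFDerivAt).differentiableAt
  have d1 : HasDerivAt (fun t : ℝ => (1 + t • A : Mat n).det) (fderiv ℝ (fun B : Mat n => B.det) 1 A) 0 := by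
    have hl : HasDerivAt (fun t : ℝ => (1 + t • A : Mat n)) A 0 := by
      exact (((hasDerivAt_id (0 : ℝ)).smul_const A).const_add (1 : Mat n)).congr_deriv
        (one_smul ℝ A)
    exact hdet.hasFDerivAt.comp_hasDerivAt_of_eq (0 : ℝ) hl (by simp)
  have d2 : HasDerivAt (fun t : ℝ => (1 + t • A : Mat n).det) 0 0 := by
    have e : ∀ t : ℝ, (1 + t • A : Mat n).det
        = 1 + (Matrix.det (1 + (Polynomial.X : Polynomial ℂ) • A.map Polynomial.C)).divX.divX.eval (t : ℂ)
          * (t : ℂ) ^ 2 := by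
      intro t
      have := Matrix.det_one_add_smul (t : ℂ) A
      rw [h, zero_mul, add_zero] at this
      rw [← this]
      rfl
    simp only [e]
    set p := (Matrix.det (1 + (Polynomial.X : Polynomial ℂ) • A.map Polynomial.C)).divX.divX
    have h1 : HasDerivAt (fun z : ℂ => 1 + p.eval z * z ^ 2) 0 ((0 : ℝ) : ℂ) := by
      have := ((p.hasDerivAt 0).mul (hasDerivAt_pow 2 (0 : ℂ))).const_add 1
      simpa using this
    exact h1.comp_ofReal
  have h0 : fderiv ℝ (fun B : Mat n => B.det) 1 A = 0 := d1.unique d2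
  have hadd : ∀ s r : ℝ, (NormedSpace.exp ((s + r) • A)).det
      = (NormedSpace.exp (s • A)).det * (NormedSpace.exp (r • A)).det := by
    intro s r
    rw [add_smul, Matrix.exp_add_of_commute _ _
      (((Commute.refl A).smul_left s).smul_right r), Matrix.det_mul]
  have d3 : HasDerivAt (fun t : ℝ => (NormedSpace.exp (t • A)).det) 0 0 := by
    have hl := hasDerivAt_exp_smul_const (𝕂 := ℝ) A (0 : ℝ)
    rw [zero_smul, NormedSpace.exp_zero, one_mul] at hl
    rw [← h0]
    exact hdet.hasFDerivAt.comp_hasDerivAt_of_eq (0 : ℝ) hl (by simp)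
  have d4 : ∀ t, HasDerivAt (fun t : ℝ => (NormedSpace.exp (t • A)).det) 0 t := by
    intro t
    have h1 : HasDerivAt (fun s : ℝ => (NormedSpace.exp (t • A)).det
        * (NormedSpace.exp ((s - t) • A)).det) 0 t := by
      have h2 := (HasDerivAt.scomp t (h := fun s : ℝ => s - t) (h' := (1 : ℝ))
        (g₁ := fun t : ℝ => (NormedSpace.exp (t • A)).det) (g₁' := 0)
        (by rw [sub_self]; exact d3) ((hasDerivAt_id t).sub_const t)).const_mul
          (NormedSpace.exp (t • A)).det
      simpa using h2
    refine h1.congr_of_eventuallyEq (Filter.Eventually.of_forall fun s => ?_)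
    change _ = _ * _
    rw [← hadd]
    congr 3
    ring
  have := is_const_of_deriv_eq_zero (fun t => (d4 t).differentiableAt) (fun t => (d4 t).deriv) t 0
  simpa using this

theorem formMatrix_mul_self (n : ℕ) : formMatrix n * formMatrix n = 1 := by
  rw [formMatrix, Matrix.diagonal_mul_diagonal, ← Matrix.diagonal_one]
  congr 1
  funext i
  refine Fin.cases (by simp) (fun j => by simp) i

/-- The exponential of an element of `su(1, n)` belongs to `SU(1, n)`. -/
theorem exists_mat_eq_exp {n : ℕ} {A : Mat n} (hA : A ∈ su1 n) :
    ∃ g : SU1 n, mat g = NormedSpace.exp A := by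
  have hF := formMatrix_mul_self n
  have hdet : (NormedSpace.exp A).det = 1 := by
    simpa using det_exp_smul_eq_one hA.2 1
  refine ⟨⟨⟨NormedSpace.exp A, hdet⟩, ?_⟩, rfl⟩
  change (NormedSpace.exp A)ᴴ * formMatrix n * NormedSpace.exp A = formMatrix n
  have h1 : Aᴴ = formMatrix n * (-A) * (formMatrix n)⁻¹ := by
    rw [Matrix.inv_eq_left_inv hF]
    have h2 := eq_neg_of_add_eq_zero_left hA.1
    calc Aᴴ = Aᴴ * formMatrix n * formMatrix n := by rw [mul_assoc, hF, mul_one]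
      _ = _ := by rw [h2]; simp
  have hU : IsUnit (formMatrix n) := ⟨⟨_, _, hF, hF⟩, rfl⟩
  rw [← Matrix.exp_conjTranspose, h1, Matrix.exp_conj _ _ hU, Matrix.inv_eq_left_inv hF,
    mul_assoc _ (formMatrix n) (formMatrix n), hF, mul_one, mul_assoc, Matrix.exp_neg,
    Matrix.nonsing_inv_mul _ (by rw [hdet]; exact isUnit_one), mul_one]

theorem q_mat {n : ℕ} (g : SU1 n) (u v : HV n) : q (mat g *ᵥ u) (mat g *ᵥ v) = q u v := by
  rw [q_mulVec_left, Matrix.mulVec_mulVec]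
  have h : (mat g)ᴴ * formMatrix n * mat g = formMatrix n := g.2
  rw [h, ← q_eq_dotProduct]

theorem mat_mul {n : ℕ} (g h : SU1 n) : mat (g * h) = mat g * mat h := rfl

theorem mat_one {n : ℕ} : mat (1 : SU1 n) = 1 := rfl

theorem mat_injective {n : ℕ} {g h : SU1 n} (e : mat g = mat h) : g = h :=
  Subtype.ext (Subtype.ext e)

theorem mat_inv_mulVec {n : ℕ} (g : SU1 n) (v : HV n) : mat g⁻¹ *ᵥ (mat g *ᵥ v) = v := by
  rw [Matrix.mulVec_mulVec, ← mat_mul, inv_mul_cancel, mat_one, Matrix.one_mulVec]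

end ComplexHyperbolic
end

noncomputable section

namespace ComplexHyperbolic

/-! ### The Iwasawa decomposition -/

theorem mem_isotropyAlg {n : ℕ} {o : CE n} {A : Mat n} (hA : A ∈ su1 n) {σ : ℂ}
    (h : A *ᵥ homog o = σ • homog o) : A ∈ isotropyAlg o := by
  refine ⟨hA, fun t => ?_⟩
  have h1 : (t • A) *ᵥ homog o = ((t : ℂ) * σ) • homog o := by
    rw [Matrix.smul_mulVec, h, real_smul_eq_coe_smul, smul_smul]
  rw [act_eq_pr, exp_mulVec_of_eigen h1, pr_smul (Complex.exp_ne_zero _), pr_homog]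

theorem q_mulVec_self_of_mem_cartanP {n : ℕ} {o : CE n} {A : Mat n} (hA : A ∈ cartanP o)
    {w : HV n} {μ : ℂ} (hw : rk w w *ᵥ homog o = μ • homog o) : q w (A *ᵥ w) = 0 := by
  set τ : ℂ := q w w / (n + 1)
  set Y : Mat n := Complex.I • rk w w - (Complex.I * τ) • 1
  have hτ : (starRingEnd ℂ) τ = τ := by
    simp [τ, q_conj]
  have hn : ((n : ℂ) + 1) ≠ 0 := by exact_mod_cast n.succ_ne_zero
  have hY : Y ∈ su1 n := by
    refine mem_su1_iff.2 ⟨fun u v => ?_, ?_⟩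
    · simp only [Y, Matrix.sub_mulVec, Matrix.smul_mulVec, rk_mulVec, Matrix.one_mulVec,
        q_sub_left, q_sub_right, q_smul_left, q_smul_right, map_mul, Complex.conj_I, hτ, q_conj]
      ring
    · simp only [Y, Matrix.trace_sub, Matrix.trace_smul, trace_rk, Matrix.trace_one, smul_eq_mul,
        Fintype.card_fin, Nat.cast_add, Nat.cast_one, τ]
      field_simp
      ring
  have hYo : Y *ᵥ homog o = (Complex.I * μ - Complex.I * τ) • homog o := by
    rw [Matrix.sub_mulVec, Matrix.smul_mulVec, hw, Matrix.smul_mulVec, Matrix.one_mulVec]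
    module
  have h := hA.2 Y (mem_isotropyAlg hY hYo)
  rw [show A * Y = Complex.I • rk (A *ᵥ w) w - (Complex.I * τ) • A by
      rw [mul_sub, mul_smul_comm, mul_rk, mul_smul_comm, mul_one], Matrix.trace_sub,
    Matrix.trace_smul, Matrix.trace_smul, hA.1.2, trace_rk, smul_zero, sub_zero, smul_eq_mul,
    mul_eq_zero, or_iff_right Complex.I_ne_zero] at h
  exact h

/-- The elements of `𝔭` are the operators `sk P ξ` with `ξ` orthogonal to `P`. -/
theorem eq_sk_of_mem_cartanP {n : ℕ} {o : CE n} {A : Mat n} (hA : A ∈ cartanP o) {P : HV n}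
    {r : ℝ} (hr : r ≠ 0) (hPo : P = r • homog o) (hP : q P P = -1) :
    q P (A *ᵥ P) = 0 ∧ A = sk P (A *ᵥ P) := by
  have hneg : (q P P).re < 0 := by simp [hP]
  have hsk := (mem_su1_iff.1 hA.1).1
  have hw0 : ∀ w, q P w = 0 → q w (A *ᵥ w) = 0 := by
    intro w hw
    refine q_mulVec_self_of_mem_cartanP hA (μ := 0) ?_
    have h1 : q w (homog o) = 0 := by
      have := q_comm_zero hw
      rw [hPo, q_rsmul_right, mul_eq_zero] at this
      exact this.resolve_left (by exact_mod_cast hr)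
    rw [rk_mulVec, h1, zero_smul, zero_smul]
  have hPP : q P (A *ᵥ P) = 0 := by
    refine q_mulVec_self_of_mem_cartanP hA (μ := q P (homog o) * r) ?_
    rw [rk_mulVec, mul_smul, ← real_smul_eq_coe_smul, ← hPo]
  have hpol : ∀ v w, q P v = 0 → q P w = 0 → q v (A *ᵥ w) = 0 := by
    intro v w hv hw
    have h1 := hw0 (v + w) (by rw [q_add_right, hv, hw, add_zero])
    have h2 := hw0 (v + Complex.I • w) (by rw [q_add_right, q_smul_right, hv, hw]; simp)
    simp only [Matrix.mulVec_add, Matrix.mulVec_smul, q_add_left, q_add_right, q_smul_left,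
      q_smul_right, hw0 v hv, hw0 w hw, Complex.conj_I] at h1 h2
    have h3 : (2 * Complex.I) * q v (A *ᵥ w) = 0 := by linear_combination Complex.I * h1 + h2
    exact (mul_eq_zero.1 h3).resolve_left (by simp)
  refine ⟨hPP, mat_ext_mulVec fun v => ?_⟩
  have hv : ∀ v, q P v = 0 → A *ᵥ v = q (A *ᵥ P) v • P := by
    intro v hv
    have h1 : q P (A *ᵥ v - q (A *ᵥ P) v • P) = 0 := by
      rw [q_sub_right, q_smul_right, hP]
      linear_combination hsk P v
    have h2 := (q_self_nonneg_of_orthogonal hneg h1).2 (by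
      rw [q_sub_right _ _ (A *ᵥ v - q (A *ᵥ P) v • P), q_smul_right, hpol _ _ h1 hv,
        q_comm_zero h1]
      simp)
    exact sub_eq_zero.1 h2
  have h1 := hv (v + q P v • P) (by rw [q_add_right, q_smul_right, hP]; ring)
  rw [Matrix.mulVec_add, Matrix.mulVec_smul, q_add_right, q_smul_right, q_comm_zero hPP, mul_zero,
    add_zero] at h1
  rw [sk_mulVec, ← h1, add_sub_cancel_right]

theorem sk_smul_right {n : ℕ} (P ξ : HV n) (s : ℝ) : sk P (s • ξ) = s • sk P ξ := by
  refine mat_ext_mulVec fun v => ?_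
  rw [sk_mulVec, Matrix.smul_mulVec, sk_mulVec, q_rsmul_left, smul_sub, real_smul_eq_coe_smul,
    real_smul_eq_coe_smul, real_smul_eq_coe_smul]
  module

theorem solv_fst {n : ℕ} (P X : HV n) (s : ℝ) : solv P X (s, 0, 0) = s • sk P X := by
  change s • sk P X + sk X 0 + (Complex.I * (0 : ℝ)) • rk X X = _
  have : sk X (0 : HV n) = 0 := by
    refine mat_ext_mulVec fun v => ?_
    simp [q_zero_left]
  rw [this]
  simp

theorem dpr_rsmul {n : ℕ} (W A : HV n) (s : ℝ) : dpr W (s • A) = s • dpr W A := by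
  rw [real_smul_eq_coe_smul, map_smul]
  rfl

theorem orbitVelocity_eq_dpr {n : ℕ} (o : CE n) (A : Mat n) :
    orbitVelocity o A = dpr (homog o) (A *ᵥ homog o) := by
  ext i
  simp only [orbitVelocity, dpr_apply, LinearMap.coe_mk, AddHom.coe_mk, pr_homog, homog_zero_apply,
    inv_one, one_smul, PiLp.sub_apply, PiLp.smul_apply, smul_eq_mul, mul_comm (o i)]
  rfl

theorem orbitVelocity_eq_dpr_smul {n : ℕ} {o : CE n} (A : Mat n) {P : HV n} {r : ℝ} (hr : r ≠ 0)
    (hPo : P = r • homog o) : orbitVelocity o A = dpr P (A *ᵥ P) := by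
  have hr' : (r : ℂ) ≠ 0 := by exact_mod_cast hr
  rw [orbitVelocity_eq_dpr, hPo, real_smul_eq_coe_smul, Matrix.mulVec_smul, dpr_smul hr', map_smul,
    smul_smul, inv_mul_cancel₀ hr', one_smul]

namespace IsFrame

variable {n : ℕ} {P X : HV n}

theorem sk_eigen (h : IsFrame P X) {τ : ℝ} {v : HV n} (hv : sk P X *ᵥ v = τ • v) :
    v = 0 ∨ τ = 0 ∨ τ = 1 ∨ τ = -1 := by
  by_contra! hc
  obtain ⟨hv0, h0, h1, h2⟩ := hc
  rw [sk_mulVec] at hv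
  have e1 := congrArg (q X) hv
  have e2 := congrArg (q P) hv
  simp only [q_sub_right, q_smul_right, q_rsmul_right, h.XX, h.XP, h.PP, h.PX] at e1 e2
  have hX : q X v = 0 := by
    have e3 : ((τ + 1 : ℝ) : ℂ) * q X v = 0 := by push_cast; linear_combination -e1
    refine (mul_eq_zero.1 e3).resolve_left ?_
    exact_mod_cast fun h => h2 (by linarith)
  have hP : q P v = 0 := by
    have e3 : ((τ - 1 : ℝ) : ℂ) * q P v = 0 := by push_cast; linear_combination -e2 - hX
    refine (mul_eq_zero.1 e3).resolve_left ?_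
    exact_mod_cast fun h => h1 (by linarith)
  rw [hX, hP, zero_smul, zero_smul, sub_zero] at hv
  exact (smul_ne_zero h0 hv0) hv.symm

theorem eq_smul_of_sk_eq (h : IsFrame P X) {v : HV n} (hv : sk P X *ᵥ v = v) :
    ∃ β : ℂ, v = β • X := by
  rw [sk_mulVec] at hv
  have e1 := congrArg (q X) hv
  simp only [q_sub_right, q_smul_right, h.XX, h.XP] at e1
  have hX : q X v = 0 := by linear_combination (-1 / 2) * e1
  rw [hX, zero_smul, zero_sub, ← neg_smul] at hv
  exact ⟨-q P v, hv.symm⟩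

theorem sk_X (h : IsFrame P X) : sk P X *ᵥ X = X := by
  rw [sk_mulVec, h.XX, h.PX]; module

theorem sk_P (h : IsFrame P X) : sk P X *ᵥ P = X - P := by
  rw [sk_mulVec, h.XP, h.PP]; module

theorem sk_perp {e : HV n} (he : e ∈ perp P X) : sk P X *ᵥ e = 0 := by
  rw [sk_mulVec, (mem_perp.1 he).1, (mem_perp.1 he).2]; module

/-- Eigenvectors of `ad (sk P X)` with a positive eigenvalue. -/
theorem root_cases (h : IsFrame P X) {ν : ℝ} (hν : 0 < ν) {Z : Mat n} (hZ : Z ∈ su1 n)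
    (hroot : sk P X * Z - Z * sk P X = ν • Z) :
    (Z ≠ 0 → ν = 1 ∨ ν = 2) ∧ (ν = 1 → ∃ w ∈ perp P X, Z = solv P X (0, w, 0)) ∧
      (ν = 2 → ∃ r, Z = solv P X (0, 0, r)) := by
  have hv : ∀ v, sk P X *ᵥ (Z *ᵥ v) = Z *ᵥ (sk P X *ᵥ v) + ν • (Z *ᵥ v) := by
    intro v
    have := congrArg (· *ᵥ v) hroot
    simp only [Matrix.sub_mulVec, ← Matrix.mulVec_mulVec, Matrix.smul_mulVec] at this
    rw [← this]; abel
  have hX : Z *ᵥ X = 0 := by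
    have h1 : sk P X *ᵥ (Z *ᵥ X) = (1 + ν) • (Z *ᵥ X) := by
      rw [hv, h.sk_X, add_smul, one_smul]
    rcases h.sk_eigen h1 with h2 | h2 | h2 | h2
    · exact h2
    all_goals linarith
  have hE : ∀ e ∈ perp P X, sk P X *ᵥ (Z *ᵥ e) = ν • (Z *ᵥ e) := by
    intro e he
    rw [hv, sk_perp he, Matrix.mulVec_zero, zero_add]
  have hP : sk P X *ᵥ (Z *ᵥ P) = (ν - 1) • (Z *ᵥ P) := by
    rw [hv, h.sk_P, Matrix.mulVec_sub, hX, sub_smul, one_smul]; abel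
  refine ⟨fun hZ0 => ?_, ?_, ?_⟩
  · by_contra! hc
    refine hZ0 (h.mat_ext ?_ ?_ fun e he => ?_)
    · rcases h.sk_eigen hP with h2 | h2 | h2 | h2
      · rw [h2, Matrix.zero_mulVec]
      · exact absurd (by linarith) hc.1
      · exact absurd (by linarith) hc.2
      · linarith
    · rw [hX, Matrix.zero_mulVec]
    · rcases h.sk_eigen (hE e he) with h2 | h2 | h2 | h2
      · rw [h2, Matrix.zero_mulVec]
      · linarith
      · exact absurd h2 hc.1
      · linarith
  · rintro rfl
    obtain ⟨f, hf, r, rfl⟩ := h.exists_solv hZ (σ := 0) (by rw [hX, zero_smul]) fun e he =>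
      h.eq_smul_of_sk_eq (by rw [hE e he, one_smul])
    rw [h.solv_P _ _ hf, Matrix.mulVec_sub, Matrix.mulVec_smul, h.sk_X, Matrix.mulVec_add,
      sk_perp hf, sub_self, zero_smul, zero_smul, Matrix.mulVec_zero, zero_add, zero_sub,
      neg_eq_zero, smul_eq_zero, or_iff_left h.X_ne] at hP
    simp at hP
    rw [hP]
    exact ⟨f, hf, rfl⟩
  · rintro rfl
    have hE0 : ∀ e ∈ perp P X, Z *ᵥ e = 0 := by
      intro e he
      rcases h.sk_eigen (hE e he) with h2 | h2 | h2 | h2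
      · exact h2
      all_goals norm_num at h2
    obtain ⟨f, hf, r, rfl⟩ := h.exists_solv hZ (σ := 0) (by rw [hX, zero_smul]) fun e he =>
      ⟨0, by rw [hE0 e he, zero_smul]⟩
    have h1 := hE0 f hf
    rw [solv_perp _ _ _ hf, smul_eq_zero, or_iff_left h.X_ne] at h1
    have h2 := (q_self_nonneg_of_orthogonal h.neg (mem_perp.1 hf).1).2 (by rw [h1]; rfl)
    exact ⟨r, by rw [h2]⟩

theorem commutator_solv (h : IsFrame P X) {w : HV n} (hw : w ∈ perp P X) (r : ℝ) :
    sk P X * solv P X (0, w, r) - solv P X (0, w, r) * sk P X = solv P X (0, w, 2 * r) := by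
  refine h.mat_ext ?_ ?_ fun e he => ?_
  · simp only [Matrix.sub_mulVec, ← Matrix.mulVec_mulVec, h.sk_P, h.solv_P _ _ hw, h.solv_X _ _ hw,
      Matrix.mulVec_sub, Matrix.mulVec_add, Matrix.mulVec_smul, h.sk_X, sk_perp hw]
    push_cast
    module
  · simp only [Matrix.sub_mulVec, ← Matrix.mulVec_mulVec, h.sk_X, h.solv_X _ _ hw,
      Matrix.mulVec_smul]
    module
  · simp only [Matrix.sub_mulVec, ← Matrix.mulVec_mulVec, sk_perp he, solv_perp _ _ _ he,
      Matrix.mulVec_smul, h.sk_X, Matrix.mulVec_zero, sub_zero]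

end IsFrame

/-- The frame adapted to an Iwasawa decomposition. -/
theorem IsIwasawa.exists_frame {n : ℕ} {c : ℝ} (hc : c < 0) {o : CE n} {x : Set (ℝ → CE n)}
    {a : Submodule ℝ (Mat n)} {α : a →ₗ[ℝ] ℝ} (hI : IsIwasawa o x a α) {X₀ P : HV n}
    (hX₀ : X₀ ≠ 0) (hXX₀ : q X₀ X₀ = 0) (hx : ∀ (γ : ℝ → CE n) (v : HV n),
      q v v = -1 → pr v = γ 0 →
        (γ ∈ x ↔ γ = fun t => pr (geoLift (rate c) v (normEnd X₀ v - v) t)))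
    {r : ℝ} (hr : r ≠ 0) (hPo : P = r • homog o) (hP : q P P = -1) :
    IsFrame P (normEnd X₀ P) ∧ (∀ A, A ∈ a ↔ ∃ s, A = solv P (normEnd X₀ P) (s, 0, 0)) ∧
      (∀ A, A ∈ rootSpace a α ↔ ∃ w ∈ perp P (normEnd X₀ P), A = solv P (normEnd X₀ P) (0, w, 0)) ∧
      (∀ A, A ∈ rootSpace a ((2 : ℝ) • α) ↔ ∃ s, A = solv P (normEnd X₀ P) (0, 0, s)) := by
  obtain ⟨hmax, hα, h2α, B, hB, hBx⟩ := hI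
  have hneg : (q P P).re < 0 := by simp [hP]
  have hPo' : pr P = o := by rw [hPo, pr_rsmul hr, pr_homog]
  obtain ⟨n1, n2, n3⟩ := normEnd_spec hX₀ hXX₀ hneg
  obtain ⟨d1, d2⟩ := normEnd_data hX₀ hXX₀ hP
  set X := normEnd X₀ P
  have h : IsFrame P X := ⟨hP, n1, n3⟩
  have hl := rate_pos hc
  set l := rate c
  -- the generator of `𝔞`
  have hcart : ∀ A ∈ a, A ∈ cartanP o := fun A hA => hmax.prop.1 hA
  obtain ⟨b1, b2⟩ := eq_sk_of_mem_cartanP (hcart B B.2) hr hPo hP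
  have hγ := (hx _ P hP (by simp [hPo', act_eq_pr])).1 hBx
  have hBP : (B : Mat n) *ᵥ P = l • (X - P) := by
    have e1 := (hasDerivAt_act_exp o (B : Mat n)).deriv
    rw [hγ, deriv_pr_geoLift_zero hP d1 d2, orbitVelocity_eq_dpr_smul _ hr hPo] at e1
    have e2 : q P (l • (X - P)) = 0 := by rw [q_rsmul_right, d2, mul_zero]
    rw [← hlift_dpr hneg b1, ← e1, ← dpr_rsmul, hlift_dpr hneg e2]
  have hskPP : sk P (X - P) = sk P X := by
    refine mat_ext_mulVec fun v => ?_
    rw [sk_mulVec, sk_mulVec, q_sub_left]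
    module
  have hBK : (B : Mat n) = l • sk P X := by
    rw [b2, hBP, sk_smul_right, hskPP]
  have ha : ∀ A, A ∈ a ↔ ∃ s, A = solv P X (s, 0, 0) := by
    intro A
    constructor
    · intro hA
      obtain ⟨a1, a2⟩ := eq_sk_of_mem_cartanP (hcart A hA) hr hPo hP
      set η := A *ᵥ P
      set ξ := X - P
      have hcomm := hmax.prop.2 A hA B B.2
      have hBξ : (B : Mat n) = l • sk P ξ := by rw [hBK, hskPP]
      rw [a2, hBξ, mul_smul_comm, smul_mul_assoc] at hcomm
      have hcomm' := smul_right_injective (Mat n) hl.ne' hcomm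
      have c1 := congrArg (· *ᵥ P) hcomm'
      have c2 := congrArg (· *ᵥ ξ) hcomm'
      simp only [← Matrix.mulVec_mulVec, sk_mulVec, hP, a1, d2, d1, q_comm_zero a1,
        q_comm_zero d2, q_sub_right, q_smul_right] at c1 c2
      have hP0 : P ≠ 0 := by
        rintro h0
        rw [h0, q_zero_left] at hP
        norm_num at hP
      have e1 : q η ξ = q ξ η := by
        have h3 : (q η ξ - q ξ η) • P = 0 := by
          rw [sub_smul]
          rw [← sub_eq_zero] at c1
          rw [← c1]
          module
        exact sub_eq_zero.1 ((smul_eq_zero.1 h3).resolve_right hP0)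
      have e2 : η = q η ξ • ξ := by
        rw [← sub_eq_zero] at c2 ⊢
        rw [← c2]
        module
      have e3 : ((q η ξ).re : ℂ) = q η ξ := Complex.conj_eq_iff_re.1 (by rw [q_conj, e1])
      refine ⟨(q η ξ).re, ?_⟩
      rw [solv_fst, a2, ← hskPP, ← sk_smul_right]
      congr 1
      rw [real_smul_eq_coe_smul, e3]
      exact e2
    · rintro ⟨s, rfl⟩
      have : solv P X (s, 0, 0) = (s / l) • (B : Mat n) := by
        rw [hBK, smul_smul, div_mul_cancel₀ _ hl.ne', solv_fst]
      rw [this]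
      exact a.smul_mem _ B.2
  -- the root spaces
  have hroot : ∀ β : a →ₗ[ℝ] ℝ, ∀ Z, Z ∈ rootSpace a β ↔ Z ∈ su1 n ∧
      sk P X * Z - Z * sk P X = (β B / l) • Z := by
    intro β Z
    refine and_congr_right fun _ => ⟨fun hZ => ?_, fun hZ H => ?_⟩
    · have := hZ B
      rw [hBK, smul_mul_assoc, mul_smul_comm, ← smul_sub] at this
      rw [div_eq_inv_mul, mul_smul, ← this, smul_smul, inv_mul_cancel₀ hl.ne', one_smul]
    · obtain ⟨s, hs⟩ := (ha H).1 H.2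
      have hH : H = (s / l) • B := by
        apply Subtype.ext
        rw [Submodule.coe_smul, hBK, smul_smul, div_mul_cancel₀ _ hl.ne', hs, solv_fst]
      rw [hs, solv_fst, smul_mul_assoc, mul_smul_comm, ← smul_sub, hZ, hH, map_smul, smul_smul,
        smul_eq_mul]
      congr 1
      ring
  set ν := α B / l with hν
  have hν0 : 0 < ν := div_pos hB hl
  have hν2 : ((2 : ℝ) • α) B / l = 2 * ν := by
    rw [LinearMap.smul_apply, smul_eq_mul, mul_div_assoc]
  obtain ⟨Z₁, hZ₁, hZ₁0⟩ := Submodule.exists_mem_ne_zero_of_ne_bot hα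
  obtain ⟨Z₂, hZ₂, hZ₂0⟩ := Submodule.exists_mem_ne_zero_of_ne_bot h2α
  rw [hroot] at hZ₁ hZ₂
  rw [hν2] at hZ₂
  have hν1 : ν = 1 := by
    have k1 := (h.root_cases hν0 hZ₁.1 hZ₁.2).1 hZ₁0
    have k2 := (h.root_cases (by linarith) hZ₂.1 hZ₂.2).1 hZ₂0
    rcases k1 with k1 | k1
    · exact k1
    · rcases k2 with k2 | k2 <;> linarith
  refine ⟨h, ha, fun A => ?_, fun A => ?_⟩
  · rw [hroot, ← hν, hν1]
    constructor
    · rintro ⟨h1, h2⟩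
      exact (h.root_cases one_pos h1 h2).2.1 rfl
    · rintro ⟨w, hw, rfl⟩
      refine ⟨h.solv_mem_su1 _ _ hw, ?_⟩
      rw [h.commutator_solv hw, mul_zero, one_smul]
  · rw [hroot, hν2, hν1, mul_one]
    constructor
    · rintro ⟨h1, h2⟩
      exact (h.root_cases two_pos h1 h2).2.2 rfl
    · rintro ⟨s, rfl⟩
      refine ⟨h.solv_mem_su1 _ _ (zero_mem _), ?_⟩
      rw [h.commutator_solv (zero_mem _), ← map_smul]
      simp

end ComplexHyperbolic
end

noncomputable section

namespace ComplexHyperbolic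

/-! ### Orbits of the subgroups of `AN` -/

/-- The algebra `𝔞 ⊕ F ⊕ 𝔤_{2α}`, for a real subspace `F` of `perp P X ≅ 𝔤_α`. -/
def solvSub {n : ℕ} (P X : HV n) (F : Submodule ℝ (HV n)) : Submodule ℝ (Mat n) :=
  ((⊤ : Submodule ℝ ℝ).prod (F.prod ⊤)).map (solv P X)

theorem mem_solvSub {n : ℕ} {P X : HV n} {F : Submodule ℝ (HV n)} {A : Mat n} :
    A ∈ solvSub P X F ↔ ∃ s r : ℝ, ∃ w ∈ F, A = solv P X (s, w, r) := by
  constructor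
  · rintro ⟨⟨s, w, r⟩, ⟨-, hw, -⟩, rfl⟩
    exact ⟨s, r, w, hw, rfl⟩
  · rintro ⟨s, r, w, hw, rfl⟩
    exact ⟨(s, w, r), ⟨trivial, hw, trivial⟩, rfl⟩

/-- The vectors whose `P`-coordinate is real and whose component in `perp P X` lies in `F`. -/
def slice {n : ℕ} (P X : HV n) (F : Submodule ℝ (HV n)) : Submodule ℝ (HV n) where
  carrier := {v | (q X v).im = 0 ∧ projE P X v ∈ F}
  zero_mem' := by simp [q_zero_right]
  add_mem' := fun {a b} ha hb => by
    refine ⟨?_, by rw [map_add]; exact add_mem ha.2 hb.2⟩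
    rw [q_add_right, Complex.add_im, ha.1, hb.1, add_zero]
  smul_mem' := fun r a ha => by
    refine ⟨?_, ?_⟩
    · rw [q_rsmul_right, Complex.im_ofReal_mul, ha.1, mul_zero]
    · have e : projE P X (r • a) = r • projE P X a := by
        rw [real_smul_eq_coe_smul, map_smul, real_smul_eq_coe_smul]
      rw [e]
      exact F.smul_mem r ha.2

theorem mem_slice {n : ℕ} {P X v : HV n} {F : Submodule ℝ (HV n)} :
    v ∈ slice P X F ↔ (q X v).im = 0 ∧ projE P X v ∈ F := Iff.rfl

/-- The lifts of the points of the ball with `⟨X, u⟩` real and negative. -/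
structure IsNormLift {n : ℕ} (X u : HV n) : Prop where
  self : q u u = -1
  im : (q X u).im = 0
  re : (q X u).re < 0

namespace IsNormLift

variable {n : ℕ} {X u u' : HV n}

theorem neg (h : IsNormLift X u) : (q u u).re < 0 := by simp [h.self]

theorem q_eq (h : IsNormLift X u) : q X u = ((q X u).re : ℂ) := by
  apply Complex.ext <;> simp [h.im]

theorem unique (h : IsNormLift X u) (h' : IsNormLift X u') (e : pr u = pr u') : u = u' := by
  have h0 := zero_ne_of_neg h.neg
  have h0' := zero_ne_of_neg h'.neg
  have e1 : u' = (u' 0 / u 0) • u := by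
    conv_lhs => rw [← smul_homog_pr h0', ← e, homog_pr h0, smul_smul, ← div_eq_mul_inv]
  set κ := u' 0 / u 0
  have e2 : κ = (((q X u').re / (q X u).re : ℝ) : ℂ) := by
    have hq : q X u' = κ * q X u := by conv_lhs => rw [e1, q_smul_right]
    push_cast
    have hne : ((q X u).re : ℂ) ≠ 0 := by exact_mod_cast h.re.ne
    rw [eq_div_iff hne, ← h.q_eq, ← hq, h'.q_eq, Complex.ofReal_re]
  have hpos : 0 < (q X u').re / (q X u).re := div_pos_of_neg_of_neg h'.re h.re
  set t := (q X u').re / (q X u).re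
  have e3 := h'.self
  rw [e1, e2, q_smul_left, q_smul_right, h.self, Complex.conj_ofReal] at e3
  have e4 : t * t = 1 := by
    have := congrArg Complex.re e3
    simp at this
    linarith
  have e5 : t = 1 := by nlinarith
  rw [e1, e2, e5, Complex.ofReal_one, one_smul]

end IsNormLift

theorem exists_normLift {n : ℕ} {X : HV n} (hX : X ≠ 0) (hXX : q X X = 0) {z : CE n}
    (hz : z ∈ CH n) : ∃ κ : ℂ, IsNormLift X (κ • homog z) ∧ pr (κ • homog z) = z := by
  obtain ⟨r, hr, h1, h2⟩ := exists_unit_lift hz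
  rw [real_smul_eq_coe_smul] at h1 h2
  have hne := q_ne_zero_of_null hX hXX (W := (r : ℂ) • homog z) (by rw [h1]; simp)
  set u := (r : ℂ) • homog z with hu
  set m := q X u with hm
  have hn : (‖m‖ : ℂ) ≠ 0 := by exact_mod_cast norm_ne_zero_iff.2 hne
  set τ : ℂ := -((starRingEnd ℂ) m / ‖m‖) with hτ
  have hmm : (starRingEnd ℂ) m * m = ‖m‖ ^ 2 := by
    rw [← Complex.normSq_eq_conj_mul_self, Complex.normSq_eq_norm_sq]; norm_cast
  have e1 : q X (τ • u) = ((-‖m‖ : ℝ) : ℂ) := by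
    rw [q_smul_right, ← hm, hτ, neg_mul, div_mul_eq_mul_div, hmm]
    push_cast
    field_simp
  have hτ1 : (starRingEnd ℂ) τ * τ = 1 := by
    rw [hτ]
    simp only [map_neg, map_div₀, Complex.conj_conj, Complex.conj_ofReal]
    rw [neg_mul_neg, div_mul_div_comm, mul_comm m, hmm]
    field_simp
  have hτ0 : τ ≠ 0 := by
    intro h0
    rw [h0] at hτ1
    simp at hτ1
  refine ⟨τ * r, ?_, ?_⟩
  · rw [mul_smul, ← hu]
    refine ⟨?_, ?_, ?_⟩
    · rw [q_smul_left, q_smul_right, h1, ← mul_assoc, hτ1, one_mul]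
    · rw [e1, Complex.ofReal_im]
    · rw [e1, Complex.ofReal_re]
      exact neg_neg_of_pos (norm_pos_iff.2 hne)
  · rw [mul_smul, ← hu, pr_smul hτ0, h2]

/-- The union of the projections of the normalized lifts in the slice given by `F`. -/
def slicePts {n : ℕ} (P X : HV n) (F : Submodule ℝ (HV n)) : Set (CE n) :=
  {z | ∃ u ∈ slice P X F, IsNormLift X u ∧ pr u = z}

/-- The elements preserving the flag given by `X` and a slice. -/
structure IsFlagMap {n : ℕ} (P X : HV n) (F : Submodule ℝ (HV n)) (M : Mat n) : Prop where
  map_X : ∃ ρ : ℝ, 0 < ρ ∧ M *ᵥ X = ρ • X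
  map_perp : ∀ e ∈ perp P X, ∃ β : ℂ, M *ᵥ e = e + β • X
  map_slice : ∀ v ∈ slice P X F, M *ᵥ v ∈ slice P X F

namespace IsFlagMap

variable {n : ℕ} {P X : HV n} {F : Submodule ℝ (HV n)}

theorem one : IsFlagMap P X F 1 :=
  ⟨⟨1, one_pos, by simp⟩, fun e _ => ⟨0, by simp⟩, fun v hv => by simpa using hv⟩

theorem mul {M N : Mat n} (hM : IsFlagMap P X F M) (hN : IsFlagMap P X F N) :
    IsFlagMap P X F (M * N) := by
  obtain ⟨ρ, hρ, h1⟩ := hM.map_X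
  obtain ⟨ρ', hρ', h2⟩ := hN.map_X
  refine ⟨⟨ρ' * ρ, mul_pos hρ' hρ, ?_⟩, fun e he => ?_, fun v hv => ?_⟩
  · rw [← Matrix.mulVec_mulVec, h2, Matrix.mulVec_smul, h1, smul_smul]
  · obtain ⟨β, hβ⟩ := hN.map_perp e he
    obtain ⟨β', hβ'⟩ := hM.map_perp e he
    refine ⟨β' + β * ρ, ?_⟩
    rw [← Matrix.mulVec_mulVec, hβ, Matrix.mulVec_add, Matrix.mulVec_smul, h1, hβ',
      real_smul_eq_coe_smul]
    module
  · rw [← Matrix.mulVec_mulVec]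
    exact hM.map_slice _ (hN.map_slice v hv)

theorem exp_solv (h : IsFrame P X) (hF : ∀ w ∈ F, w ∈ perp P X) (s r : ℝ)
    {w : HV n} (hw : w ∈ F) : IsFlagMap P X F (NormedSpace.exp (solv P X (s, w, r))) := by
  refine ⟨⟨Real.exp s, Real.exp_pos s, ?_⟩, fun e he => ?_, fun v hv => ?_⟩
  · have e1 : solv P X (s, w, r) *ᵥ X = (s : ℂ) • X := by
      rw [h.solv_X _ _ (hF w hw), real_smul_eq_coe_smul]
    rw [exp_mulVec_of_eigen e1, real_smul_eq_coe_smul, Complex.ofReal_exp]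
  · have hK : ∀ k ∈ (Submodule.span ℂ {X}).restrictScalars ℝ, solv P X (s, w, r) *ᵥ k
        ∈ (Submodule.span ℂ {X}).restrictScalars ℝ := by
      intro k hk
      obtain ⟨b, rfl⟩ := Submodule.mem_span_singleton.1 hk
      rw [Matrix.mulVec_smul, h.solv_X _ _ (hF w hw), real_smul_eq_coe_smul, smul_smul]
      exact Submodule.smul_mem _ _ (Submodule.mem_span_singleton_self X)
    have h1 : solv P X (s, w, r) *ᵥ e ∈ (Submodule.span ℂ {X}).restrictScalars ℝ := by
      rw [IsFrame.solv_perp _ _ _ he]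
      exact Submodule.smul_mem (Submodule.span ℂ {X}) _ (Submodule.mem_span_singleton_self X)
    have h2 := exp_mulVec_sub_mem h1 hK
    obtain ⟨β, hβ⟩ := Submodule.mem_span_singleton.1 (Submodule.restrictScalars_mem ℝ _ _ |>.1 h2)
    exact ⟨β, by rw [hβ, add_sub_cancel]⟩
  · refine exp_mulVec_mem (fun k hk => ?_) hv
    rw [mem_slice] at hk ⊢
    have hwX := (mem_perp.1 (hF w hw)).2
    have hk1 : q X k = ((q X k).re : ℂ) := by apply Complex.ext <;> simp [hk.1]
    rw [solv_mulVec]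
    constructor
    · simp only [q_add_right, q_sub_right, q_rsmul_right, q_smul_right, h.XX, h.XP, hwX]
      rw [hk1]
      simp
    · have e : projE P X (s • (q X k • P - q P k • X) + (q w k • X - q X k • w)
          + (Complex.I * r * q X k) • X) = (-(q X k).re) • w := by
        rw [real_smul_eq_coe_smul, real_smul_eq_coe_smul]
        simp only [map_add, map_sub, map_smul, h.projE_X, h.projE_P,
          IsFrame.projE_perp (hF w hw)]
        rw [hk1]
        simp
      rw [e]
      exact F.smul_mem _ hw

end IsFlagMap

theorem solvSub_le_su1 {n : ℕ} {P X : HV n} (h : IsFrame P X) {F : Submodule ℝ (HV n)}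
    (hF : ∀ w ∈ F, w ∈ perp P X) : solvSub P X F ≤ su1 n := by
  intro A hA
  obtain ⟨s, r, w, hw, rfl⟩ := mem_solvSub.1 hA
  exact h.solv_mem_su1 s r (hF w hw)

theorem exists_mem_expSubgroup {n : ℕ} {s : Submodule ℝ (Mat n)} (hs : s ≤ su1 n) {A : Mat n}
    (hA : A ∈ s) : ∃ g ∈ expSubgroup s, mat g = NormedSpace.exp A := by
  obtain ⟨g, hg⟩ := exists_mat_eq_exp (hs hA)
  exact ⟨g, Subgroup.subset_closure ⟨A, hA, hg⟩, hg⟩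

theorem isFlagMap_of_mem {n : ℕ} {P X : HV n} (h : IsFrame P X) {F : Submodule ℝ (HV n)}
    (hF : ∀ w ∈ F, w ∈ perp P X) {g : SU1 n} (hg : g ∈ expSubgroup (solvSub P X F)) :
    IsFlagMap P X F (mat g) := by
  suffices hs : IsFlagMap P X F (mat g) ∧ IsFlagMap P X F (mat g⁻¹) from hs.1
  induction hg using Subgroup.closure_induction with
  | mem g hg =>
    obtain ⟨A, hA, hgA⟩ := hg
    obtain ⟨s, r, w, hw, rfl⟩ := mem_solvSub.1 hA
    refine ⟨hgA ▸ IsFlagMap.exp_solv h hF s r hw, ?_⟩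
    have hA' := neg_mem hA
    obtain ⟨g', -, hg'⟩ := exists_mem_expSubgroup (solvSub_le_su1 h hF) hA'
    have e : g⁻¹ = g' := by
      refine inv_eq_of_mul_eq_one_right (mat_injective ?_)
      rw [mat_mul, hgA, hg', ← Matrix.exp_add_of_commute _ _ ((Commute.refl (solv P X (s, w, r))).neg_right),
        add_neg_cancel, NormedSpace.exp_zero, mat_one]
    obtain ⟨s', r', w', hw', e'⟩ := mem_solvSub.1 hA'
    rw [e, hg', e']
    exact IsFlagMap.exp_solv h hF s' r' hw'
  | one =>
    rw [inv_one, mat_one]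
    exact ⟨IsFlagMap.one, IsFlagMap.one⟩
  | mul g g' _ _ h1 h2 =>
    rw [mul_inv_rev, mat_mul, mat_mul]
    exact ⟨h1.1.mul h2.1, h2.2.mul h1.2⟩
  | inv g _ h1 =>
    rw [inv_inv]
    exact h1.symm

theorem IsFlagMap.isNormLift {n : ℕ} {P X : HV n} (h : IsFrame P X) {F : Submodule ℝ (HV n)}
    {g : SU1 n} (hg : IsFlagMap P X F (mat g)) : IsNormLift X (mat g *ᵥ P) := by
  obtain ⟨ρ, hρ, hX⟩ := hg.map_X
  have e : q X (mat g *ᵥ P) = ((-ρ⁻¹ : ℝ) : ℂ) := by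
    have h1 := q_mat g X P
    rw [hX, q_rsmul_left, h.XP] at h1
    have hρ' : (ρ : ℂ) ≠ 0 := by exact_mod_cast hρ.ne'
    push_cast
    field_simp
    linear_combination h1
  refine ⟨by rw [q_mat, h.PP], by rw [e, Complex.ofReal_im], ?_⟩
  rw [e, Complex.ofReal_re]
  exact neg_neg_of_pos (inv_pos.2 hρ)

theorem mat_eq_one_of_fix {n : ℕ} {P X : HV n} (h : IsFrame P X) {F : Submodule ℝ (HV n)}
    {g : SU1 n} (hg : IsFlagMap P X F (mat g)) (hP : mat g *ᵥ P = P) : g = 1 := by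
  obtain ⟨ρ, hρ, hX⟩ := hg.map_X
  refine mat_injective (h.mat_ext ?_ ?_ fun e he => ?_)
  · rw [hP, mat_one, Matrix.one_mulVec]
  · have h1 := q_mat g X P
    rw [hX, hP, q_rsmul_left, h.XP] at h1
    have h2 : ρ = 1 := by
      have := congrArg Complex.re h1
      simpa using this
    rw [hX, h2, mat_one, Matrix.one_mulVec, one_smul]
  · obtain ⟨β, hβ⟩ := hg.map_perp e he
    have h1 := q_mat g P e
    rw [hβ, hP, q_add_right, q_smul_right, h.PX, (mem_perp.1 he).1] at h1
    have h2 : β = 0 := by linear_combination -h1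
    rw [hβ, h2, zero_smul, add_zero, mat_one, Matrix.one_mulVec]

/-- The orbit of the base point contains every normalized lift in the slice. -/
theorem exists_mulVec_eq {n : ℕ} {P X : HV n} (h : IsFrame P X) {F : Submodule ℝ (HV n)}
    (hF : ∀ w ∈ F, w ∈ perp P X) {v : HV n} (hv : v ∈ slice P X F) (hv' : IsNormLift X v) :
    ∃ g ∈ expSubgroup (solvSub P X F), mat g *ᵥ P = v := by
  obtain ⟨him, hf⟩ := mem_slice.1 hv
  set f := projE P X v with hfdef
  set y : ℝ := -(q X v).re with hy
  have hy0 : 0 < y := by linarith [hv'.re]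
  have hyC : (y : ℂ) ≠ 0 := by exact_mod_cast hy0.ne'
  have hqX : q X v = -(y : ℂ) := by
    rw [hv'.q_eq, hy]; simp
  have hfE := hF f hf
  have hdec : v = (-(y : ℂ) - q P v) • X + (y : ℂ) • P + f := by
    conv_lhs => rw [IsFrame.decomp (P := P) (X := X) v, hqX, neg_smul, sub_neg_eq_add]
  have hsu := solvSub_le_su1 h hF
  obtain ⟨w, hw⟩ : ∃ w : HV n, w = y⁻¹ • f := ⟨_, rfl⟩
  have hwF : w ∈ F := hw ▸ F.smul_mem _ hf
  have hwE := hF w hwF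
  set r : ℝ := (q P v).im / y with hr
  obtain ⟨g₁, hg₁, hm₁⟩ := exists_mem_expSubgroup hsu
    (mem_solvSub.2 ⟨-Real.log y, 0, 0, zero_mem F, rfl⟩)
  obtain ⟨g₂, hg₂, hm₂⟩ := exists_mem_expSubgroup hsu (mem_solvSub.2 ⟨0, r, w, hwF, rfl⟩)
  have d1 : mat g₁ *ᵥ X = ((y⁻¹ : ℝ) : ℂ) • X := by
    have e : solv P X (-Real.log y, 0, 0) *ᵥ X = ((-Real.log y : ℝ) : ℂ) • X := by
      rw [h.solv_X _ _ (zero_mem _), real_smul_eq_coe_smul]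
    rw [hm₁, exp_mulVec_of_eigen e, ← Complex.ofReal_exp, Real.exp_neg, Real.exp_log hy0]
  have d2 : mat g₁ *ᵥ ((2 : ℂ) • P - X) = (y : ℂ) • ((2 : ℂ) • P - X) := by
    have e : solv P X (-Real.log y, 0, 0) *ᵥ ((2 : ℂ) • P - X)
        = ((Real.log y : ℝ) : ℂ) • ((2 : ℂ) • P - X) := by
      rw [Matrix.mulVec_sub, Matrix.mulVec_smul, h.solv_X _ _ (zero_mem _),
        h.solv_P _ _ (zero_mem _), real_smul_eq_coe_smul, real_smul_eq_coe_smul]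
      push_cast
      module
    rw [hm₁, exp_mulVec_of_eigen e, ← Complex.ofReal_exp, Real.exp_log hy0]
  have d3 : mat g₁ *ᵥ P = (y : ℂ) • P + (((y⁻¹ - y) / 2 : ℝ) : ℂ) • X := by
    have e : P = (2⁻¹ : ℂ) • ((2 : ℂ) • P - X) + (2⁻¹ : ℂ) • X := by module
    conv_lhs => rw [e]
    rw [Matrix.mulVec_add, Matrix.mulVec_smul, Matrix.mulVec_smul, d1, d2]
    push_cast
    module
  have d4 : mat g₂ *ᵥ X = X := by
    have e : solv P X (0, w, r) *ᵥ X = (0 : ℂ) • X := by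
      rw [h.solv_X _ _ hwE, zero_smul, zero_smul]
    rw [hm₂, exp_mulVec_of_eigen e, Complex.exp_zero, one_smul]
  have d5 : mat g₂ *ᵥ P = P + (w - (Complex.I * r) • X) + (2⁻¹ : ℝ) • (q w w • X) := by
    have e1 : solv P X (0, w, r) *ᵥ P = w - (Complex.I * r) • X := by
      rw [h.solv_P _ _ hwE, zero_smul, zero_add]
    have e2 : solv P X (0, w, r) *ᵥ (w - (Complex.I * r) • X) = q w w • X := by
      rw [Matrix.mulVec_sub, Matrix.mulVec_smul, h.solv_X _ _ hwE, IsFrame.solv_perp _ _ _ hwE]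
      simp
    rw [hm₂, exp_mulVec_of_nilpotent, e1, e2]
    rw [e1, e2, Matrix.mulVec_smul, h.solv_X _ _ hwE]
    simp
  refine ⟨g₂ * g₁, mul_mem hg₂ hg₁, ?_⟩
  rw [mat_mul, ← Matrix.mulVec_mulVec, d3, Matrix.mulVec_add, Matrix.mulVec_smul,
    Matrix.mulVec_smul, d4, d5]
  have hww : q w w = ((y⁻¹ ^ 2 * (q f f).re : ℝ) : ℂ) := by
    have h1 := q_self_ofReal f
    rw [hw, q_rsmul_left, q_rsmul_right]
    push_cast
    rw [h1]
    ring
  have hself : 2 * (q P v).re * y + y ^ 2 + (q f f).re = -1 := by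
    have h1 := hv'.self
    rw [hdec] at h1
    have h3 : q f P = 0 := q_comm_zero (mem_perp.1 hfE).1
    have h4 : q f X = 0 := q_comm_zero (mem_perp.1 hfE).2
    rw [← hdec] at h1
    have h2 : q v v = q (((-(y : ℂ) - q P v) • X + (y : ℂ) • P + f))
        ((-(y : ℂ) - q P v) • X + (y : ℂ) • P + f) := by rw [← hdec]
    rw [h1] at h2
    simp only [q_add_left, q_add_right, q_smul_left, q_smul_right, h.XX, h.XP, h.PP, h.PX, h3, h4,
      (mem_perp.1 hfE).1, (mem_perp.1 hfE).2, map_sub, map_neg, Complex.conj_ofReal] at h2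
    have h5 := congrArg Complex.re h2
    simp at h5
    nlinarith
  have hcoef : -(y : ℂ) - q P v = (y : ℂ) * (-(Complex.I * r)) + y * (2⁻¹ * q w w)
      + (((y⁻¹ - y) / 2 : ℝ) : ℂ) := by
    rw [hww]
    have e1 : (y : ℂ) * (-(Complex.I * r)) + y * (2⁻¹ * ((y⁻¹ ^ 2 * (q f f).re : ℝ) : ℂ))
        + (((y⁻¹ - y) / 2 : ℝ) : ℂ)
        = ((y * (2⁻¹ * (y⁻¹ ^ 2 * (q f f).re)) + (y⁻¹ - y) / 2 : ℝ) : ℂ)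
          + ((-(y * r) : ℝ) : ℂ) * Complex.I := by
      push_cast
      ring
    rw [e1]
    apply Complex.ext
    · rw [Complex.sub_re, Complex.neg_re, Complex.ofReal_re, Complex.add_re, Complex.ofReal_re,
        Complex.re_ofReal_mul, Complex.I_re]
      field_simp
      linarith
    · rw [Complex.sub_im, Complex.neg_im, Complex.ofReal_im, Complex.add_im, Complex.ofReal_im,
        Complex.im_ofReal_mul, Complex.I_im, hr]
      field_simp
      ring
  rw [hdec, hcoef, hw]
  simp only [real_smul_eq_coe_smul]
  match_scalars
  · ring
  · rw [mul_one, mul_inv_cancel₀ hyC]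
  · ring

end ComplexHyperbolic
end

noncomputable section

namespace ComplexHyperbolic

/-! ### The simply transitive subgroup -/

theorem act_pr {n : ℕ} (A : Mat n) {W : HV n} (h : W 0 ≠ 0) : act A (pr W) = pr (A *ᵥ W) := by
  rw [act_eq_pr, homog_pr h, Matrix.mulVec_smul, pr_smul (inv_ne_zero h)]

theorem q_mat_self_neg {n : ℕ} (g : SU1 n) {W : HV n} (h : (q W W).re < 0) :
    (q (mat g *ᵥ W) (mat g *ᵥ W)).re < 0 := by rwa [q_mat]

theorem act_mul_pr {n : ℕ} (g h : SU1 n) {W : HV n} (hW : (q W W).re < 0) :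
    act (mat (g * h)) (pr W) = act (mat g) (act (mat h) (pr W)) := by
  rw [act_pr _ (zero_ne_of_neg hW), act_pr _ (zero_ne_of_neg hW),
    act_pr _ (zero_ne_of_neg (q_mat_self_neg h hW)), mat_mul, Matrix.mulVec_mulVec]

section Orbit

variable {n : ℕ} {P X : HV n} {F : Submodule ℝ (HV n)}

theorem IsFrame.P_mem_slice (h : IsFrame P X) (F : Submodule ℝ (HV n)) : P ∈ slice P X F := by
  rw [mem_slice, h.projE_P, h.XP]
  exact ⟨by simp, zero_mem F⟩

theorem orbit_eq_slicePts (h : IsFrame P X) (hF : ∀ w ∈ F, w ∈ perp P X) :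
    {z | ∃ g ∈ expSubgroup (solvSub P X F), act (mat g) (pr P) = z} = slicePts P X F := by
  ext z
  constructor
  · rintro ⟨g, hg, rfl⟩
    have hm := isFlagMap_of_mem h hF hg
    exact ⟨mat g *ᵥ P, hm.map_slice _ (h.P_mem_slice F), hm.isNormLift h,
      (act_pr _ (zero_ne_of_neg h.neg)).symm⟩
  · rintro ⟨u, hu, hu', rfl⟩
    obtain ⟨g, hg, hgP⟩ := exists_mulVec_eq h hF hu hu'
    exact ⟨g, hg, by rw [act_pr _ (zero_ne_of_neg h.neg), hgP]⟩

/-- The solvable group acts freely. -/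
theorem eq_of_act_eq (h : IsFrame P X) (hF : ∀ w ∈ F, w ∈ perp P X) {g g' : SU1 n}
    (hg : g ∈ expSubgroup (solvSub P X F)) (hg' : g' ∈ expSubgroup (solvSub P X F))
    (e : act (mat g) (pr P) = act (mat g') (pr P)) : g = g' := by
  have h0 := zero_ne_of_neg h.neg
  rw [act_pr _ h0, act_pr _ h0] at e
  have e1 := ((isFlagMap_of_mem h hF hg).isNormLift h).unique
    ((isFlagMap_of_mem h hF hg').isNormLift h) e
  have e2 : g⁻¹ * g' = 1 := by
    refine mat_eq_one_of_fix h (isFlagMap_of_mem h hF (mul_mem (inv_mem hg) hg')) ?_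
    rw [mat_mul, ← Matrix.mulVec_mulVec, ← e1, mat_inv_mulVec]
  exact inv_mul_eq_one.1 e2

theorem solvSub_mono {F' : Submodule ℝ (HV n)} (hF : F ≤ F') : solvSub P X F ≤ solvSub P X F' := by
  intro A hA
  obtain ⟨s, r, w, hw, rfl⟩ := mem_solvSub.1 hA
  exact mem_solvSub.2 ⟨s, r, w, hF hw, rfl⟩

theorem expSubgroup_mono {s s' : Submodule ℝ (Mat n)} (h : s ≤ s') :
    expSubgroup s ≤ expSubgroup s' :=
  Subgroup.closure_mono fun _ ⟨A, hA, e⟩ => ⟨A, h hA, e⟩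

theorem actsSimplyTransitively_of_orbit (h : IsFrame P X) (hF : ∀ w ∈ F, w ∈ perp P X) :
    ActsSimplyTransitively (expSubgroup (solvSub P X F)) (slicePts P X F) := by
  have hP := h.neg
  rw [← orbit_eq_slicePts h hF]
  refine ⟨?_, ?_⟩
  · rintro g hg _ ⟨g', hg', rfl⟩
    exact ⟨g * g', mul_mem hg hg', act_mul_pr g g' hP⟩
  · rintro _ ⟨g, hg, rfl⟩ _ ⟨g', hg', rfl⟩
    refine ⟨g' * g⁻¹, ⟨mul_mem hg' (inv_mem hg), ?_⟩, ?_⟩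
    · rw [← act_mul_pr _ _ hP, inv_mul_cancel_right]
    · rintro k ⟨hk, e⟩
      rw [← act_mul_pr _ _ hP] at e
      rw [← eq_of_act_eq h hF (mul_mem hk hg) hg' e, mul_inv_cancel_right]

theorem le_of_actsSimplyTransitively (h : IsFrame P X) (hF : ∀ w ∈ F, w ∈ perp P X)
    {S : Set (CE n)} (hS : pr P ∈ S) {H H' : Subgroup (SU1 n)}
    (hH : H ≤ expSubgroup (solvSub P X F)) (hH' : H' ≤ expSubgroup (solvSub P X F))
    (a : ActsSimplyTransitively H S) (a' : ActsSimplyTransitively H' S) : H ≤ H' := by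
  intro g hg
  obtain ⟨g', ⟨hg', e⟩, -⟩ := a'.2 _ hS _ (a.1 g hg _ hS)
  rwa [← eq_of_act_eq h hF (hH' hg') (hH hg) e]

end Orbit

/-- A totally geodesic submanifold, as the set of points over a complex subspace that contains the
frame. -/
structure IsAdapted {n : ℕ} (P X : HV n) (V : Submodule ℂ (HV n)) (S : Set (CE n)) : Prop where
  frame : IsFrame P X
  P_mem : P ∈ V
  X_mem : X ∈ V
  mem_iff : ∀ z, z ∈ S ↔ z ∈ CH n ∧ homog z ∈ V

/-- The vectors of `V` orthogonal to the frame. -/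
def tanPart {n : ℕ} (P X : HV n) (V : Submodule ℂ (HV n)) : Submodule ℝ (HV n) :=
  (V ⊓ perp P X).restrictScalars ℝ

theorem mem_tanPart {n : ℕ} {P X w : HV n} {V : Submodule ℂ (HV n)} :
    w ∈ tanPart P X V ↔ w ∈ V ∧ w ∈ perp P X := Iff.rfl

namespace IsAdapted

variable {n : ℕ} {P X : HV n} {V : Submodule ℂ (HV n)} {S : Set (CE n)}

theorem tanPart_le : ∀ w ∈ tanPart P X V, w ∈ perp P X := fun _ hw => hw.2

theorem pr_mem (h : IsAdapted P X V S) {u : HV n} (hu : u ∈ V) (hn : (q u u).re < 0) :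
    pr u ∈ S := by
  rw [h.mem_iff, homog_pr (zero_ne_of_neg hn)]
  exact ⟨pr_mem_CH hn, V.smul_mem _ hu⟩

theorem mem_slice_iff (h : IsAdapted P X V S) {u : HV n} :
    u ∈ slice P X (tanPart P X V) ↔ (q X u).im = 0 ∧ u ∈ V := by
  rw [mem_slice, mem_tanPart, and_iff_left (h.frame.projE_mem u)]
  refine and_congr_right fun _ => ⟨fun hu => ?_, fun hu => ?_⟩
  · rw [IsFrame.decomp (P := P) (X := X) u]
    exact add_mem (sub_mem (V.smul_mem _ h.X_mem) (V.smul_mem _ h.P_mem)) hu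
  · rw [projE_apply]
    exact add_mem (sub_mem hu (V.smul_mem _ h.X_mem)) (V.smul_mem _ h.P_mem)

theorem eq_slicePts (h : IsAdapted P X V S) : S = slicePts P X (tanPart P X V) := by
  ext z
  constructor
  · intro hz
    obtain ⟨hz1, hz2⟩ := (h.mem_iff z).1 hz
    obtain ⟨κ, hκ, e⟩ := exists_normLift h.frame.X_ne h.frame.XX hz1
    exact ⟨_, h.mem_slice_iff.2 ⟨hκ.im, V.smul_mem κ hz2⟩, hκ, e⟩
  · rintro ⟨u, hu, hu', rfl⟩
    exact h.pr_mem (h.mem_slice_iff.1 hu).2 hu'.neg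

theorem o_mem (h : IsAdapted P X V S) : pr P ∈ S := h.pr_mem h.P_mem h.frame.neg

/-- The group acting simply transitively on the totally geodesic submanifold. -/
theorem eq_expSubgroup (h : IsAdapted P X V S) {H : Subgroup (SU1 n)}
    (hH : H ≤ expSubgroup (solvSub P X ((perp P X).restrictScalars ℝ)))
    (a : ActsSimplyTransitively H S) : H = expSubgroup (solvSub P X (tanPart P X V)) := by
  have hle : expSubgroup (solvSub P X (tanPart P X V))
      ≤ expSubgroup (solvSub P X ((perp P X).restrictScalars ℝ)) :=
    expSubgroup_mono (solvSub_mono tanPart_le)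
  have a' : ActsSimplyTransitively (expSubgroup (solvSub P X (tanPart P X V))) S := by
    conv => rw [h.eq_slicePts]
    exact actsSimplyTransitively_of_orbit h.frame tanPart_le
  exact le_antisymm (le_of_actsSimplyTransitively h.frame (fun _ hw => hw) h.o_mem hH hle a a')
    (le_of_actsSimplyTransitively h.frame (fun _ hw => hw) h.o_mem hle hH a' a)

/-- The Lie algebra of the group acting simply transitively. -/
theorem lieAlg_eq (h : IsAdapted P X V S) :
    lieAlg (expSubgroup (solvSub P X (tanPart P X V))) = solvSub P X (tanPart P X V) := by
  have hsu := solvSub_le_su1 h.frame (tanPart_le (P := P) (X := X) (V := V))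
  apply le_antisymm
  · refine Submodule.span_le.2 ?_
    rintro A ⟨hA, hexp⟩
    have hm : ∀ t : ℝ, IsFlagMap P X (tanPart P X V) (NormedSpace.exp (t • A)) := by
      intro t
      obtain ⟨g, hg, e⟩ := hexp t
      exact e ▸ isFlagMap_of_mem h.frame tanPart_le hg
    have h1 : A *ᵥ X ∈ Submodule.span ℝ {X} := by
      refine mulVec_mem_of_exp fun t => ?_
      obtain ⟨ρ, -, e⟩ := (hm t).map_X
      rw [e]
      exact sub_mem (Submodule.smul_mem _ _ (Submodule.mem_span_singleton_self X))
        (Submodule.mem_span_singleton_self X)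
    obtain ⟨σ, hσ⟩ := Submodule.mem_span_singleton.1 h1
    obtain ⟨f, hf, r, rfl⟩ := h.frame.exists_solv hA hσ.symm fun e he => by
      have h2 : A *ᵥ e ∈ (Submodule.span ℂ {X}).restrictScalars ℝ := by
        refine mulVec_mem_of_exp fun t => ?_
        obtain ⟨β, e⟩ := (hm t).map_perp _ he
        rw [e, add_sub_cancel_left]
        exact Submodule.smul_mem (Submodule.span ℂ {X}) _ (Submodule.mem_span_singleton_self X)
      obtain ⟨β, hβ⟩ := Submodule.mem_span_singleton.1 (Submodule.restrictScalars_mem ℝ _ _ |>.1 h2)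
      exact ⟨β, hβ.symm⟩
    have h3 : solv P X (σ, f, r) *ᵥ P ∈ slice P X (tanPart P X V) :=
      mulVec_mem_of_exp fun t => sub_mem ((hm t).map_slice _ (h.frame.P_mem_slice _))
        (h.frame.P_mem_slice _)
    rw [h.frame.solv_P _ _ hf] at h3
    have h4 := (mem_slice.1 h3).2
    rw [real_smul_eq_coe_smul] at h4
    simp only [map_add, map_sub, map_smul, h.frame.projE_X, h.frame.projE_P,
      IsFrame.projE_perp hf, sub_zero, smul_zero, zero_add] at h4
    exact mem_solvSub.2 ⟨σ, r, f, h4, rfl⟩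
  · intro A hA
    refine Submodule.subset_span ⟨hsu hA, fun t => ?_⟩
    exact exists_mem_expSubgroup hsu (Submodule.smul_mem _ t hA)

end IsAdapted

end ComplexHyperbolic
end

noncomputable section

namespace ComplexHyperbolic

/-! ### The normal bundle of the totally geodesic submanifold -/

theorem hasDerivAt_homog {n : ℕ} {γ : ℝ → CE n} {τ : CE n} {t : ℝ} (h : HasDerivAt γ τ t) :
    HasDerivAt (fun s => homog (γ s)) (tvec τ) t := by
  have e : (fun s => homog (γ s)) = fun s => homog (0 : CE n) + tvec (γ s) := by
    funext s
    rw [← homog_add, zero_add]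
  rw [e]
  let L : CE n →L[ℝ] HV n := LinearMap.toContinuousLinearMap ((tvec (n := n)).restrictScalars ℝ)
  exact (L.hasFDerivAt.comp_hasDerivAt t h).const_add _

theorem hasDerivAt_mem {n : ℕ} {K : Submodule ℝ (HV n)} {f : ℝ → HV n} {f' : HV n} {t : ℝ}
    (hf : ∀ s, f s ∈ K) (h : HasDerivAt f f' t) : f' ∈ K := by
  have hcl : IsClosed (K : Set (HV n)) := K.closed_of_finiteDimensional
  refine hcl.mem_of_tendsto (hasDerivAt_iff_tendsto_slope.1 h)
    (Filter.Eventually.of_forall fun s => ?_)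
  rw [slope_def_module]
  exact K.smul_mem _ (sub_mem (hf s) (hf t))

theorem tvec_dpr_mem {n : ℕ} {V : Submodule ℂ (HV n)} {P e : HV n} (hP : (q P P).re < 0)
    (hPV : P ∈ V) (he : e ∈ V) : tvec (dpr P e) ∈ V := by
  have h0 := zero_ne_of_neg hP
  have h1 : P 0 • tvec (dpr P e) = e - (e 0 / P 0) • P := by
    rw [eq_sub_iff_add_eq, ← eq_tvec_add h0 e]
  have h2 : tvec (dpr P e) = (P 0)⁻¹ • (e - (e 0 / P 0) • P) := by
    rw [← h1, inv_smul_smul₀ h0]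
  rw [h2]
  exact V.smul_mem _ (sub_mem he (V.smul_mem _ hPV))

/-- The vectors orthogonal to `V` that are horizontal lifts of the elements of `v`. -/
def vertPart {n : ℕ} (P : HV n) (V : Submodule ℂ (HV n)) (v : Submodule ℝ (CE n)) :
    Submodule ℝ (HV n) where
  carrier := {w | (∀ u ∈ V, q u w = 0) ∧ dpr P w ∈ v}
  zero_mem' := ⟨fun u _ => q_zero_right u, by simp⟩
  add_mem' := fun {a b} ha hb => ⟨fun u hu => by
    rw [q_add_right, ha.1 u hu, hb.1 u hu, add_zero], by rw [map_add]; exact add_mem ha.2 hb.2⟩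
  smul_mem' := fun r a ha => ⟨fun u hu => by rw [q_rsmul_right, ha.1 u hu, mul_zero], by
    rw [dpr_rsmul]; exact v.smul_mem r ha.2⟩

namespace IsAdapted

variable {n : ℕ} {P X : HV n} {V : Submodule ℂ (HV n)} {S : Set (CE n)}

theorem dpr_mem_normalSpace (h : IsAdapted P X V S) {c : ℝ} (hc : c < 0) {u w : HV n} (hu : u ∈ V)
    (huu : q u u = -1) (hw : ∀ e ∈ V, q e w = 0) : dpr u w ∈ normalSpace c S (pr u) := by
  have hn : (q u u).re < 0 := by simp [huu]
  have h0 := zero_ne_of_neg hn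
  rintro τ ⟨γ, hγ, hγS, hγ0, rfl⟩
  have hd : HasDerivAt γ (deriv γ 0) 0 := (hγ.differentiable (by simp) 0).hasDerivAt
  have h1 : tvec (deriv γ 0) ∈ V := hasDerivAt_mem (K := V.restrictScalars ℝ)
    (fun s => ((h.mem_iff _).1 (hγS s)).2) (hasDerivAt_homog hd)
  have h2 : deriv γ 0 = dpr u (u 0 • tvec (deriv γ 0)) := by
    rw [map_smul, dpr_tvec, smul_inv_smul₀ h0]
  change metric c (pr u) (deriv γ 0) (dpr u w) = 0
  rw [h2, metric_dpr_unit hc huu, hw u hu, hw _ (V.smul_mem _ h1)]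
  simp

theorem q_hlift_eq_zero (h : IsAdapted P X V S) {c : ℝ} (hc : c < 0) {ξ : CE n}
    (hξ : ξ ∈ normalSpace c S (pr P)) {u : HV n} (hu : u ∈ V) : q u (hlift P ξ) = 0 := by
  have hP := h.frame.neg
  have key : ∀ e ∈ V, (q e (hlift P ξ)).re = 0 := by
    intro e he
    have hτV := tvec_dpr_mem hP h.P_mem he
    obtain ⟨τ, hτ⟩ : ∃ τ, τ = dpr P e := ⟨_, rfl⟩
    rw [← hτ] at hτV
    have ho := (h.mem_iff _).1 h.o_mem
    have ho1 : ‖pr P‖ < 1 := by simpa [CH] using ho.1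
    obtain ⟨ε, hε, hε1⟩ : ∃ ε : ℝ, 0 < ε ∧ ‖pr P‖ + ε * ‖τ‖ < 1 := by
      have hτ0 := norm_nonneg τ
      have h1 : 0 < 1 - ‖pr P‖ := by linarith
      refine ⟨(1 - ‖pr P‖) / (‖τ‖ + 1), by positivity, ?_⟩
      have h2 : (1 - ‖pr P‖) / (‖τ‖ + 1) * ‖τ‖ < 1 - ‖pr P‖ := by
        rw [div_mul_eq_mul_div, div_lt_iff₀ (by positivity)]
        nlinarith
      linarith
    have hγ : ε • τ ∈ tangentVectors S (pr P) := by
      refine ⟨fun t => pr P + Real.sin t • ε • τ,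
        contDiff_const.add (Real.contDiff_sin.smul contDiff_const), fun t => ?_, by simp, ?_⟩
      · rw [h.mem_iff, homog_add]
        refine ⟨?_, add_mem ho.2 ?_⟩
        · rw [CH, mem_ball_zero_iff]
          refine (norm_add_le _ _).trans_lt (lt_of_le_of_lt ?_ hε1)
          rw [norm_smul, norm_smul, Real.norm_eq_abs, Real.norm_eq_abs, abs_of_pos hε]
          have := mul_le_mul_of_nonneg_right (Real.abs_sin_le_one t)
            (mul_nonneg hε.le (norm_nonneg τ))
          linarith
        · have e1 : tvec (Real.sin t • ε • τ) = ((Real.sin t * ε : ℝ) : ℂ) • tvec τ := by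
            rw [smul_smul, ← map_smul, RCLike.real_smul_eq_coe_smul (K := ℂ)]
            rfl
          rw [e1]
          exact V.smul_mem _ hτV
      · have := ((Real.hasDerivAt_sin 0).smul_const (ε • τ)).const_add (pr P)
        rw [Real.cos_zero, one_smul] at this
        exact this.deriv
    have h1 := hξ _ hγ
    rw [map_smul, LinearMap.smul_apply, smul_eq_zero, or_iff_right hε.ne'] at h1
    change metric c (pr P) τ ξ = 0 at h1
    have h2 : ξ = dpr P (hlift P ξ) := (dpr_hlift hP ξ).symm
    rw [hτ, h2, metric_dpr_unit hc h.frame.PP, q_hlift hP ξ, mul_zero,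
      zero_add, mul_eq_zero] at h1
    exact h1.resolve_left (inv_ne_zero (pow_ne_zero 2 (rate_pos hc).ne'))
  apply Complex.ext
  · exact key u hu
  · have h1 := key _ (V.smul_mem Complex.I hu)
    rw [q_smul_left] at h1
    simpa using h1

variable {v : Submodule ℝ (CE n)}

theorem vertPart_le (h : IsAdapted P X V S) : ∀ w ∈ vertPart P V v, w ∈ perp P X :=
  fun _ hw => mem_perp.2 ⟨hw.1 P h.P_mem, hw.1 X h.X_mem⟩

theorem hlift_mem_vertPart (h : IsAdapted P X V S) {c : ℝ} (hc : c < 0)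
    (hv : v ≤ normalSpace c S (pr P)) {η : CE n} (hη : η ∈ v) : hlift P η ∈ vertPart P V v :=
  ⟨fun _ hu => h.q_hlift_eq_zero hc (hv hη) hu, by rwa [dpr_hlift h.frame.neg]⟩

/-- The simply transitive group fixes the orthogonal complement of `V`. -/
theorem mat_mulVec_of_orthogonal (h : IsAdapted P X V S) {g : SU1 n}
    (hg : g ∈ expSubgroup (solvSub P X (tanPart P X V))) {w : HV n} (hw : ∀ u ∈ V, q u w = 0) :
    mat g *ᵥ w = w := by
  have hm := isFlagMap_of_mem h.frame tanPart_le hg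
  obtain ⟨β, hβ⟩ := hm.map_perp w (mem_perp.2 ⟨hw P h.P_mem, hw X h.X_mem⟩)
  have hL := hm.isNormLift h.frame
  have hPV := (h.mem_slice_iff.1 (hm.map_slice _ (h.frame.P_mem_slice _))).2
  have h1 := q_mat g P w
  rw [hβ, q_add_right, q_smul_right, hw _ hPV, hw P h.P_mem, zero_add, mul_eq_zero] at h1
  have h2 : q (mat g *ᵥ P) X ≠ 0 := by
    intro h3
    have h4 := hL.re
    rw [q_comm_zero h3] at h4
    simp at h4
  rw [hβ, h1.resolve_right h2, zero_smul, add_zero]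

end IsAdapted

theorem differentiableAt_act {n : ℕ} {A : Mat n} {z : CE n} (h0 : (A *ᵥ homog z) 0 ≠ 0) :
    DifferentiableAt ℝ (act A) z := by
  have e : act A = fun z => pr (A *ᵥ homog (0 : CE n) + A *ᵥ tvec z) := by
    funext z
    rw [act_eq_pr, ← Matrix.mulVec_add, ← homog_add, zero_add]
  let L : CE n →L[ℝ] HV n :=
    LinearMap.toContinuousLinearMap ((A.mulVecLin ∘ₗ tvec).restrictScalars ℝ)
  have hW : ContDiffAt ℝ 1 (fun z : CE n => A *ᵥ homog (0 : CE n) + A *ᵥ tvec z) z :=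
    contDiffAt_const.add L.contDiff.contDiffAt
  have h0' : (A *ᵥ homog (0 : CE n) + A *ᵥ tvec z) 0 ≠ 0 := by
    rwa [← Matrix.mulVec_add, ← homog_add, zero_add]
  rw [e]
  refine ContDiffAt.differentiableAt (n := 1)
    (ContDiffAt.smul (ContDiffAt.inv (contDiffAt_pi.1 hW 0) h0') ?_) (by simp)
  exact (LinearMap.toContinuousLinearMap
    ((tl : HV n →ₗ[ℂ] CE n).restrictScalars ℝ)).contDiff.contDiffAt.comp z hW

theorem fderiv_act_pr {n : ℕ} (g : SU1 n) {P : HV n} (hP : (q P P).re < 0) (w : HV n) :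
    fderiv ℝ (act (mat g)) (pr P) (dpr P w) = dpr (mat g *ᵥ P) (mat g *ᵥ w) := by
  have h0 := zero_ne_of_neg hP
  have h1 := zero_ne_of_neg (q_mat_self_neg g hP)
  have e1 : mat g *ᵥ homog (pr P) = (P 0)⁻¹ • (mat g *ᵥ P) := by
    rw [homog_pr h0, Matrix.mulVec_smul]
  have h2 : (mat g *ᵥ homog (pr P)) 0 ≠ 0 := by
    rw [e1]
    exact mul_ne_zero (inv_ne_zero h0) h1
  have hγ : HasDerivAt (fun t : ℝ => pr P + t • dpr P w) (dpr P w) 0 := by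
    simpa using ((hasDerivAt_id (0 : ℝ)).smul_const (dpr P w)).const_add (pr P)
  have d1 := (differentiableAt_act h2).hasFDerivAt.comp_hasDerivAt_of_eq (0 : ℝ) hγ (by simp)
  let L : HV n →L[ℝ] HV n := LinearMap.toContinuousLinearMap ((mat g).mulVecLin.restrictScalars ℝ)
  have d2 : HasDerivAt (fun t : ℝ => pr (mat g *ᵥ homog (pr P + t • dpr P w)))
      (dpr (mat g *ᵥ homog (pr P)) (mat g *ᵥ tvec (dpr P w))) 0 := by
    have := hasDerivAt_pr (L.hasFDerivAt.comp_hasDerivAt (0 : ℝ) (hasDerivAt_homog hγ))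
      (by simpa [L] using h2)
    simpa [L] using this
  have d3 : HasDerivAt (fun t : ℝ => pr (mat g *ᵥ homog (pr P + t • dpr P w)))
      (fderiv ℝ (act (mat g)) (pr P) (dpr P w)) 0 := by
    refine d1.congr_of_eventuallyEq (Filter.Eventually.of_forall fun t => ?_)
    exact (act_eq_pr _ _).symm
  rw [d3.unique d2, e1, dpr_smul (inv_ne_zero h0), inv_inv, ← map_smul, ← Matrix.mulVec_smul]
  conv_rhs => rw [eq_tvec_add h0 w, Matrix.mulVec_add, Matrix.mulVec_smul _ (w 0 / P 0), map_add,
    map_smul _ (w 0 / P 0), dpr_self h1, smul_zero, add_zero]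

namespace IsAdapted

variable {n : ℕ} {P X : HV n} {V : Submodule ℂ (HV n)} {S : Set (CE n)} {v : Submodule ℝ (CE n)}

theorem leftTranslate_eq (h : IsAdapted P X V S) {c : ℝ} (hc : c < 0)
    (hv : v ≤ normalSpace c S (pr P)) {u : HV n} (hu : u ∈ V) (hL : IsNormLift X u) :
    leftTranslate (expSubgroup (solvSub P X (tanPart P X V))) v (pr P) (pr u)
      = dpr u '' (vertPart P V v) := by
  have hP := h.frame.neg
  have h0 := zero_ne_of_neg hP
  ext ξ
  constructor
  · rintro ⟨g, hg, e, η, hη, rfl⟩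
    rw [act_pr _ h0] at e
    have hgP := ((isFlagMap_of_mem h.frame tanPart_le hg).isNormLift h.frame).unique hL e
    have hw := h.hlift_mem_vertPart hc hv hη
    refine ⟨hlift P η, hw, ?_⟩
    rw [← h.mat_mulVec_of_orthogonal hg hw.1, ← hgP, ← fderiv_act_pr g hP, dpr_hlift hP]
  · rintro ⟨w, hw, rfl⟩
    obtain ⟨g, hg, hgP⟩ := exists_mulVec_eq h.frame tanPart_le (h.mem_slice_iff.2 ⟨hL.im, hu⟩) hL
    refine ⟨g, hg, by rw [act_pr _ h0, hgP], dpr P w, hw.2, ?_⟩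
    rw [fderiv_act_pr g hP, hgP, h.mat_mulVec_of_orthogonal hg hw.1]

theorem isNormalSubbundle (h : IsAdapted P X V S) {c : ℝ} (hc : c < 0)
    (hv : v ≤ normalSpace c S (pr P)) : IsNormalSubbundle c S (Module.finrank ℝ v)
      (leftTranslate (expSubgroup (solvSub P X (tanPart P X V))) v (pr P)) := by
  have hP := h.frame.neg
  have key : ∀ p ∈ S, ∃ u ∈ V, IsNormLift X u ∧ pr u = p := by
    intro p hp
    rw [h.eq_slicePts] at hp
    obtain ⟨u, hu, hL, e⟩ := hp
    exact ⟨u, (h.mem_slice_iff.1 hu).2, hL, e⟩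
  intro p hp
  refine ⟨?_, Set.univ, isOpen_univ, trivial, ?_⟩
  · obtain ⟨u, hu, hL, rfl⟩ := key p hp
    rw [h.leftTranslate_eq hc hv hu hL]
    rintro _ ⟨w, hw, rfl⟩
    exact h.dpr_mem_normalSpace hc hu hL.self hw.1
  · let b := Module.finBasis ℝ v
    let w : Fin (Module.finrank ℝ v) → HV n := fun i => hlift P (b i : CE n)
    refine ⟨fun i z => (-q X (homog z)) • (tl (w i) - w i 0 • z), fun i => ?_, ?_⟩
    · have e : (fun z : CE n => q X (homog z)) = fun z => inner ℂ (tl X) z - (starRingEnd ℂ) (X 0) := by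
        funext z
        simp [q]
      have e1 : ContDiff ℝ ∞ (fun z : CE n => q X (homog z)) := by
        rw [e]
        exact (contDiff_const.inner ℂ contDiff_id).sub contDiff_const
      exact (e1.neg.smul (contDiff_const.sub (contDiff_id.const_smul (w i 0)))).contDiffOn
    · rintro p ⟨hp, -⟩
      obtain ⟨u, hu, hL, rfl⟩ := key p hp
      have hu0 := zero_ne_of_neg hL.neg
      set y : ℝ := -(q X u).re with hy
      have hy0 : y ≠ 0 := by have := hL.re; linarith
      let ψ : v →ₗ[ℝ] CE n :=
        y • ((dpr u ∘ₗ hlift P).restrictScalars ℝ ∘ₗ v.subtype)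
      have hψ : ∀ η : v, ψ η = y • dpr u (hlift P (η : CE n)) := fun η => rfl
      have hX : (fun i => (-q X (homog (pr u))) • (tl (w i) - w i 0 • pr u)) = ψ ∘ b := by
        funext i
        have e1 : tl (w i) - w i 0 • pr u = u 0 • dpr u (w i) := by
          rw [dpr_apply, smul_inv_smul₀ hu0]
        rw [e1, homog_pr hu0, q_smul_right, hL.q_eq, smul_smul, Function.comp, hψ,
          RCLike.real_smul_eq_coe_smul (K := ℂ)]
        congr 1
        rw [hy]
        push_cast
        field_simp
        rfl
      have hker : LinearMap.ker ψ = ⊥ := by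
        rw [LinearMap.ker_eq_bot']
        intro η hη
        rw [hψ, smul_eq_zero, or_iff_right hy0] at hη
        have h1 := dpr_eq_zero hu0 hη
        have hw := h.hlift_mem_vertPart hc hv η.2
        have h2 := hw.1 u hu
        rw [h1, q_smul_right, hL.self, mul_neg, mul_one, neg_eq_zero] at h2
        rw [h2, zero_smul] at h1
        have h3 := dpr_hlift hP (η : CE n)
        rw [h1, map_zero] at h3
        exact Subtype.ext h3.symm
      rw [h.leftTranslate_eq hc hv hu hL]
      beta_reduce
      rw [hX]
      refine ⟨b.linearIndependent.map' ψ hker, ?_⟩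
      rw [Set.range_comp, Submodule.span_image, b.span_eq, Submodule.map_top]
      ext ξ
      constructor
      · rintro ⟨η, rfl⟩
        refine ⟨y • hlift P (η : CE n), Submodule.smul_mem _ _ (h.hlift_mem_vertPart hc hv η.2), ?_⟩
        rw [hψ, dpr_rsmul]
      · rintro ⟨w, hw, rfl⟩
        refine ⟨⟨y⁻¹ • dpr P w, v.smul_mem _ hw.2⟩, ?_⟩
        rw [hψ]
        change y • dpr u (hlift P (y⁻¹ • dpr P w)) = dpr u w
        rw [← dpr_rsmul, ← dpr_rsmul, hlift_dpr hP (by rw [q_rsmul_right, hw.1 P h.P_mem, mul_zero]),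
          smul_inv_smul₀ hy0]

end IsAdapted

end ComplexHyperbolic
end

noncomputable section

namespace ComplexHyperbolic

/-! ### The subspaces of the solvable algebra -/

/-- The identification of `perp P X` with `𝔤_α`. -/
def nil {n : ℕ} (P X : HV n) : HV n →ₗ[ℝ] Mat n :=
  solv P X ∘ₗ LinearMap.inr ℝ ℝ (HV n × ℝ) ∘ₗ LinearMap.inl ℝ (HV n) ℝ

theorem nil_apply {n : ℕ} (P X w : HV n) : nil P X w = solv P X (0, w, 0) := rfl

/-- The explicit form of the Iwasawa decomposition in a frame. -/
structure IsSolvFrame {n : ℕ} (P X : HV n) (a : Submodule ℝ (Mat n)) (α : a →ₗ[ℝ] ℝ) :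
    Prop where
  mem_a : ∀ A, A ∈ a ↔ ∃ s, A = solv P X (s, 0, 0)
  mem_root : ∀ A, A ∈ rootSpace a α ↔ ∃ w ∈ perp P X, A = solv P X (0, w, 0)
  mem_root_two : ∀ A, A ∈ rootSpace a ((2 : ℝ) • α) ↔ ∃ s, A = solv P X (0, 0, s)

theorem solv_eq_add {n : ℕ} (P X : HV n) (s r : ℝ) (w : HV n) :
    solv P X (s, w, r) = solv P X (s, 0, 0) + nil P X w + solv P X (0, 0, r) := by
  rw [nil_apply, ← map_add, ← map_add]
  simp

namespace IsSolvFrame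

variable {n : ℕ} {P X : HV n} {a : Submodule ℝ (Mat n)} {α : a →ₗ[ℝ] ℝ}

theorem sup_eq (h : IsSolvFrame P X a α) (F : Submodule ℝ (HV n)) :
    a ⊔ F.map (nil P X) ⊔ rootSpace a ((2 : ℝ) • α) = solvSub P X F := by
  apply le_antisymm
  · refine sup_le (sup_le (fun A hA => ?_) ?_) fun A hA => ?_
    · obtain ⟨s, rfl⟩ := (h.mem_a A).1 hA
      exact mem_solvSub.2 ⟨s, 0, 0, zero_mem F, rfl⟩
    · rintro _ ⟨w, hw, rfl⟩
      exact mem_solvSub.2 ⟨0, 0, w, hw, rfl⟩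
    · obtain ⟨s, rfl⟩ := (h.mem_root_two A).1 hA
      exact mem_solvSub.2 ⟨0, s, 0, zero_mem F, rfl⟩
  · intro A hA
    obtain ⟨s, r, w, hw, rfl⟩ := mem_solvSub.1 hA
    rw [solv_eq_add]
    exact Submodule.add_mem_sup (Submodule.add_mem_sup ((h.mem_a _).2 ⟨s, rfl⟩)
      (Submodule.mem_map_of_mem hw)) ((h.mem_root_two _).2 ⟨r, rfl⟩)

theorem sup_root_two (h : IsSolvFrame P X a α) :
    a ⊔ rootSpace a ((2 : ℝ) • α) = solvSub P X ⊥ := by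
  rw [← h.sup_eq, Submodule.map_bot, sup_bot_eq]

theorem rootSpace_eq (h : IsSolvFrame P X a α) :
    rootSpace a α = ((perp P X).restrictScalars ℝ).map (nil P X) := by
  ext A
  rw [h.mem_root]
  constructor
  · rintro ⟨w, hw, rfl⟩
    exact ⟨w, hw, rfl⟩
  · rintro ⟨w, hw, rfl⟩
    exact ⟨w, hw, rfl⟩

theorem solvAlg_eq (h : IsSolvFrame P X a α) :
    solvAlg a α = solvSub P X ((perp P X).restrictScalars ℝ) := by
  rw [solvAlg, h.rootSpace_eq, h.sup_eq]

end IsSolvFrame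

theorem IsFrame.metric_solv {n : ℕ} {P X : HV n} (h : IsFrame P X) {c : ℝ} (hc : c < 0)
    (s r s' r' : ℝ) {w : HV n} (hw : w ∈ perp P X) :
    metric c (pr P) (dpr P (solv P X (s', 0, r') *ᵥ P)) (dpr P (solv P X (s, w, r) *ᵥ P))
      = (rate c ^ 2)⁻¹ * (s' * s + r' * r) := by
  have h1 := (mem_perp.1 hw).1
  have h2 := (mem_perp.1 hw).2
  rw [metric_dpr_unit hc h.PP, h.solv_P _ _ hw, h.solv_P _ _ (zero_mem _)]
  simp only [add_zero, q_sub_left, q_add_right, q_sub_right, q_smul_left, q_smul_right,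
    q_rsmul_left, q_rsmul_right, h.XX, h.XP, h.PX, h.PP, h1, h2]
  congr 1
  simp
  ring

theorem IsAdapted.hPart_eq {n : ℕ} {P X : HV n} {V : Submodule ℂ (HV n)} {S : Set (CE n)}
    {a : Submodule ℝ (Mat n)} {α : a →ₗ[ℝ] ℝ} (h : IsAdapted P X V S) (hI : IsSolvFrame P X a α)
    {c : ℝ} (hc : c < 0) {o : CE n} (ho : pr P = o)
    (hov : ∀ A, orbitVelocity o A = dpr P (A *ᵥ P)) :
    hPart c o a α (expSubgroup (solvSub P X (tanPart P X V)))
      = (tanPart P X V).map (nil P X) := by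
  have hl : (rate c ^ 2)⁻¹ ≠ 0 := inv_ne_zero (pow_ne_zero 2 (rate_pos hc).ne')
  rw [hPart, h.lieAlg_eq, hI.sup_root_two]
  subst ho
  ext A
  constructor
  · rintro ⟨hA, hort⟩
    obtain ⟨s, r, w, hw, rfl⟩ := mem_solvSub.1 hA
    have key : ∀ s' r' : ℝ, s' * s + r' * r = 0 := by
      intro s' r'
      have h1 : metric c (pr P) _ _ = 0 := hort _ (mem_solvSub.2 ⟨s', r', 0, zero_mem _, rfl⟩)
      rw [hov, hov, h.frame.metric_solv hc _ _ _ _ hw.2] at h1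
      exact (mul_eq_zero.1 h1).resolve_left hl
    have e1 : s = 0 := by simpa using key 1 0
    have e2 : r = 0 := by simpa using key 0 1
    exact ⟨w, hw, by rw [e1, e2, nil_apply]⟩
  · rintro ⟨w, hw, rfl⟩
    refine ⟨mem_solvSub.2 ⟨0, 0, w, hw, rfl⟩, fun B hB => ?_⟩
    obtain ⟨s', r', w', hw', rfl⟩ := mem_solvSub.1 hB
    rw [(Submodule.mem_bot ℝ).1 hw']
    change metric c (pr P) _ _ = 0
    rw [hov, hov, nil_apply, h.frame.metric_solv hc _ _ _ _ hw.2]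
    simp

theorem IsAdapted.vPart_eq {n : ℕ} {P X : HV n} {V : Submodule ℂ (HV n)} {S : Set (CE n)}
    {a : Submodule ℝ (Mat n)} {α : a →ₗ[ℝ] ℝ} (h : IsAdapted P X V S) (hI : IsSolvFrame P X a α)
    {c : ℝ} (hc : c < 0) {o : CE n} (hov : ∀ A, orbitVelocity o A = dpr P (A *ᵥ P))
    {v : Submodule ℝ (CE n)} (hv : v ≤ normalSpace c S (pr P)) :
    vPart o a α v = (vertPart P V v).map (nil P X) := by
  have hP := h.frame.neg
  have hnil : ∀ w ∈ perp P X, nil P X w *ᵥ P = w := fun w hw => by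
    rw [nil_apply, h.frame.solv_P _ _ hw]
    simp
  rw [vPart, hI.solvAlg_eq]
  ext A
  constructor
  · rintro ⟨hA, hAv⟩
    obtain ⟨s, r, w, hw, rfl⟩ := mem_solvSub.1 hA
    rw [SetLike.mem_coe, Submodule.mem_comap, hov, h.frame.solv_P _ _ hw] at hAv
    set B := s • (X - P) + w - (Complex.I * r) • X with hB
    have h1 := (mem_perp.1 hw).1
    have h2 := (mem_perp.1 hw).2
    have e1 : q P B = Complex.I * r := by
      simp only [hB, q_add_right, q_sub_right, q_smul_right, q_rsmul_right, h.frame.PX, h.frame.PP,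
        h1]
      ring
    have e2 : hlift P (dpr P B) = B + (Complex.I * r) • P := by
      have e3 : dpr P (B + (Complex.I * r) • P) = dpr P B := by
        rw [map_add, map_smul, dpr_self (zero_ne_of_neg hP), smul_zero, add_zero]
      rw [← e3, hlift_dpr hP]
      rw [q_add_right, q_smul_right, e1, h.frame.PP]
      ring
    have e3 := (h.hlift_mem_vertPart hc hv hAv).1 X h.X_mem
    rw [e2] at e3
    simp only [hB, q_add_right, q_sub_right, q_smul_right, q_rsmul_right, h.frame.XX, h.frame.XP,
      h2] at e3
    have hs : s = 0 := by simpa using congrArg Complex.re e3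
    have hr : r = 0 := by simpa using congrArg Complex.im e3
    have hBw : B = w := by rw [hB, hs, hr]; simp
    have e4 := h.hlift_mem_vertPart hc hv hAv
    rw [e2, hBw, hr, Complex.ofReal_zero, mul_zero, zero_smul, add_zero] at e4
    exact ⟨w, e4, by rw [hs, hr, nil_apply]⟩
  · rintro ⟨w, hw, rfl⟩
    have hw' := h.vertPart_le w hw
    refine ⟨mem_solvSub.2 ⟨0, 0, w, hw', rfl⟩, ?_⟩
    rw [SetLike.mem_coe, Submodule.mem_comap, hov, hnil w hw']
    exact hw.2

theorem IsAdapted.disjoint_nil {n : ℕ} {P X : HV n} {V : Submodule ℂ (HV n)} {S : Set (CE n)}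
    (h : IsAdapted P X V S) (v : Submodule ℝ (CE n)) :
    Disjoint ((tanPart P X V).map (nil P X)) ((vertPart P V v).map (nil P X)) := by
  rw [Submodule.disjoint_def]
  rintro _ ⟨w, hw, rfl⟩ ⟨w', hw', e⟩
  rw [nil_apply, nil_apply] at e
  obtain ⟨-, e1, -⟩ := h.frame.solv_injective (h.vertPart_le w' hw') hw.2
    (congrArg (fun A => A *ᵥ P) e)
  subst e1
  have h1 := hw'.1 w' hw.1
  have h2 := (q_self_nonneg_of_orthogonal h.frame.neg (hw'.1 P h.P_mem)).2 (by simp [h1])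
  rw [h2, map_zero]

end ComplexHyperbolic
end

noncomputable section

namespace ComplexHyperbolic

/-! ### Attaching horocycles -/

theorem normEnd_smul {n : ℕ} {X v : HV n} {κ : ℂ} (hκ : κ ≠ 0) :
    normEnd (κ • X) v = normEnd X v := by
  rw [normEnd, normEnd, q_smul_right, smul_smul]
  congr 1
  field_simp

theorem IsNormLift.normEnd_eq {n : ℕ} {X u : HV n} (h : IsNormLift X u) :
    normEnd X u = (-(q X u).re)⁻¹ • X := by
  rw [normEnd, ← q_conj X u, h.q_eq, Complex.conj_ofReal, ← h.q_eq, real_smul_eq_coe_smul]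
  congr 1
  push_cast
  rw [inv_neg, ← h.q_eq]

theorem slice_mono {n : ℕ} {P X : HV n} {F F' : Submodule ℝ (HV n)} (h : F ≤ F') :
    slice P X F ≤ slice P X F' := fun _ hv => ⟨hv.1, h hv.2⟩

theorem mem_slice_of_mem {n : ℕ} {P X w : HV n} {F : Submodule ℝ (HV n)} (hw : w ∈ F)
    (hE : w ∈ perp P X) : w ∈ slice P X F := by
  rw [mem_slice, IsFrame.projE_perp hE, (mem_perp.1 hE).2]
  exact ⟨rfl, hw⟩

theorem IsFrame.X_mem_slice {n : ℕ} {P X : HV n} (h : IsFrame P X) (F : Submodule ℝ (HV n)) :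
    X ∈ slice P X F := by
  rw [mem_slice, h.projE_X, h.XX]
  exact ⟨rfl, zero_mem F⟩

theorem IsNormLift.isHoroData {n : ℕ} {l : ℝ} {X u w : HV n} (h : IsNormLift X u) (hX : q X X = 0)
    (huw : q u w = 0) (hXw : q X w = 0) (hww : q w w = ((l ^ 2 : ℝ) : ℂ)) :
    IsHoroData l u w (normEnd X u) := by
  have hX0 : X ≠ 0 := by
    rintro rfl
    have := h.re
    rw [q_zero_left] at this
    simp at this
  obtain ⟨h1, -, h3⟩ := normEnd_spec hX0 hX h.neg
  refine ⟨h.self, huw, hww, h1, h3, ?_⟩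
  rw [h.normEnd_eq, q_rsmul_left, hXw, mul_zero]

/-- Over a point of the submanifold, a horocycle is determined by a lift of its initial data. -/
theorem exists_horoLift {n : ℕ} {P X : HV n} {V : Submodule ℂ (HV n)} {S : Set (CE n)}
    (h : IsAdapted P X V S) {v : Submodule ℝ (CE n)} {L : HV n} (hL : IsNormLift X L)
    (hF : L ∈ slice P X (tanPart P X V ⊔ vertPart P V v)) {l : ℝ} (hl : 0 < l) :
    L ∈ V ∨ ∃ u ∈ V, IsNormLift X u ∧ ∃ w ∈ vertPart P V v, q w w = ((l ^ 2 : ℝ) : ℂ) ∧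
      ∃ s : ℝ, L = horoLift l u w (normEnd X u) s := by
  obtain ⟨f, hf, g, hg, e⟩ := Submodule.mem_sup.1 hF.2
  have hgE := h.vertPart_le g hg
  have hg1 := (mem_perp.1 hgE).1
  have hg2 := (mem_perp.1 hgE).2
  have hdec := IsFrame.decomp (P := P) (X := X) L
  rw [← e] at hdec
  have hM : L - g ∈ V := by
    have e1 : L - g = (q X L - q P L) • X - q X L • P + f := by
      conv_lhs => rw [hdec]
      abel
    rw [e1]
    exact add_mem (sub_mem (V.smul_mem _ h.X_mem) (V.smul_mem _ h.P_mem)) hf.1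
  rcases eq_or_ne g 0 with rfl | hg0
  · exact Or.inl (by simpa using hM)
  right
  obtain ⟨d0, d1⟩ := q_self_nonneg_of_orthogonal h.frame.neg hg1
  set d := (q g g).re with hd
  have hdpos : 0 < d := d0.lt_of_ne fun h0 => hg0 (d1 h0.symm)
  have hgg : q g g = (d : ℂ) := (q_self_ofReal g).symm
  set y : ℝ := -(q X L).re with hy
  have hy0 : 0 < y := by have := hL.re; linarith
  have hyC : (y : ℂ) ≠ 0 := by exact_mod_cast hy0.ne'
  have hXL : q X L = -(y : ℂ) := by rw [hL.q_eq, hy]; simp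
  set u : HV n := (L - g) - (d / (2 * y)) • X with hu
  have huV : u ∈ V := by
    rw [hu, real_smul_eq_coe_smul]
    exact sub_mem hM (V.smul_mem _ h.X_mem)
  have hXu : q X u = -(y : ℂ) := by
    rw [hu, q_sub_right, q_sub_right, q_rsmul_right, h.frame.XX, hg2, hXL]
    ring
  have hself : q u u = -1 := by
    have e1 : L = (u + g) + (d / (2 * y)) • X := by rw [hu]; abel
    have e2 := hL.self
    have huX : q u X = -(y : ℂ) := by rw [← q_conj, hXu]; simp
    rw [e1] at e2
    simp only [q_add_left, q_add_right, q_rsmul_left, q_rsmul_right, h.frame.XX, hXu, huX, hgg, hg2,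
      q_comm_zero hg2, hg.1 u huV, q_comm_zero (hg.1 u huV)] at e2
    push_cast at e2
    have e3 : 2 * (y : ℂ) * (d / (2 * y)) = d := by field_simp
    linear_combination e2 + e3
  have hLu : IsNormLift X u := by
    refine ⟨hself, ?_, ?_⟩
    · rw [hXu]; simp
    · rw [hXu]; simpa using hy0
  set s : ℝ := Real.sqrt d / l with hs
  have hs0 : 0 < s := div_pos (Real.sqrt_pos.2 hdpos) hl
  have hsl : s ^ 2 * l ^ 2 = d := by
    rw [hs, div_pow, Real.sq_sqrt hdpos.le, div_mul_cancel₀]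
    positivity
  refine ⟨u, huV, hLu, s⁻¹ • g, Submodule.smul_mem _ _ hg, ?_, s, ?_⟩
  · rw [q_rsmul_left, q_rsmul_right, hgg]
    norm_cast
    rw [← hsl]
    field_simp
  · rw [horoLift, smul_inv_smul₀ hs0.ne', hLu.normEnd_eq, hsl, hXu, smul_smul, hu]
    simp only [Complex.neg_re, Complex.ofReal_re, neg_neg]
    match_scalars
    · ring
    · ring
    · field_simp
      ring

theorem IsAdapted.attachHorocycles_eq {n : ℕ} {P X : HV n} {V : Submodule ℂ (HV n)}
    {S : Set (CE n)} (h : IsAdapted P X V S) {c : ℝ} (hc : c < 0) {x : Set (ℝ → CE n)}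
    (hx : ∀ (γ : ℝ → CE n) (u : HV n), q u u = -1 → pr u = γ 0 →
      (γ ∈ x ↔ γ = fun t => pr (geoLift (rate c) u (normEnd X u - u) t)))
    {v : Submodule ℝ (CE n)} (hv : v ≤ normalSpace c S (pr P)) :
    attachHorocycles c x S (leftTranslate (expSubgroup (solvSub P X (tanPart P X V))) v (pr P))
      = slicePts P X (tanPart P X V ⊔ vertPart P V v) := by
  have hl := rate_pos hc
  have hXX := h.frame.XX
  have hX0 := h.frame.X_ne
  have hderiv : ∀ u : HV n, q u u = -1 →
      deriv (fun t => pr (geoLift (rate c) u (normEnd X u - u) t)) 0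
        = rate c • dpr u (normEnd X u) := by
    intro u hu
    obtain ⟨e1, e2⟩ := normEnd_data hX0 hXX hu
    rw [deriv_pr_geoLift_zero hu e1 e2, map_sub,
      dpr_self (zero_ne_of_neg (w := u) (by simp [hu])), sub_zero]
  ext z
  constructor
  · rintro (hz | ⟨p, hp, U, hU, σ, ⟨k1, k2, k3, k4, k5, k6, γ, hγ, hγ0, k7⟩, t, rfl⟩)
    · rw [h.eq_slicePts] at hz
      obtain ⟨u, hu, hL, e⟩ := hz
      exact ⟨u, slice_mono le_sup_left hu, hL, e⟩
    · obtain ⟨u, hu, hL, rfl⟩ := h.eq_slicePts.subset hp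
      have huV := (h.mem_slice_iff.1 hu).2
      rw [h.leftTranslate_eq hc hv huV hL] at hU
      obtain ⟨w, hw, rfl⟩ := hU
      have hwE := h.vertPart_le w hw
      have hww : q w w = ((rate c ^ 2 : ℝ) : ℂ) := by
        have e1 := k5 0
        rw [k3, k4, metric_dpr_unit hc hL.self, hw.1 u huV, mul_zero, zero_add,
          inv_mul_eq_one₀ (by positivity)] at e1
        rw [e1, q_self_ofReal]
      have hD := hL.isHoroData hXX (hw.1 u huV) (mem_perp.1 hwE).2 hww
      rw [(hx γ u hL.self hγ0.symm).1 hγ, hderiv u hL.self, smul_smul] at k7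
      have hσ := hD.unique hc k1 k2 k3 k4 k6 (by rw [k7, rate, sq])
      have e1 : q X (horoLift (rate c) u w (normEnd X u) t) = q X u := by
        rw [horoLift, hL.normEnd_eq, q_add_right, q_add_right, q_rsmul_right, q_rsmul_right,
          q_rsmul_right, hXX, (mem_perp.1 hwE).2]
        ring
      refine ⟨horoLift (rate c) u w (normEnd X u) t, ?_, ⟨hD.self t, ?_, ?_⟩, (congrFun hσ t).symm⟩
      · rw [horoLift, hL.normEnd_eq]
        exact add_mem (add_mem (slice_mono le_sup_left hu) (Submodule.smul_mem _ _
          (mem_slice_of_mem (Submodule.mem_sup_right hw) hwE)))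
          (Submodule.smul_mem _ _ (Submodule.smul_mem _ _ (h.frame.X_mem_slice _)))
      · rw [e1]
        exact hL.im
      · rw [e1]
        exact hL.re
  · rintro ⟨L, hLF, hL, rfl⟩
    rcases exists_horoLift h hL hLF hl with hV | ⟨u, huV, hu, w, hw, hww, s, rfl⟩
    · exact Or.inl (h.pr_mem hV hL.neg)
    · right
      have hwE := h.vertPart_le w hw
      have hD := hu.isHoroData hXX (hw.1 u huV) (mem_perp.1 hwE).2 hww
      obtain ⟨k1, k2, k3, k4, k5, k6, k7⟩ := hD.curve hc rfl
      obtain ⟨γ, hγ⟩ : ∃ γ : ℝ → CE n, γ = fun t => pr (geoLift (rate c) u (normEnd X u - u) t) :=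
        ⟨_, rfl⟩
      have hγ0 : γ 0 = pr u := by rw [hγ]; exact congrArg pr (geoLift_zero _ _ _)
      refine ⟨pr u, h.pr_mem huV hu.neg, dpr u w, ?_, _, ⟨k1, k2, k3, k4, k5, k6, γ,
        (hx γ u hu.self hγ0.symm).2 hγ, hγ0, ?_⟩, s, rfl⟩
      · rw [h.leftTranslate_eq hc hv huV hu]
        exact ⟨w, hw, rfl⟩
      · rw [k7, hγ, hderiv u hu.self, smul_smul, rate, sq]

theorem isIsometry_id {n : ℕ} (c : ℝ) : IsIsometry c (id : CE n → CE n) :=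
  ⟨Set.bijOn_id _, contDiffOn_id, fun z _ u v => by rw [fderiv_id]; rfl⟩

/-- The frame at `o` determined by the point at infinity `x`. -/
theorem exists_adapted {n m : ℕ} {c : ℝ} (hc : c < 0) {S : Set (CE n)}
    (hS : IsTotallyGeodesicCH c m S) {o : CE n} (ho : o ∈ S) {x : Set (ℝ → CE n)}
    (hx : IsPointAtInfinity c x) (hxS : InIdealBoundary S x) {a : Submodule ℝ (Mat n)}
    {α : a →ₗ[ℝ] ℝ} (hI : IsIwasawa o x a α) :
    ∃ (P X : HV n) (V : Submodule ℂ (HV n)), IsAdapted P X V S ∧ IsSolvFrame P X a α ∧ pr P = o ∧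
      (∀ A, orbitVelocity o A = dpr P (A *ᵥ P)) ∧
      ∀ (γ : ℝ → CE n) (u : HV n), q u u = -1 → pr u = γ 0 →
        (γ ∈ x ↔ γ = fun t => pr (geoLift (rate c) u (normEnd X u - u) t)) := by
  obtain ⟨X₀, hX₀, hXX₀, hx₀⟩ := hx.exists_null hc
  obtain ⟨V, hV⟩ := hS.exists_subspace hc
  obtain ⟨ho1, ho2⟩ := (hV o).1 ho
  obtain ⟨r, hr, hP, hPo⟩ := exists_unit_lift ho1
  obtain ⟨hF, ha, h1, h2⟩ := hI.exists_frame hc hX₀ hXX₀ hx₀ hr.ne' rfl hP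
  have hXV : X₀ ∈ V := by
    obtain ⟨γ, hγ, hγS⟩ := hxS
    obtain ⟨hz1, hz2⟩ := (hV _).1 (hγS 0)
    obtain ⟨r', hr', hW, hW0⟩ := exists_unit_lift hz1
    set W := r' • homog (γ 0) with hWdef
    have hWV : W ∈ V := by
      rw [hWdef, real_smul_eq_coe_smul]
      exact V.smul_mem _ hz2
    have e := (hx₀ γ W hW hW0).1 hγ
    obtain ⟨d1, d2⟩ := normEnd_data hX₀ hXX₀ hW
    have hG := q_geoLift_self (l := rate c) hW d1 d2 1
    set G := geoLift (rate c) W (normEnd X₀ W - W) 1 with hGdef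
    have hG0 : G 0 ≠ 0 := zero_ne_of_neg (by simp [hG])
    have hGV : G ∈ V := by
      have h3 := ((hV _).1 (hγS 1)).2
      rw [e] at h3
      rw [← smul_homog_pr hG0]
      exact V.smul_mem _ h3
    have hs : Real.sinh (rate c * 1) ≠ 0 := by
      rw [mul_one, Ne, Real.sinh_eq_zero]
      exact (rate_pos hc).ne'
    have hN : normEnd X₀ W - W = (Real.sinh (rate c * 1))⁻¹ • (G - Real.cosh (rate c * 1) • W) := by
      rw [hGdef, geoLift, add_sub_cancel_left, inv_smul_smul₀ hs]
    have hNV : normEnd X₀ W ∈ V := by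
      have h3 : normEnd X₀ W - W ∈ V := by
        rw [hN, real_smul_eq_coe_smul, real_smul_eq_coe_smul]
        exact V.smul_mem _ (sub_mem hGV (V.smul_mem _ hWV))
      simpa using add_mem h3 hWV
    have hq : -(q W X₀)⁻¹ ≠ 0 := by
      refine neg_ne_zero.2 (inv_ne_zero fun h3 => ?_)
      exact q_ne_zero_of_null hX₀ hXX₀ (W := W) (by simp [hW]) (q_comm_zero h3)
    exact (V.smul_mem_iff hq).1 hNV
  refine ⟨r • homog o, normEnd X₀ (r • homog o), V, ⟨hF, ?_, V.smul_mem _ hXV, hV⟩, ⟨ha, h1, h2⟩,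
    hPo, fun A => orbitVelocity_eq_dpr_smul A hr.ne' rfl, ?_⟩
  · rw [real_smul_eq_coe_smul]
    exact V.smul_mem _ ho2
  · intro γ u hu hu0
    have hq : -(q (r • homog o) X₀)⁻¹ ≠ 0 := by
      refine neg_ne_zero.2 (inv_ne_zero fun h3 => ?_)
      exact q_ne_zero_of_null hX₀ hXX₀ hF.neg (q_comm_zero h3)
    have e : normEnd (normEnd X₀ (r • homog o)) u = normEnd X₀ u := normEnd_smul hq
    rw [hx₀ γ u hu hu0, e]

end ComplexHyperbolic
end

theorem mainTheorem7 (c : ℝ) (hc : c < 0) (n k : ℕ) (hk : 1 ≤ k) (hkn : k ≤ n - 1)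
    (S : Set (CE n)) (hS : IsTotallyGeodesicCH c (n - k) S)
    (o : CE n) (ho : o ∈ S)
    (x : Set (ℝ → CE n)) (hx : IsPointAtInfinity c x) (hxS : InIdealBoundary S x)
    (a : Submodule ℝ (Mat n)) (α : a →ₗ[ℝ] ℝ) (hI : IsIwasawa o x a α)
    (v : Submodule ℝ (CE n)) (hv : v < normalSpace c S o) (hvJ : v ⊓ v.map (J n) = ⊥) :
    (∃! H : Subgroup (SU1 n), H ≤ expSubgroup (solvAlg a α) ∧ ActsSimplyTransitively H S) ∧
    ∀ H : Subgroup (SU1 n), H ≤ expSubgroup (solvAlg a α) → ActsSimplyTransitively H S →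
      IsNormalSubbundle c S (Module.finrank ℝ v) (leftTranslate H v o) ∧
      Disjoint (hPart c o a α H) (vPart o a α v) ∧
      hPart c o a α H ⊔ vPart o a α v ≤ rootSpace a α ∧
      IsCongruent c (attachHorocycles c x S (leftTranslate H v o))
        (Wsub o a α (hPart c o a α H ⊔ vPart o a α v)) := by
  obtain ⟨P, X, V, hA, hF, hPo, hov, hx'⟩ := exists_adapted hc hS ho hx hxS hI
  have hvle : v ≤ normalSpace c S (pr P) := hPo ▸ hv.le
  have hE : ∀ w ∈ tanPart P X V ⊔ vertPart P V v, w ∈ perp P X := by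
    have : tanPart P X V ⊔ vertPart P V v ≤ (perp P X).restrictScalars ℝ :=
      sup_le IsAdapted.tanPart_le hA.vertPart_le
    exact this
  rw [hF.solvAlg_eq]
  constructor
  · refine ⟨expSubgroup (solvSub P X (tanPart P X V)),
      ⟨expSubgroup_mono (solvSub_mono IsAdapted.tanPart_le), ?_⟩,
      fun H hH => hA.eq_expSubgroup hH.1 hH.2⟩
    conv => rw [hA.eq_slicePts]
    exact actsSimplyTransitively_of_orbit hA.frame IsAdapted.tanPart_le
  · intro H hH hT
    obtain rfl := hA.eq_expSubgroup hH hT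
    rw [hA.hPart_eq hF hc hPo hov, hA.vPart_eq hF hc hov hvle]
    refine ⟨hPo ▸ hA.isNormalSubbundle hc hvle, hA.disjoint_nil v, ?_, id, isIsometry_id c, ?_⟩
    · rw [← Submodule.map_sup, hF.rootSpace_eq]
      exact Submodule.map_mono hE
    · rw [Set.image_id, ← hPo, hA.attachHorocycles_eq hc hx' hvle, Wsub, ← Submodule.map_sup,
        hF.sup_eq, orbit_eq_slicePts hA.frame hE]
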